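/- Let $k$ be an algebraically closed field of characteristic zero and let $A\neq 0$ be a finitely generated commutative associative unital $k$-algebra. Let $\mathfrak g=\mathfrak g_{\bar 0}\oplus\mathfrak g_{\bar 1}$ be a finite dimensional Lie superalgebra over $k$ which is one of the following: (a) a reductive Lie algebra, regarded as a Lie superalgebra with $\mathfrak g_{\bar 1}=0$; (b) a basic classical Lie superalgebra, that is, a simple Lie superalgebra for which the representation of $\mathfrak g_{\bar 0}$ on $\mathfrak g_{\bar 1}$ is completely reducible and which has a nondegenerate even invariant bilinear form; (c) isomorphic to $\mathfrak{sl}(n,n)$ for some $n\ge 1$. The Lie superalgebra $\mathfrak g\otimes A$ has even and odd parts $\mathfrak g_{\bar 0}\otimes A$ and $\mathfrak g_{\bar 1}\otimes A$ and bracket $[x\otimes a,y\otimes b]=[x,y]\otimes ab$. All modules are $\mathbb Z/2$-graded, and irreducibility refers to graded submodules. For a $(\mathfrak g\otimes A)$-module $V$, let $\operatorname{Ann}_A V$ be the sum of all ideals $I$ of $A$ with $(\mathfrak g\otimes I)V=0$. The support of $V$ is the set of maximal ideals of $A$ that contain $\operatorname{Ann}_A V$; the support is called reduced if $\operatorname{Ann}_A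 V$ is a radical ideal. For pairwise distinct maximal ideals $\mathfrak m_1,\dots,\mathfrak m_\ell$ of $A$ with residue field $k$, integers $n_1,\dots,n_\ell\ge 1$, and finite dimensional $(\mathfrak g\otimes A/\mathfrak m_i^{n_i})$-modules $V_i$, the module $V_1\otimes\cdots\otimes V_\ell$ over $\bigoplus_{i=1}^\ell\bigl(\mathfrak g\otimes A/\mathfrak m_i^{n_i}\bigr)$ (with the usual signs) becomes a $(\mathfrak g\otimes A)$-module through the canonical map $\mathfrak g\otimes A\to\bigoplus_{i=1}^\ell\bigl(\mathfrak g\otimes A/\mathfrak m_i^{n_i}\bigr)$. A module isomorphic to one obtained in this way is called a generalized evaluation module, and an evaluation module if this is possible with $n_1=\dots=n_\ell=1$. Let $V$ be an irreducible finite dimensional $(\mathfrak g\otimes A)$-module. Then: 1. $V$ is a generalized evaluation module if and only if its support is finite. 2. $V$ is an evaluation module if and only if its support is finite and reduced. -/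

import Mathlib

open scoped TensorProduct

noncomputable section

/-! ### Super vector spaces -/

/-- The Koszul sign `(-1)^{pq}` for parities `p, q ∈ ℤ/2`. -/
def superSign (k : Type*) [Field k] (p q : ZMod 2) : k := if p = 1 ∧ q = 1 then -1 else 1

/-- A `ℤ/2`-grading `V = V₀ ⊕ V₁` of a vector space. -/
structure SuperSpace (k V : Type*) [Field k] [AddCommGroup V] [Module k V] where
  part : ZMod 2 → Submodule k V
  isCompl_part : IsCompl (part 0) (part 1)

theorem ZMod.two_cases (p : ZMod 2) : p = 0 ∨ p = 1 := by
  revert p; decide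

namespace SuperSpace

variable {k V : Type*} [Field k] [AddCommGroup V] [Module k V] (S : SuperSpace k V)

theorem isCompl' (p : ZMod 2) : IsCompl (S.part p) (S.part (p + 1)) := by
  rcases ZMod.two_cases p with rfl | rfl
  · simpa using S.isCompl_part
  · have : (1 + 1 : ZMod 2) = 0 := by decide
    rw [this]; exact S.isCompl_part.symm

/-- The projection of `V` onto its component of parity `p`. -/
def proj (p : ZMod 2) : V →ₗ[k] V :=
  (S.part p).projection (S.part (p + 1)) (S.isCompl' p)

/-- The parity operator, `v ↦ (-1)^{|v|} v` on homogeneous `v`. -/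
def parityOp : V →ₗ[k] V := S.proj 0 - S.proj 1

/-- Graded subspaces: those containing the homogeneous components of each of their elements. -/
def IsGraded (W : Submodule k V) : Prop := ∀ w ∈ W, ∀ p, S.proj p w ∈ W

theorem proj_mem (p : ZMod 2) (v : V) : S.proj p v ∈ S.part p :=
  Submodule.projection_apply_mem _ _

theorem proj_of_mem {p : ZMod 2} {v : V} (h : v ∈ S.part p) : S.proj p v = v :=
  Submodule.projection_apply_of_mem_left _ h

theorem proj_of_mem_ne {p q : ZMod 2} {v : V} (hpq : p ≠ q) (h : v ∈ S.part q) :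
    S.proj p v = 0 := by
  refine Submodule.projection_apply_of_mem_right _ ?_
  have key : ∀ p q : ZMod 2, p ≠ q → q = p + 1 := by decide
  rwa [← key p q hpq]

theorem proj_add_proj (v : V) : S.proj 0 v + S.proj 1 v = v := by
  have h : v ∈ S.part 0 ⊔ S.part 1 := by
    rw [S.isCompl_part.sup_eq_top]; trivial
  obtain ⟨a, ha, b, hb, rfl⟩ := Submodule.mem_sup.1 h
  simp only [map_add, S.proj_of_mem ha, S.proj_of_mem hb,
    S.proj_of_mem_ne (show (0 : ZMod 2) ≠ 1 by decide) hb,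
    S.proj_of_mem_ne (show (1 : ZMod 2) ≠ 0 by decide) ha]
  abel

theorem parityOp_of_mem {q : ZMod 2} {v : V} (h : v ∈ S.part q) :
    S.parityOp v = superSign k 1 q • v := by
  rcases ZMod.two_cases q with rfl | rfl
  · simp [parityOp, superSign, S.proj_of_mem h,
      S.proj_of_mem_ne (show (1 : ZMod 2) ≠ 0 by decide) h]
  · simp [parityOp, superSign, S.proj_of_mem h,
      S.proj_of_mem_ne (show (0 : ZMod 2) ≠ 1 by decide) h]

theorem parityOp_mem {q : ZMod 2} {v : V} (h : v ∈ S.part q) : S.parityOp v ∈ S.part q := by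
  rw [S.parityOp_of_mem h]; exact Submodule.smul_mem _ _ h

/-- Two linear maps agree if they agree on homogeneous elements. -/
theorem hom_ext {W : Type*} [AddCommGroup W] [Module k W] {f g : V →ₗ[k] W}
    (h : ∀ p, ∀ v ∈ S.part p, f v = g v) : f = g := by
  ext v
  rw [← S.proj_add_proj v, map_add, map_add, h 0 _ (S.proj_mem 0 v), h 1 _ (S.proj_mem 1 v)]

end SuperSpace

/-! ### Lie superalgebras and their modules -/

/-- A Lie superalgebra structure on a vector space over a field of characteristic zero. -/
structure LieSuperalgebra (k g : Type*) [Field k] [AddCommGroup g] [Module k g]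
    extends SuperSpace k g where
  bracket : g →ₗ[k] g →ₗ[k] g
  bracket_mem : ∀ p q, ∀ x ∈ part p, ∀ y ∈ part q, bracket x y ∈ part (p + q)
  bracket_skew : ∀ p q, ∀ x ∈ part p, ∀ y ∈ part q,
    bracket x y = -(superSign k p q • bracket y x)
  jacobi : ∀ p q, ∀ x ∈ part p, ∀ y ∈ part q, ∀ z,
    bracket x (bracket y z) = bracket (bracket x y) z + superSign k p q • bracket y (bracket x z)

/-- A (`ℤ/2`-graded) module structure on `V` over the Lie superalgebra `L`. -/
structure LieSuperModule {k g : Type*} [Field k] [AddCommGroup g] [Module k g]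
    (L : LieSuperalgebra k g) (V : Type*) [AddCommGroup V] [Module k V]
    extends SuperSpace k V where
  act : g →ₗ[k] V →ₗ[k] V
  act_mem : ∀ p q, ∀ x ∈ L.part p, ∀ v ∈ part q, act x v ∈ part (p + q)
  act_bracket : ∀ p q, ∀ x ∈ L.part p, ∀ y ∈ L.part q, ∀ v,
    act (L.bracket x y) v = act x (act y v) - superSign k p q • act y (act x v)

/-- Homomorphisms of Lie superalgebras: even linear maps preserving the bracket. -/
structure LieSuperHom {k g h : Type*} [Field k] [AddCommGroup g] [Module k g]
    [AddCommGroup h] [Module k h] (L : LieSuperalgebra k g) (M : LieSuperalgebra k h) where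
  toLinearMap : g →ₗ[k] h
  map_mem : ∀ p, ∀ x ∈ L.part p, toLinearMap x ∈ M.part p
  map_bracket : ∀ x y, toLinearMap (L.bracket x y) = M.bracket (toLinearMap x) (toLinearMap y)

namespace LieSuperModule

variable {k g h V W : Type*} [Field k] [AddCommGroup g] [Module k g] [AddCommGroup h] [Module k h]
  [AddCommGroup V] [Module k V] [AddCommGroup W] [Module k W]
  {L : LieSuperalgebra k g} {M : LieSuperalgebra k h}

/-- The composition of a representation with a homomorphism of Lie superalgebras. -/
def pullback (N : LieSuperModule M V) (f : LieSuperHom L M) : LieSuperModule L V where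
  toSuperSpace := N.toSuperSpace
  act := N.act ∘ₗ f.toLinearMap
  act_mem p q x hx v hv := N.act_mem p q _ (f.map_mem p x hx) v hv
  act_bracket p q x hx y hy v := by
    simpa [f.map_bracket] using
      N.act_bracket p q _ (f.map_mem p x hx) _ (f.map_mem q y hy) v

/-- Irreducible modules: nonzero, and without proper nonzero graded submodules. -/
def IsIrreducible (N : LieSuperModule L V) : Prop :=
  Nontrivial V ∧ ∀ U : Submodule k V, N.IsGraded U → (∀ x, ∀ u ∈ U, N.act x u ∈ U) →
    U = ⊥ ∨ U = ⊤

/-- Isomorphism of modules, through an even linear bijection commuting with the action. -/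
def IsIsomorphic (N : LieSuperModule L V) (P : LieSuperModule L W) : Prop :=
  ∃ e : V ≃ₗ[k] W, (∀ p, ∀ v ∈ N.part p, e v ∈ P.part p) ∧
    ∀ x v, e (N.act x v) = P.act x (e v)

end LieSuperModule

/-! ### The classes of Lie superalgebras -/

namespace LieSuperalgebra

variable {k g h : Type*} [Field k] [AddCommGroup g] [Module k g] [AddCommGroup h] [Module k h]

/-- Isomorphism of Lie superalgebras. -/
def IsIsomorphic (L : LieSuperalgebra k g) (M : LieSuperalgebra k h) : Prop :=
  ∃ f : LieSuperHom L M, Function.Bijective f.toLinearMap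

section Even

variable [CharZero k] (L : LieSuperalgebra k g)

theorem bracket_even_self {x : g} (hx : x ∈ L.part 0) : L.bracket x x = 0 := by
  have h := L.bracket_skew 0 0 x hx x hx
  simp only [superSign, zero_ne_one, and_self, if_false, one_smul] at h
  have h2 : (2 : k) • L.bracket x x = 0 := by
    rw [two_smul]; nth_rewrite 1 [h]; simp
  exact (smul_eq_zero.1 h2).resolve_left two_ne_zero

/-- The even part of a Lie superalgebra is a Lie algebra. -/
instance evenLieRing : LieRing (L.part 0) where
  bracket x y := ⟨L.bracket x y, by simpa using L.bracket_mem 0 0 x x.2 y y.2⟩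
  add_lie x y z := by ext; simp
  lie_add x y z := by ext; simp
  lie_self x := by ext; exact L.bracket_even_self x.2
  leibniz_lie x y z := by
    ext
    simpa [superSign] using L.jacobi 0 0 x x.2 y y.2 z

instance evenLieAlgebra : LieAlgebra k (L.part 0) where
  lie_smul t x y := by
    ext
    exact map_smul (L.bracket x) t (y : g)

/-- `L` is a reductive Lie algebra: its odd part vanishes, and the radical of the Lie algebra
`L = L₀` is its center. (Finite dimensionality is assumed separately.) -/
def IsReductive : Prop :=
  L.part 1 = ⊥ ∧ LieAlgebra.radical k (L.part 0) = LieAlgebra.center k (L.part 0)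

end Even

variable (L : LieSuperalgebra k g)

/-- Simple Lie superalgebras: nonabelian, without proper nonzero graded ideals. -/
def IsSimple : Prop :=
  L.bracket ≠ 0 ∧ ∀ I : Submodule k g, L.IsGraded I → (∀ x, ∀ y ∈ I, L.bracket x y ∈ I) →
    I = ⊥ ∨ I = ⊤

/-- Classical Lie superalgebras: simple, with completely reducible representation of the even part
on the odd part. -/
def IsClassical : Prop :=
  L.IsSimple ∧ ∀ W ≤ L.part 1, (∀ x ∈ L.part 0, ∀ w ∈ W, L.bracket x w ∈ W) →
    ∃ W' ≤ L.part 1, (∀ x ∈ L.part 0, ∀ w ∈ W', L.bracket x w ∈ W') ∧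
      W ⊓ W' = ⊥ ∧ W ⊔ W' = L.part 1

/-- Basic classical Lie superalgebras: classical, with a nondegenerate even invariant bilinear
form. -/
def IsBasicClassical : Prop :=
  L.IsClassical ∧ ∃ B : g →ₗ[k] g →ₗ[k] k, B.Nondegenerate ∧
    (∀ p q, p ≠ q → ∀ x ∈ L.part p, ∀ y ∈ L.part q, B x y = 0) ∧
    ∀ x y z, B (L.bracket x y) z = B x (L.bracket y z)

end LieSuperalgebra

/-! ### The Lie superalgebra `𝔰𝔩(n,n)` -/

section SpecialLinear

variable (k : Type*) [Field k] (n : ℕ)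

/-- Square matrices of size `n + n`, with entries in `k`. -/
abbrev SuperMat := Matrix (Fin n ⊕ Fin n) (Fin n ⊕ Fin n) k

/-- The block diagonal part of a matrix. -/
def SuperMat.diag : SuperMat k n →ₗ[k] SuperMat k n where
  toFun X := Matrix.fromBlocks X.toBlocks₁₁ 0 0 X.toBlocks₂₂
  map_add' X Y := by
    ext (i | i) (j | j) <;> simp [Matrix.toBlocks₁₁, Matrix.toBlocks₂₂]
  map_smul' c X := by
    ext (i | i) (j | j) <;> simp [Matrix.toBlocks₁₁, Matrix.toBlocks₂₂]

/-- The supercommutator of matrices: on homogeneous matrices, `XY - (-1)^{|X||Y|} YX`. Here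
`diag X - (X - diag X)` is `(-1)^{|X|} X` if `X` is homogeneous. -/
def SuperMat.comm : SuperMat k n →ₗ[k] SuperMat k n →ₗ[k] SuperMat k n :=
  LinearMap.mk₂ k
    (fun X Y => X * Y - (diag k n Y * X + (Y - diag k n Y) * (diag k n X - (X - diag k n X))))
    (fun X X' Y => by simp only [map_add]; noncomm_ring)
    (fun c X Y => by
      simp only [map_smul, ← smul_sub, Matrix.smul_mul, Matrix.mul_smul, ← smul_add])
    (fun X Y Y' => by simp only [map_add]; noncomm_ring)
    (fun c X Y => by
      simp only [map_smul, ← smul_sub, Matrix.smul_mul, Matrix.mul_smul, ← smul_add])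

/-- The supertrace of a matrix. -/
def SuperMat.str : SuperMat k n →ₗ[k] k where
  toFun X := X.toBlocks₁₁.trace - X.toBlocks₂₂.trace
  map_add' X Y := by
    simp only [Matrix.trace, Matrix.toBlocks₁₁, Matrix.toBlocks₂₂, Matrix.diag_apply,
      Matrix.of_apply, Matrix.add_apply, Finset.sum_add_distrib]
    ring
  map_smul' c X := by
    simp [Matrix.trace, Matrix.toBlocks₁₁, Matrix.toBlocks₂₂, ← Finset.mul_sum, mul_sub]

/-- Even matrices are the block diagonal ones, odd matrices those with zero diagonal blocks. -/
def SuperMat.part (p : ZMod 2) : Submodule k (SuperMat k n) :=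
  if p = 0 then LinearMap.eqLocus (diag k n) LinearMap.id else LinearMap.ker (diag k n)

variable {k n}

namespace SuperMat

open Matrix

theorem mem_part_zero {X : SuperMat k n} : X ∈ part k n 0 ↔ diag k n X = X := by
  simp [part]

theorem mem_part_one {X : SuperMat k n} : X ∈ part k n 1 ↔ diag k n X = 0 := by
  simp [part]

@[simp] theorem diag_fromBlocks (P Q R S : Matrix (Fin n) (Fin n) k) :
    diag k n (fromBlocks P Q R S) = fromBlocks P 0 0 S := by
  simp [diag]

@[simp] theorem str_fromBlocks (P Q R S : Matrix (Fin n) (Fin n) k) :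
    str k n (fromBlocks P Q R S) = P.trace - S.trace := by
  simp [str]

theorem diag_diag (X : SuperMat k n) : diag k n (diag k n X) = diag k n X := by
  rw [← fromBlocks_toBlocks X]; simp

theorem str_diag (X : SuperMat k n) : str k n (diag k n X) = str k n X := by
  rw [← fromBlocks_toBlocks X]; simp

theorem mem_part_zero' {X : SuperMat k n} (h : X ∈ part k n 0) :
    X = fromBlocks X.toBlocks₁₁ 0 0 X.toBlocks₂₂ := (mem_part_zero.1 h).symm

theorem mem_part_one' {X : SuperMat k n} (h : X ∈ part k n 1) :
    X = fromBlocks 0 X.toBlocks₁₂ X.toBlocks₂₁ 0 := by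
  have h1 := mem_part_one.1 h
  rw [← fromBlocks_toBlocks X, diag_fromBlocks, ← fromBlocks_zero, fromBlocks_inj] at h1
  nth_rewrite 1 [← fromBlocks_toBlocks X]
  rw [h1.1, h1.2.2.2]

theorem comm_apply (X Y : SuperMat k n) : comm k n X Y =
    X * Y - (diag k n Y * X + (Y - diag k n Y) * (diag k n X - (X - diag k n X))) := rfl

theorem comm_of_mem {p q : ZMod 2} {X Y : SuperMat k n} (hX : X ∈ part k n p)
    (hY : Y ∈ part k n q) : comm k n X Y = X * Y - superSign k p q • (Y * X) := by
  rcases ZMod.two_cases p with rfl | rfl <;> rcases ZMod.two_cases q with rfl | rfl <;>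
    simp only [mem_part_zero, mem_part_one] at hX hY <;>
    simp [comm_apply, superSign, hX, hY]

theorem mul_mem_part {p q : ZMod 2} {X Y : SuperMat k n} (hX : X ∈ part k n p)
    (hY : Y ∈ part k n q) : X * Y ∈ part k n (p + q) := by
  have e : (1 + 1 : ZMod 2) = 0 := by decide
  rcases ZMod.two_cases p with rfl | rfl <;> rcases ZMod.two_cases q with rfl | rfl
  · rw [mem_part_zero' hX, mem_part_zero' hY, add_zero, mem_part_zero]
    simp [fromBlocks_multiply]
  · rw [mem_part_zero' hX, mem_part_one' hY, zero_add, mem_part_one]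
    simp [fromBlocks_multiply]
  · rw [mem_part_one' hX, mem_part_zero' hY, add_zero, mem_part_one]
    simp [fromBlocks_multiply]
  · rw [mem_part_one' hX, mem_part_one' hY, e, mem_part_zero]
    simp [fromBlocks_multiply]

theorem comm_mem_part {p q : ZMod 2} {X Y : SuperMat k n} (hX : X ∈ part k n p)
    (hY : Y ∈ part k n q) : comm k n X Y ∈ part k n (p + q) := by
  rw [comm_of_mem hX hY]
  refine Submodule.sub_mem _ (mul_mem_part hX hY) (Submodule.smul_mem _ _ ?_)
  rw [add_comm]; exact mul_mem_part hY hX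

theorem exists_parts (X : SuperMat k n) :
    ∃ X₀ ∈ part k n 0, ∃ X₁ ∈ part k n 1, X = X₀ + X₁ :=
  ⟨diag k n X, mem_part_zero.2 (diag_diag X), X - diag k n X,
    mem_part_one.2 (by rw [map_sub, diag_diag, sub_self]), by abel⟩

theorem comm_skew {p q : ZMod 2} {X Y : SuperMat k n} (hX : X ∈ part k n p)
    (hY : Y ∈ part k n q) : comm k n X Y = -(superSign k p q • comm k n Y X) := by
  rw [comm_of_mem hX hY, comm_of_mem hY hX]
  rcases ZMod.two_cases p with rfl | rfl <;> rcases ZMod.two_cases q with rfl | rfl <;>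
    simp [superSign, add_comm]

theorem comm_jacobi_aux {p q r : ZMod 2} {X Y Z : SuperMat k n} (hX : X ∈ part k n p)
    (hY : Y ∈ part k n q) (hZ : Z ∈ part k n r) :
    comm k n X (comm k n Y Z) =
      comm k n (comm k n X Y) Z + superSign k p q • comm k n Y (comm k n X Z) := by
  rw [comm_of_mem hX (comm_mem_part hY hZ), comm_of_mem (comm_mem_part hX hY) hZ,
    comm_of_mem hY (comm_mem_part hX hZ), comm_of_mem hY hZ, comm_of_mem hX hY, comm_of_mem hX hZ]
  have e : (1 + 1 : ZMod 2) = 0 := by decide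
  rcases ZMod.two_cases p with rfl | rfl <;> rcases ZMod.two_cases q with rfl | rfl <;>
    rcases ZMod.two_cases r with rfl | rfl <;>
    simp only [superSign, e, add_zero, zero_add, zero_ne_one, and_self, and_true, and_false,
      if_true, if_false, one_smul, neg_smul] <;> noncomm_ring

theorem comm_jacobi {p q : ZMod 2} {X Y : SuperMat k n} (hX : X ∈ part k n p)
    (hY : Y ∈ part k n q) (Z : SuperMat k n) :
    comm k n X (comm k n Y Z) =
      comm k n (comm k n X Y) Z + superSign k p q • comm k n Y (comm k n X Z) := by
  obtain ⟨Z₀, h0, Z₁, h1, rfl⟩ := exists_parts Z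
  simp only [map_add, comm_jacobi_aux hX hY h0, comm_jacobi_aux hX hY h1, smul_add]
  abel

theorem str_comm (X Y : SuperMat k n) : str k n (comm k n X Y) = 0 := by
  obtain ⟨X₀, h0, X₁, h1, rfl⟩ := exists_parts X
  obtain ⟨Y₀, h0', Y₁, h1', rfl⟩ := exists_parts Y
  simp only [map_add, LinearMap.add_apply, comm_of_mem h0 h0', comm_of_mem h0 h1',
    comm_of_mem h1 h0', comm_of_mem h1 h1']
  rw [mem_part_zero' h0, mem_part_one' h1, mem_part_zero' h0', mem_part_one' h1']
  simp only [superSign, zero_ne_one, and_self, and_true, and_false,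
    if_true, if_false, one_smul, neg_smul, map_sub, map_neg, fromBlocks_multiply, str_fromBlocks]
  simp [trace_mul_comm Y₀.toBlocks₁₁, trace_mul_comm Y₀.toBlocks₂₂,
    trace_mul_comm Y₁.toBlocks₁₂, trace_mul_comm Y₁.toBlocks₂₁]

end SuperMat

variable (k n)

/-- The Lie superalgebra `𝔰𝔩(n,n)` of `(n + n) × (n + n)` matrices of supertrace zero, with the
supercommutator as bracket. -/
def slSuper : LieSuperalgebra k (LinearMap.ker (SuperMat.str k n)) where
  part p := (SuperMat.part k n p).comap (LinearMap.ker (SuperMat.str k n)).subtype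
  isCompl_part := by
    constructor
    · rw [Submodule.disjoint_def]
      intro X h0 h1
      ext1
      have h0' := SuperMat.mem_part_zero.1 h0
      have h1' := SuperMat.mem_part_one.1 h1
      exact h0'.symm.trans h1'
    · rw [codisjoint_iff, eq_top_iff]
      rintro ⟨X, hX⟩ -
      have hd : SuperMat.str k n (SuperMat.diag k n X) = 0 := by
        rw [SuperMat.str_diag]; exact hX
      refine Submodule.mem_sup.2 ⟨⟨SuperMat.diag k n X, hd⟩,
        SuperMat.mem_part_zero.2 (SuperMat.diag_diag X), ⟨X - SuperMat.diag k n X, ?_⟩,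
        SuperMat.mem_part_one.2 ?_, ?_⟩
      · rw [LinearMap.mem_ker, map_sub, hd, sub_zero]; exact hX
      · change SuperMat.diag k n (X - SuperMat.diag k n X) = 0
        rw [map_sub, SuperMat.diag_diag, sub_self]
      · ext1; simp
  bracket := LinearMap.mk₂ k
    (fun X Y => ⟨SuperMat.comm k n X Y, SuperMat.str_comm X.1 Y.1⟩)
    (fun X X' Y => by ext1; simp)
    (fun c X Y => by ext1; simp)
    (fun X Y Y' => by ext1; simp)
    (fun c X Y => by ext1; simp)
  bracket_mem p q X hX Y hY := SuperMat.comm_mem_part hX hY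
  bracket_skew p q X hX Y hY := by
    ext1; exact SuperMat.comm_skew hX hY
  jacobi p q X hX Y hY Z := by
    ext1; exact SuperMat.comm_jacobi hX hY Z

end SpecialLinear

/-! ### Map superalgebras, direct sums, and outer tensor products -/

namespace LieSuperalgebra

variable {k g : Type*} [Field k] [AddCommGroup g] [Module k g] (L : LieSuperalgebra k g)

/-- The map superalgebra `g ⊗ A`, with parts `g_ε ⊗ A` and bracket
`[x ⊗ a, y ⊗ b] = [x, y] ⊗ ab`. -/
def map (A : Type*) [CommRing A] [Algebra k A] : LieSuperalgebra k (g ⊗[k] A) where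
  part p := LinearMap.range ((L.part p).subtype.rTensor A)
  isCompl_part := by
    have key : ∀ p q, ∀ x ∈ LinearMap.range ((L.part q).subtype.rTensor A),
        (L.proj p).rTensor A x = if p = q then x else 0 := by
      rintro p q _ ⟨x, rfl⟩
      rw [← LinearMap.comp_apply, ← LinearMap.rTensor_comp]
      split_ifs with h
      · subst h
        congr 2
        ext y
        exact L.proj_of_mem y.2
      · have : L.proj p ∘ₗ (L.part q).subtype = 0 := by
          ext y
          exact L.proj_of_mem_ne h y.2
        rw [this]; simp
    constructor
    · rw [Submodule.disjoint_def]
      intro x h0 h1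
      have h := key 0 0 x h0
      rw [key 0 1 x h1] at h
      simpa using h.symm
    · rw [codisjoint_iff, eq_top_iff]
      rintro x -
      induction x with
      | zero => exact Submodule.zero_mem _
      | add x y hx hy => exact Submodule.add_mem _ hx hy
      | tmul x a =>
        rw [← L.proj_add_proj x, TensorProduct.add_tmul]
        exact Submodule.add_mem_sup ⟨⟨_, L.proj_mem 0 x⟩ ⊗ₜ a, rfl⟩ ⟨⟨_, L.proj_mem 1 x⟩ ⊗ₜ a, rfl⟩
  bracket := TensorProduct.map₂ L.bracket (LinearMap.mul k A)
  bracket_mem := by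
    rintro p q _ ⟨x, rfl⟩ _ ⟨y, rfl⟩
    induction x with
    | zero => simp
    | add x x' hx hx' => simpa using Submodule.add_mem _ hx hx'
    | tmul x a =>
      induction y with
      | zero => simp
      | add y y' hy hy' => simpa using Submodule.add_mem _ hy hy'
      | tmul y b => exact ⟨⟨_, L.bracket_mem p q x x.2 y y.2⟩ ⊗ₜ (a * b), rfl⟩
  bracket_skew := by
    rintro p q _ ⟨x, rfl⟩ _ ⟨y, rfl⟩
    induction x with
    | zero => simp
    | add x x' hx hx' =>
      simp only [map_add, LinearMap.add_apply, hx, hx', smul_add]; abel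
    | tmul x a =>
      induction y with
      | zero => simp
      | add y y' hy hy' =>
        simp only [map_add, LinearMap.add_apply, hy, hy', smul_add]; abel
      | tmul y b =>
        simp only [LinearMap.rTensor_tmul, Submodule.subtype_apply, TensorProduct.map₂_apply_tmul,
          TensorProduct.map_tmul, LinearMap.mul_apply', mul_comm b a]
        rw [L.bracket_skew p q x x.2 y y.2, TensorProduct.neg_tmul, TensorProduct.smul_tmul']
  jacobi := by
    rintro p q _ ⟨x, rfl⟩ _ ⟨y, rfl⟩ z
    induction x with
    | zero => simp
    | add x x' hx hx' =>
      simp only [map_add, LinearMap.add_apply, hx, hx', smul_add]; abel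
    | tmul x a =>
      induction y with
      | zero => simp
      | add y y' hy hy' =>
        simp only [map_add, LinearMap.add_apply, hy, hy', smul_add]; abel
      | tmul y b =>
        induction z with
        | zero => simp
        | add z z' hz hz' =>
          simp only [map_add, hz, hz', smul_add]; abel
        | tmul z c =>
          simp only [LinearMap.rTensor_tmul, Submodule.subtype_apply,
            TensorProduct.map₂_apply_tmul, TensorProduct.map_tmul, LinearMap.mul_apply']
          rw [L.jacobi p q x x.2 y y.2 z, TensorProduct.add_tmul, TensorProduct.smul_tmul',
            mul_assoc, mul_left_comm b a c]

/-- The direct sum of a family of Lie superalgebras (which is finite in all uses below). -/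
def pi {ι : Type*} {g : ι → Type*} [∀ i, AddCommGroup (g i)]
    [∀ i, Module k (g i)] (L : ∀ i, LieSuperalgebra k (g i)) : LieSuperalgebra k (∀ i, g i) where
  part p := Submodule.pi Set.univ fun i => (L i).part p
  isCompl_part := by
    constructor
    · rw [Submodule.disjoint_def]
      intro x h0 h1
      ext i
      exact (Submodule.disjoint_def.1 (L i).isCompl_part.disjoint) _ (h0 i trivial) (h1 i trivial)
    · rw [codisjoint_iff, eq_top_iff]
      rintro x -
      exact Submodule.mem_sup.2 ⟨fun i => (L i).proj 0 (x i), fun i _ => (L i).proj_mem 0 _,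
        fun i => (L i).proj 1 (x i), fun i _ => (L i).proj_mem 1 _,
        funext fun i => (L i).proj_add_proj (x i)⟩
  bracket := LinearMap.mk₂ k (fun x y i => (L i).bracket (x i) (y i))
    (fun x x' y => by ext i; simp)
    (fun c x y => by ext i; simp)
    (fun x y y' => by ext i; simp)
    (fun c x y => by ext i; simp)
  bracket_mem p q x hx y hy i _ := (L i).bracket_mem p q _ (hx i trivial) _ (hy i trivial)
  bracket_skew p q x hx y hy := by
    ext i; exact (L i).bracket_skew p q _ (hx i trivial) _ (hy i trivial)
  jacobi p q x hx y hy z := by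
    ext i; exact (L i).jacobi p q _ (hx i trivial) _ (hy i trivial) _

end LieSuperalgebra

namespace SuperSpace

open PiTensorProduct

theorem sign_mul_self (k : Type*) [Field k] (p q : ZMod 2) :
    superSign k p q * superSign k p q = 1 := by
  unfold superSign; split_ifs <;> simp

theorem parityOp_mul_self {k V : Type*} [Field k] [AddCommGroup V] [Module k V]
    (S : SuperSpace k V) : S.parityOp * S.parityOp = 1 := by
  refine S.hom_ext fun p v hv => ?_
  rw [Module.End.mul_apply, S.parityOp_of_mem hv, map_smul, S.parityOp_of_mem hv, smul_smul,
    sign_mul_self, one_smul, Module.End.one_apply]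

variable {k : Type*} [Field k] {ι : Type*} [Fintype ι] [LinearOrder ι]
  {V : ι → Type*} [∀ i, AddCommGroup (V i)] [∀ i, Module k (V i)]

/-- The homogeneous tensors of parity `p` in a tensor product: those spanned by the pure tensors of
homogeneous vectors whose parities sum to `p`. -/
def tensorPart (S : ∀ i, SuperSpace k (V i)) (p : ZMod 2) : Submodule k (⨂[k] i, V i) :=
  Submodule.span k {t | ∃ (d : ι → ZMod 2) (v : ∀ i, V i),
    (∀ i, v i ∈ (S i).part (d i)) ∧ ∑ i, d i = p ∧ t = tprod k v}

theorem map_parityOp_tensorPart (S : ∀ i, SuperSpace k (V i)) {p : ZMod 2} {t : ⨂[k] i, V i}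
    (ht : t ∈ tensorPart S p) :
    PiTensorProduct.map (fun i => (S i).parityOp) t = superSign k 1 p • t := by
  induction ht using Submodule.span_induction with
  | zero => simp
  | add x y _ _ hx hy => rw [map_add, hx, hy, smul_add]
  | smul c x _ hx => rw [map_smul, hx, smul_comm]
  | mem t ht =>
    obtain ⟨d, v, hv, rfl, rfl⟩ := ht
    have h : (fun i => (S i).parityOp (v i)) = fun i => superSign k 1 (d i) • v i :=
      funext fun i => (S i).parityOp_of_mem (hv i)
    rw [map_tprod, h, MultilinearMap.map_smul_univ]
    congr 1
    have key : ∀ a b : ZMod 2, superSign k 1 (a + b) = superSign k 1 a * superSign k 1 b := by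
      intro a b
      have e : (1 + 1 : ZMod 2) = 0 := by decide
      rcases ZMod.two_cases a with rfl | rfl <;> rcases ZMod.two_cases b with rfl | rfl <;>
        simp [superSign, e]
    classical
    induction (Finset.univ : Finset ι) using Finset.induction_on with
    | empty => simp [superSign]
    | insert a s ha ih => rw [Finset.prod_insert ha, Finset.sum_insert ha, key, ih]

/-- The tensor product of finitely many super vector spaces. -/
def tensor [CharZero k] (S : ∀ i, SuperSpace k (V i)) : SuperSpace k (⨂[k] i, V i) where
  part := tensorPart S
  isCompl_part := by
    constructor
    · rw [Submodule.disjoint_def]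
      intro t h0 h1
      have h := map_parityOp_tensorPart S h0
      rw [map_parityOp_tensorPart S h1] at h
      simp only [superSign, and_self, if_true, zero_ne_one, and_false, if_false, one_smul,
        neg_smul] at h
      have h2 : (2 : k) • t = 0 := by
        rw [two_smul]; nth_rewrite 1 [← h]; simp
      exact (smul_eq_zero.1 h2).resolve_left two_ne_zero
    · rw [codisjoint_iff, eq_top_iff, ← PiTensorProduct.span_tprod_eq_top, Submodule.span_le]
      rintro _ ⟨v, rfl⟩
      have h : v = fun i => ∑ p : ZMod 2, (S i).proj p (v i) :=
        funext fun i =>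
        ((S i).proj_add_proj (v i)).symm.trans
          (Fin.sum_univ_two fun p : ZMod 2 => (S i).proj p (v i)).symm
      rw [h, MultilinearMap.map_sum]
      refine Submodule.sum_mem _ fun d _ => ?_
      have hm : tprod k (fun i => (S i).proj (d i) (v i)) ∈ tensorPart S (∑ i, d i) :=
        Submodule.subset_span ⟨d, _, fun i => (S i).proj_mem _ _, rfl, rfl⟩
      rcases ZMod.two_cases (∑ i, d i) with h0 | h0 <;> rw [h0] at hm
      · exact Submodule.mem_sup_left hm
      · exact Submodule.mem_sup_right hm

end SuperSpace

namespace LieSuperModule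

open PiTensorProduct SuperSpace

variable {k : Type*} [Field k] {ι : Type*} [LinearOrder ι]
  {g : ι → Type*} [∀ i, AddCommGroup (g i)] [∀ i, Module k (g i)]
  {V : ι → Type*} [∀ i, AddCommGroup (V i)] [∀ i, Module k (V i)]
  {L : ∀ i, LieSuperalgebra k (g i)}

/-- The power of the parity operator that the Koszul rule puts at the `j`-th factor when an element
of parity `p` acts on the `i`-th factor. -/
def koszulOp (N : ∀ i, LieSuperModule (L i) (V i)) (i : ι) (p : ZMod 2) (j : ι) :
    V j →ₗ[k] V j :=
  if j < i ∧ p = 1 then (N j).parityOp else 1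

/-- The action of an element `x` of parity `p` of the `i`-th Lie superalgebra on a tensor product:
`v₁ ⊗ ⋯ ⊗ v_ℓ ↦ (-1)^{p(|v₁| + ⋯ + |v_{i-1}|)} v₁ ⊗ ⋯ ⊗ x v_i ⊗ ⋯ ⊗ v_ℓ`. -/
def siteOp (N : ∀ i, LieSuperModule (L i) (V i)) (i : ι) (p : ZMod 2) :
    g i →ₗ[k] Module.End k (⨂[k] i, V i) :=
  (PiTensorProduct.mapMultilinear k V V).toLinearMap (koszulOp N i p) i ∘ₗ (N i).act

theorem siteOp_apply (N : ∀ i, LieSuperModule (L i) (V i)) (i : ι) (p : ZMod 2) (x : g i) :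
    siteOp N i p x =
      PiTensorProduct.map (Function.update (koszulOp N i p) i ((N i).act x)) := rfl

/-- The action of the direct sum of the Lie superalgebras `L i` on the tensor product of the
modules `V i`. -/
def tensorAct [Fintype ι] (N : ∀ i, LieSuperModule (L i) (V i)) :
    (∀ i, g i) →ₗ[k] Module.End k (⨂[k] i, V i) :=
  ∑ i, ∑ p : ZMod 2, siteOp N i p ∘ₗ (L i).proj p ∘ₗ LinearMap.proj i

theorem tensorAct_of_mem [Fintype ι] (N : ∀ i, LieSuperModule (L i) (V i)) {p : ZMod 2} {x : ∀ i, g i}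
    (hx : x ∈ (LieSuperalgebra.pi L).part p) : tensorAct N x = ∑ i, siteOp N i p (x i) := by
  simp only [tensorAct, LinearMap.sum_apply, LinearMap.comp_apply, LinearMap.proj_apply]
  refine Finset.sum_congr rfl fun i _ => ?_
  rw [Finset.sum_eq_single p]
  · rw [(L i).proj_of_mem (hx i trivial)]
  · intro q _ hq
    rw [(L i).proj_of_mem_ne hq (hx i trivial), map_zero]
  · simp

theorem koszulOp_mul (N : ∀ i, LieSuperModule (L i) (V i)) (i j : ι) (p q : ZMod 2) :
    koszulOp N i p j * koszulOp N i q j = koszulOp N i (p + q) j := by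
  have e : (1 + 1 : ZMod 2) = 0 := by decide
  unfold koszulOp
  by_cases h : j < i <;> rcases ZMod.two_cases p with rfl | rfl <;>
    rcases ZMod.two_cases q with rfl | rfl <;> simp [h, e, parityOp_mul_self]

theorem act_mul_koszulOp (N : ∀ i, LieSuperModule (L i) (V i)) (i j : ι) (hij : i < j)
    (p q : ZMod 2) {x : g i} (hx : x ∈ (L i).part p) :
    (N i).act x * koszulOp N j q i =
      superSign k p q • (koszulOp N j q i * ((N i).act x : Module.End k (V i))) := by
  unfold koszulOp
  rcases ZMod.two_cases q with rfl | rfl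
  · simp [superSign]
  · simp only [hij, and_self, if_true]
    refine (N i).hom_ext fun r v hv => ?_
    rw [LinearMap.smul_apply, Module.End.mul_apply, Module.End.mul_apply,
      (N i).parityOp_of_mem hv, (N i).parityOp_of_mem ((N i).act_mem p r x hx v hv), map_smul,
      smul_smul]
    congr 1
    have e : (1 + 1 : ZMod 2) = 0 := by decide
    rcases ZMod.two_cases p with rfl | rfl <;> rcases ZMod.two_cases r with rfl | rfl <;>
      simp [superSign, e]

theorem siteOp_comm_of_lt (N : ∀ i, LieSuperModule (L i) (V i)) {i j : ι} (hij : i < j)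
    (p q : ZMod 2) {x : g i} (hx : x ∈ (L i).part p) (y : g j) :
    siteOp N i p x * siteOp N j q y = superSign k p q • (siteOp N j q y * siteOp N i p x) := by
  rw [siteOp_apply, siteOp_apply, ← PiTensorProduct.map_mul, ← PiTensorProduct.map_mul]
  set G : ∀ l, Module.End k (V l) := fun l =>
    Function.update (koszulOp N j q) j ((N j).act y) l *
      Function.update (koszulOp N i p) i ((N i).act x) l with hG
  have h : (fun l => Function.update (koszulOp N i p) i ((N i).act x) l *
      Function.update (koszulOp N j q) j ((N j).act y) l) =
      Function.update G i (superSign k p q • G i) := by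
    funext l
    by_cases hi : l = i
    · subst hi
      simp only [Function.update_self, hG, Function.update_of_ne hij.ne]
      exact act_mul_koszulOp N l j hij p q hx
    · rw [Function.update_of_ne hi, Function.update_of_ne hi]
      simp only [hG, Function.update_of_ne hi]
      by_cases hj : l = j
      · subst hj
        simp [koszulOp, not_lt_of_gt hij]
      · rw [Function.update_of_ne hj]
        unfold koszulOp
        split_ifs <;> simp
  refine (congrArg PiTensorProduct.map h).trans ?_
  rw [PiTensorProduct.map_update_smul, Function.update_eq_self]

theorem siteOp_comm (N : ∀ i, LieSuperModule (L i) (V i)) {i j : ι} (hij : i ≠ j)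
    (p q : ZMod 2) {x : g i} (hx : x ∈ (L i).part p) {y : g j} (hy : y ∈ (L j).part q) :
    siteOp N i p x * siteOp N j q y = superSign k p q • (siteOp N j q y * siteOp N i p x) := by
  rcases lt_or_gt_of_ne hij with h | h
  · exact siteOp_comm_of_lt N h p q hx y
  · have hs : superSign k q p = superSign k p q := by simp [superSign, and_comm]
    rw [siteOp_comm_of_lt N h q p hy x, hs, smul_smul, sign_mul_self, one_smul]

theorem siteOp_mul (N : ∀ i, LieSuperModule (L i) (V i)) (i : ι) (p q : ZMod 2) (x y : g i) :
    siteOp N i p x * siteOp N i q y =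
      (PiTensorProduct.mapMultilinear k V V).toLinearMap (koszulOp N i (p + q)) i
        ((N i).act x * (N i).act y : Module.End k (V i)) := by
  rw [siteOp_apply, siteOp_apply, ← PiTensorProduct.map_mul]
  refine congrArg PiTensorProduct.map (funext fun l => ?_)
  by_cases hi : l = i
  · subst hi; simp
  · rw [Function.update_of_ne hi, Function.update_of_ne hi, Function.update_of_ne hi,
      koszulOp_mul]

theorem siteOp_bracket (N : ∀ i, LieSuperModule (L i) (V i)) (i : ι) (p q : ZMod 2) {x y : g i}
    (hx : x ∈ (L i).part p) (hy : y ∈ (L i).part q) :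
    siteOp N i (p + q) ((L i).bracket x y) =
      siteOp N i p x * siteOp N i q y - superSign k p q • (siteOp N i q y * siteOp N i p x) := by
  have h : (N i).act ((L i).bracket x y) =
      (N i).act x * (N i).act y - superSign k p q • ((N i).act y * (N i).act x) :=
    LinearMap.ext fun v => (N i).act_bracket p q x hx y hy v
  rw [siteOp_mul, siteOp_mul, add_comm q p, ← map_smul, ← map_sub, ← h]
  rfl

/-- The outer tensor product of modules `V i` over Lie superalgebras `L i`, which is a module over
their direct sum: `x = (x_i)` acts as `∑ i, 1 ⊗ ⋯ ⊗ x_i ⊗ ⋯ ⊗ 1`, with signs by the Koszul rule. -/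
def outerTensor [Fintype ι] [CharZero k] (N : ∀ i, LieSuperModule (L i) (V i)) :
    LieSuperModule (LieSuperalgebra.pi L) (⨂[k] i, V i) where
  toSuperSpace := SuperSpace.tensor fun i => (N i).toSuperSpace
  act := tensorAct N
  act_mem := by
    intro p q x hx t ht
    rw [tensorAct_of_mem N hx, LinearMap.sum_apply]
    refine Submodule.sum_mem _ fun i _ => ?_
    change t ∈ tensorPart _ q at ht
    change _ ∈ tensorPart _ (p + q)
    induction ht using Submodule.span_induction with
    | zero => simp
    | add x y _ _ hx hy => rw [map_add]; exact Submodule.add_mem _ hx hy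
    | smul c x _ hx => rw [map_smul]; exact Submodule.smul_mem _ _ hx
    | mem t ht =>
      obtain ⟨d, v, hv, rfl, rfl⟩ := ht
      rw [siteOp_apply, PiTensorProduct.map_tprod]
      refine Submodule.subset_span ⟨Function.update d i (p + d i), _, fun j => ?_, ?_, rfl⟩
      · by_cases hj : j = i
        · subst hj
          simpa using (N j).act_mem p (d j) _ (hx j trivial) _ (hv j)
        · rw [Function.update_of_ne hj, Function.update_of_ne hj]
          unfold koszulOp
          split_ifs
          · exact (N j).parityOp_mem (hv j)
          · exact hv j
      · rw [Finset.sum_update_of_mem (Finset.mem_univ i), add_assoc,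
          ← Finset.sum_eq_add_sum_sdiff_singleton_of_mem (Finset.mem_univ i)]
  act_bracket := by
    intro p q x hx y hy t
    have hb := (LieSuperalgebra.pi L).bracket_mem p q x hx y hy
    have h : tensorAct N ((LieSuperalgebra.pi L).bracket x y) =
        tensorAct N x * tensorAct N y - superSign k p q • (tensorAct N y * tensorAct N x) := by
      rw [tensorAct_of_mem N hx, tensorAct_of_mem N hy, tensorAct_of_mem N hb,
        Finset.sum_mul_sum, Finset.sum_mul_sum]
      conv_rhs => rw [Finset.sum_comm (f := fun i j => siteOp N i q (y i) * siteOp N j p (x j))]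
      simp only [Finset.smul_sum, ← Finset.sum_sub_distrib]
      refine Finset.sum_congr rfl fun i _ => ?_
      rw [Finset.sum_eq_single i]
      · exact siteOp_bracket N i p q (hx i trivial) (hy i trivial)
      · intro j _ hj
        rw [siteOp_comm N hj.symm p q (hx i trivial) (hy j trivial), sub_self]
      · simp
    exact LinearMap.congr_fun h t

end LieSuperModule

/-! ### Generalized evaluation modules, annihilators, and supports -/

namespace LieSuperalgebra

variable {k g A : Type*} [Field k] [AddCommGroup g] [Module k g] [CommRing A] [Algebra k A]
  (L : LieSuperalgebra k g)

/-- The generalized evaluation map `g ⊗ A → ⨁ i, g ⊗ (A / I i)`, used for `I i = m_i ^ n_i` with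
distinct rational points `m_i`. -/
def evalHom {ι : Type*} (I : ι → Ideal A) :
    LieSuperHom (L.map A) (LieSuperalgebra.pi fun i => L.map (A ⧸ I i)) where
  toLinearMap := LinearMap.pi fun i => (Ideal.Quotient.mkₐ k (I i)).toLinearMap.lTensor g
  map_mem := by
    rintro p _ ⟨x, rfl⟩ i -
    induction x with
    | zero => simp
    | add x y hx hy => simpa using Submodule.add_mem _ hx hy
    | tmul x a => exact ⟨x ⊗ₜ (Ideal.Quotient.mk (I i) a), rfl⟩
  map_bracket x y := by
    ext i
    change (Ideal.Quotient.mkₐ k (I i)).toLinearMap.lTensor g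
        (TensorProduct.map₂ L.bracket (LinearMap.mul k A) x y) =
      TensorProduct.map₂ L.bracket (LinearMap.mul k (A ⧸ I i))
        ((Ideal.Quotient.mkₐ k (I i)).toLinearMap.lTensor g x)
        ((Ideal.Quotient.mkₐ k (I i)).toLinearMap.lTensor g y)
    induction x with
    | zero => simp
    | add x x' hx hx' => simp only [map_add, LinearMap.add_apply, hx, hx']
    | tmul x a =>
      induction y with
      | zero => simp
      | add y y' hy hy' => simp only [map_add, hy, hy']
      | tmul y b => simp

end LieSuperalgebra

/-- The `k`-rational points among the maximal ideals of a `k`-algebra `A`: those with residue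
field `k`. -/
def MaximalSpectrum.IsRational (k : Type*) {A : Type*} [Field k] [CommRing A] [Algebra k A]
    (m : MaximalSpectrum A) : Prop :=
  Function.Bijective (algebraMap k (A ⧸ m.asIdeal))

namespace LieSuperModule

universe u v w x

variable {k : Type u} {g : Type v} {A : Type w} {V : Type x} [Field k] [AddCommGroup g]
  [Module k g] [CommRing A] [Algebra k A] [AddCommGroup V] [Module k V] {L : LieSuperalgebra k g}

/-- `N` is isomorphic to `ev_{m_1^{n_1}, …, m_ℓ^{n_ℓ}}(W_1, …, W_ℓ)` for some finite dimensional
`(g ⊗ A / m_i^{n_i})`-modules `W_i`. -/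
def IsEvaluationAt [CharZero k] (N : LieSuperModule (L.map A) V) {ℓ : ℕ}
    (m : Fin ℓ → MaximalSpectrum A) (n : Fin ℓ → ℕ) : Prop :=
  ∃ (W : Fin ℓ → Type x) (_ : ∀ i, AddCommGroup (W i)) (_ : ∀ i, Module k (W i))
    (P : ∀ i, LieSuperModule (L.map (A ⧸ (m i).asIdeal ^ n i)) (W i)),
    (∀ i, Module.Finite k (W i)) ∧
      N.IsIsomorphic ((outerTensor P).pullback (L.evalHom fun i => (m i).asIdeal ^ n i))

/-- Generalized evaluation modules. -/
def IsGeneralizedEvaluation [CharZero k] (N : LieSuperModule (L.map A) V) : Prop :=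
  ∃ (ℓ : ℕ) (m : Fin ℓ → MaximalSpectrum A) (n : Fin ℓ → ℕ),
    Function.Injective m ∧ (∀ i, (m i).IsRational k) ∧ (∀ i, 1 ≤ n i) ∧ N.IsEvaluationAt m n

/-- Evaluation modules: the case where all exponents are `1`. -/
def IsEvaluation [CharZero k] (N : LieSuperModule (L.map A) V) : Prop :=
  ∃ (ℓ : ℕ) (m : Fin ℓ → MaximalSpectrum A),
    Function.Injective m ∧ (∀ i, (m i).IsRational k) ∧ N.IsEvaluationAt m fun _ => 1

/-- The annihilator in `A` of a `(g ⊗ A)`-module: the sum of the ideals `I` of `A` such that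
`g ⊗ I` acts by zero. -/
def annihilator (N : LieSuperModule (L.map A) V) : Ideal A :=
  sSup {I : Ideal A | ∀ x : g, ∀ f ∈ I, ∀ v : V, N.act (x ⊗ₜ f) v = 0}

/-- The support of a `(g ⊗ A)`-module. -/
def support (N : LieSuperModule (L.map A) V) : Set (MaximalSpectrum A) :=
  {m | N.annihilator ≤ m.asIdeal}

/-- The support is reduced if the annihilator is a radical ideal. -/
def HasReducedSupport (N : LieSuperModule (L.map A) V) : Prop :=
  N.annihilator.IsRadical

end LieSuperModule

end

noncomputable section

/-! ### Faithful completely reducible modules over Lie algebras -/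

section ReductiveLieAlgebra

open LieModule Module.End

variable {k q U : Type*} [Field k] [LieRing q]
  [AddCommGroup U] [Module k U] [LieRingModule q U]

/-! A generalized evaluation module at `m_1^{n_1}, …, m_ℓ^{n_ℓ}` is annihilated by the intersection
`I` of these powers, so every maximal ideal in its support contains `I` and is one of the `m_i`. If
all exponents are 1, then `A ⧸ I` is a finite product of fields; its ideals are all radical, so the
annihilator is radical.

Conversely, let the support be finite. As `A` is noetherian and Jacobson, the annihilator contains
an intersection of powers of maximal ideals, with exponents 1 if it is radical. Elements `a_i` of
`A` that are orthogonal idempotents modulo this intersection split the action into supercommuting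
actions of `x ⊗ a_i b`, the `i`-th of which factors through `A ⧸ m_i^{n_i}`. It remains to write `V`
as an outer tensor product of irreducible modules `W_i` for these actions
(`SupercommutingActions.exists_tensorEquiv`). Let `R_i` be the algebra of operators generated by the
`i`-th action. Irreducibility of `V` makes `R_i` faithful on each of its nonzero graded submodules
(`eq_zero_of_forall_mem`). If `W_i` is irreducible even without its grading, Burnside's theorem
identifies `R_i` with `End W_i`, and products of matrix units from the various `R_i`, applied to a
suitable vector, give the isomorphism.

The proviso is where the structure of `g` enters (`IsIrreducible.eq_bot_or_eq_top`): a super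
irreducible module may split after the grading is forgotten, and then it has an odd automorphism
`φ`. This is excluded by a triangular decomposition `n⁻ ⊕ (r ⊕ m) ⊕ n⁺` with `r` even, `m` odd and
`[m, m] = 0`. A space `W` of highest weight vectors of a single parity, also killed by `m`,
generates `V`; hence `V = W + n⁻V`, and `n⁻V` contains everything of the other parity. Since `φ`
preserves `n⁻V` and exchanges parities, `n⁻V = V`, against the existence of a lowest weight
functional. For `𝔰𝔩(n,n)` the decomposition is by blocks, with `m = 0`. For basic classical `g` it
comes from the eigenvalues of a regular even element, and `[m, m] = 0` follows from the invariant
form. -/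

theorem LieSubmodule.eq_top_of_forall_exists_mem [ComplementedLattice (LieSubmodule k q U)]
    (D : LieSubmodule k q U) (h : ∀ W : LieSubmodule k q U, W ≠ ⊥ → ∃ v ∈ W, v ∈ D ∧ v ≠ 0) :
    D = ⊤ := by
  obtain ⟨W, hW⟩ := exists_isCompl D
  by_cases hb : W = ⊥
  · subst hb; simpa using hW.sup_eq_top
  · obtain ⟨v, hv, hv', h0⟩ := h W hb
    have : v ∈ D ⊓ W := ⟨hv', hv⟩
    rw [hW.inf_eq_bot] at this
    exact absurd (by simpa using this) h0

variable [LieAlgebra k q] [LieModule k q U] [IsAlgClosed k] [Module.Finite k U]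

theorem LieSubmodule.exists_hasEigenvector (t : q) (W : LieSubmodule k q U) (hW : W ≠ ⊥) :
    ∃ v ∈ W, v ≠ 0 ∧ ∃ μ : k, ⁅t, v⁆ = μ • v := by
  have : Nontrivial W := (LieSubmodule.nontrivial_iff_ne_bot k q U).2 hW
  obtain ⟨μ, hμ⟩ := Module.End.exists_eigenvalue (LieModule.toEnd k q W t)
  obtain ⟨w, hw⟩ := hμ.exists_hasEigenvector
  refine ⟨w, w.2, fun h => hw.2 (by ext; simpa using h), μ, ?_⟩
  have := congrArg Subtype.val hw.apply_eq_smul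
  simpa using this

/-- If `ad t` is diagonalizable, then so is the action of `t` on any completely reducible module. -/
theorem LieModule.iSup_eigenspace_toEnd_eq_top [ComplementedLattice (LieSubmodule k q U)] (t : q)
    (ht : ⨆ μ, (LieAlgebra.ad k q t).eigenspace μ = ⊤) :
    ⨆ μ, (LieModule.toEnd k q U t).eigenspace μ = ⊤ := by
  -- Eigenvectors of `ad t` shift the eigenvalues of `t`, so the sum of the eigenspaces is a
  -- submodule. Every nonzero submodule contains an eigenvector, so a complement of this sum must
  -- vanish.
  let D : LieSubmodule k q U :=
    { toSubmodule := ⨆ μ, (LieModule.toEnd k q U t).eigenspace μ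
      lie_mem := by
        intro x v hv
        change v ∈ ⨆ μ, (LieModule.toEnd k q U t).eigenspace μ at hv
        change ⁅x, v⁆ ∈ ⨆ μ, (LieModule.toEnd k q U t).eigenspace μ
        induction hv using Submodule.iSup_induction' with
        | zero => simp
        | add v w _ _ hv hw => rw [lie_add]; exact Submodule.add_mem _ hv hw
        | mem μ v hv =>
          have hx : x ∈ ⨆ μ, (LieAlgebra.ad k q t).eigenspace μ := by rw [ht]; trivial
          induction hx using Submodule.iSup_induction' with
          | zero => simp
          | add y z _ _ hy hz => rw [add_lie]; exact Submodule.add_mem _ hy hz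
          | mem ν x hx =>
            refine Submodule.mem_iSup_of_mem (ν + μ) ?_
            rw [mem_eigenspace_iff] at hx hv ⊢
            simp only [LieAlgebra.ad_apply, toEnd_apply_apply] at hx hv ⊢
            rw [leibniz_lie, hx, hv, smul_lie, lie_smul, add_smul] }
  have hD : D = ⊤ := by
    refine LieSubmodule.eq_top_of_forall_exists_mem D fun W hW => ?_
    obtain ⟨v, hv, h0, μ, hμ⟩ := LieSubmodule.exists_hasEigenvector t W hW
    exact ⟨v, hv, Submodule.mem_iSup_of_mem μ (by simpa [mem_eigenspace_iff] using hμ), h0⟩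
  exact congrArg LieSubmodule.toSubmodule hD

variable [CharZero k] [Module.Finite k q] [ComplementedLattice (LieSubmodule k q U)]

/-- The radical of a Lie algebra with a faithful completely reducible module is central. -/
theorem LieModule.lie_eq_zero_of_mem_radical (hf : ∀ x : q, (∀ u : U, ⁅x, u⁆ = 0) → x = 0)
    {x : q} (hx : x ∈ LieAlgebra.radical k q) (y : q) : ⁅x, y⁆ = 0 := by
  let R := LieAlgebra.radical k q
  -- In characteristic zero the weight spaces of the solvable ideal `R` are submodules, and by Lie's
  -- theorem every nonzero submodule contains a weight vector. On a weight space `x` is a scalar, so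
  -- `⁅x, y⁆` acts by zero.
  let D : LieSubmodule k q U := ⨆ χ : R → k, weightSpaceOfIsLieTower k U χ
  have hD : D = ⊤ := by
    refine LieSubmodule.eq_top_of_forall_exists_mem D fun W hW => ?_
    have : Nontrivial W := (LieSubmodule.nontrivial_iff_ne_bot k q U).2 hW
    obtain ⟨χ, hχ⟩ := exists_nontrivial_weightSpace_of_isSolvable k R W
    obtain ⟨⟨w, hw⟩, h0⟩ := exists_ne (0 : weightSpace W χ)
    rw [mem_weightSpace] at hw
    refine ⟨w, w.2, ?_, fun h => h0 (by ext; simpa using h)⟩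
    refine (le_iSup (fun χ : R → k => weightSpaceOfIsLieTower k U χ) χ) ?_
    change (w : U) ∈ weightSpace U χ
    rw [mem_weightSpace]
    exact fun r => congrArg Subtype.val (hw r)
  refine hf _ fun u => ?_
  have hu : u ∈ D := by rw [hD]; trivial
  induction hu using LieSubmodule.iSup_induction' with
  | zero => simp
  | add v w _ _ hv hw => rw [lie_add, hv, hw, add_zero]
  | mem χ v hv =>
    have h1 : ∀ w ∈ weightSpaceOfIsLieTower k U χ, ⁅x, w⁆ = χ ⟨x, hx⟩ • w := fun w hw => by
      have hw' : w ∈ weightSpace U χ := hw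
      rw [mem_weightSpace] at hw'
      exact hw' ⟨x, hx⟩
    rw [lie_lie, h1 ⁅y, v⁆ ((weightSpaceOfIsLieTower k U χ).lie_mem hv), h1 v hv, lie_smul,
      sub_self]

/-- The radical of a Lie algebra with a faithful completely reducible module meets the derived
algebra trivially. -/
theorem LieModule.eq_zero_of_mem_radical_of_mem_lcs
    (hf : ∀ x : q, (∀ u : U, ⁅x, u⁆ = 0) → x = 0)
    {x : q} (hx : x ∈ LieAlgebra.radical k q) (hx' : x ∈ lowerCentralSeries k q q 1) : x = 0 := by
  have hc := fun y => LieModule.lie_eq_zero_of_mem_radical hf hx y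
  have had : LieAlgebra.ad k q x = 0 := by ext y; exact hc y
  have hD := LieModule.iSup_eigenspace_toEnd_eq_top (U := U) x (by
    rw [had, eq_top_iff]
    exact le_iSup_of_le 0 (by simp [eigenspace_zero]))
  refine hf x fun u => ?_
  have hu : u ∈ ⨆ μ, (LieModule.toEnd k q U x).eigenspace μ := by rw [hD]; trivial
  induction hu using Submodule.iSup_induction' with
  | zero => simp
  | add v w _ _ hv hw => rw [lie_add, hv, hw, add_zero]
  | mem μ v hv =>
    by_cases hv0 : v = 0
    · simp [hv0]
    -- Since `x` is central, its eigenspaces are submodules. Its trace on such an eigenspace is `μ`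
    -- times the dimension, and vanishes because `x` lies in the derived algebra; hence `μ = 0`.
    let E : LieSubmodule k q U :=
      { toSubmodule := (LieModule.toEnd k q U x).eigenspace μ
        lie_mem := by
          intro y v hv
          change v ∈ (LieModule.toEnd k q U x).eigenspace μ at hv
          change ⁅y, v⁆ ∈ (LieModule.toEnd k q U x).eigenspace μ
          rw [mem_eigenspace_iff, toEnd_apply_apply] at hv ⊢
          rw [leibniz_lie, hc, zero_lie, zero_add, hv, lie_smul] }
    have ht := LieModule.trace_toEnd_eq_zero_of_mem_lcs (R := k) (L := q) (M := E) le_rfl hx'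
    have hE : LieModule.toEnd k q E x = μ • LinearMap.id := by
      ext w
      have := w.2
      change (w : U) ∈ (LieModule.toEnd k q U x).eigenspace μ at this
      rw [mem_eigenspace_iff, toEnd_apply_apply] at this
      simpa using this
    rw [hE, map_smul, LinearMap.trace_id, smul_eq_mul, mul_eq_zero] at ht
    rw [mem_eigenspace_iff, toEnd_apply_apply] at hv
    rcases ht with rfl | ht
    · simpa using hv
    · have : Nontrivial E := ⟨⟨⟨v, by simpa [E, mem_eigenspace_iff] using hv⟩, 0,
        fun h => hv0 (congrArg Subtype.val h)⟩⟩
      exact absurd ht (by exact_mod_cast (Module.finrank_pos (R := k) (M := E)).ne')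

end ReductiveLieAlgebra

/-! ### Maximal tori of Lie algebras with central radical -/

section CentralRadical

variable {k q : Type*} [Field k] [LieRing q] [LieAlgebra k q]

/-- The projection onto the quotient by an ideal, as a homomorphism of Lie algebras. -/
def LieIdeal.quotientMap (I : LieIdeal k q) : q →ₗ⁅k⁆ q ⧸ I :=
  { I.toSubmodule.mkQ with map_lie' := fun {x y} => LieSubmodule.Quotient.mk_bracket (I := I) x y }

theorem LieIdeal.quotientMap_surjective (I : LieIdeal k q) : Function.Surjective I.quotientMap :=
  I.toSubmodule.mkQ_surjective

theorem LieIdeal.quotientMap_eq_zero {I : LieIdeal k q} {x : q} : I.quotientMap x = 0 ↔ x ∈ I :=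
  LieSubmodule.Quotient.mk_eq_zero'

variable [Module.Finite k q]

/-- The preimage of an abelian ideal has its derived algebra inside the central ideal `R`, so it is
solvable of derived length at most 2 and therefore contained in `R`. -/
theorem LieAlgebra.hasTrivialRadical_quotient_radical (R : LieIdeal k q)
    (hR : R = LieAlgebra.radical k q) (hc : ∀ x ∈ R, ∀ y : q, ⁅x, y⁆ = 0) :
    LieAlgebra.HasTrivialRadical k (q ⧸ R) := by
  rw [LieAlgebra.hasTrivialRadical_iff_no_abelian_ideals]
  intro I hI
  have hJ : LieAlgebra.IsSolvable (I.comap R.quotientMap) := by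
    refine LieAlgebra.IsSolvable.mk (R := k) (k := 2) ?_
    rw [LieIdeal.derivedSeries_eq_bot_iff, LieAlgebra.derivedSeriesOfIdeal_succ,
      LieAlgebra.derivedSeriesOfIdeal_succ, LieAlgebra.derivedSeriesOfIdeal_zero]
    have h1 : ⁅I.comap R.quotientMap, I.comap R.quotientMap⁆ ≤ R := by
      rw [LieSubmodule.lie_le_iff]
      intro x hx y hy
      rw [← LieIdeal.quotientMap_eq_zero, LieHom.map_lie]
      exact congrArg Subtype.val (hI.trivial ⟨_, hx⟩ ⟨_, hy⟩)
    rw [eq_bot_iff, LieSubmodule.lie_le_iff]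
    intro x hx y _
    rw [hc x (h1 hx)]
    exact LieSubmodule.zero_mem _
  have hle := (LieAlgebra.LieIdeal.solvable_iff_le_radical k q _).1 hJ
  rw [← hR] at hle
  rw [eq_bot_iff]
  intro x hx
  obtain ⟨y, rfl⟩ := R.quotientMap_surjective x
  have : R.quotientMap y = 0 := LieIdeal.quotientMap_eq_zero.2 (hle hx)
  rw [this]; exact LieSubmodule.zero_mem _

variable [IsAlgClosed k] [CharZero k]

/-- A Lie algebra with central radical which meets the derived algebra trivially has a subspace of
commuting diagonalizable elements which is its own centralizer. -/
theorem LieAlgebra.exists_torus (R : LieIdeal k q) (hR : R = LieAlgebra.radical k q)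
    (hc : ∀ x ∈ R, ∀ y : q, ⁅x, y⁆ = 0)
    (hd : ∀ x ∈ R, x ∈ LieModule.lowerCentralSeries k q q 1 → x = 0) :
    ∃ T : Submodule k q, (∀ s ∈ T, ∀ t ∈ T, ⁅s, t⁆ = 0) ∧
      (∀ t ∈ T, ⨆ μ, (LieAlgebra.ad k q t).eigenspace μ = ⊤) ∧
      ∀ y, (∀ t ∈ T, ⁅t, y⁆ = 0) → y ∈ T := by
  have := LieAlgebra.hasTrivialRadical_quotient_radical R hR hc
  obtain ⟨h, hh⟩ := LieAlgebra.exists_isCartanSubalgebra_engel k (q ⧸ R)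
  generalize LieSubalgebra.engel k h = H at hh
  have hd' : ∀ x y : q, ⁅x, y⁆ ∈ R → ⁅x, y⁆ = 0 := fun x y hxy => hd _ hxy (by
    rw [LieModule.lowerCentralSeries_succ]
    exact LieSubmodule.lie_mem_lie trivial trivial)
  -- The torus is the preimage of a Cartan subalgebra of the semisimple quotient.
  refine ⟨H.toSubmodule.comap (R.quotientMap : q →ₗ[k] q ⧸ R), ?_, ?_, ?_⟩
  · intro s hs t ht
    apply hd'
    rw [← LieIdeal.quotientMap_eq_zero, LieHom.map_lie]
    have := trivial_lie_zero H H ⟨_, hs⟩ ⟨_, ht⟩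
    exact congrArg Subtype.val this
  · intro t ht
    have hss : (LieAlgebra.ad k (q ⧸ R) (R.quotientMap t)).IsSemisimple :=
      LieAlgebra.IsKilling.isSemisimple_ad_of_mem_isCartanSubalgebra (H := H) ht
    have htop := hss.iSup_eigenspace_eq_top
    have hRle : R.toSubmodule ≤ ⨆ μ, (LieAlgebra.ad k q t).eigenspace μ := by
      intro x hx
      refine Submodule.mem_iSup_of_mem 0 ?_
      rw [Module.End.mem_eigenspace_iff, LieAlgebra.ad_apply, zero_smul, ← lie_skew, hc x hx,
        neg_zero]
    -- Eigenvectors lift from the quotient. Let `r = ⁅t, x⁆ - μ • x`, an element of `R`. For `μ = 0`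
    -- it is a bracket, so it vanishes; for `μ ≠ 0` the vector `x + μ⁻¹ • r` is an eigenvector, as
    -- `r` is central.
    have key : ∀ z ∈ ⨆ μ, (LieAlgebra.ad k (q ⧸ R) (R.quotientMap t)).eigenspace μ, ∀ x,
        R.quotientMap x = z → x ∈ ⨆ μ, (LieAlgebra.ad k q t).eigenspace μ := by
      intro z hz
      induction hz using Submodule.iSup_induction' with
      | zero => exact fun x hx => hRle (LieIdeal.quotientMap_eq_zero.1 hx)
      | add v w _ _ hv hw =>
        intro x hx
        obtain ⟨y, rfl⟩ := R.quotientMap_surjective v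
        rw [← add_sub_cancel y x]
        refine Submodule.add_mem _ (hv y rfl) (hw _ ?_)
        rw [map_sub, hx, add_sub_cancel_left]
      | mem μ z hz =>
        intro x hx
        rw [Module.End.mem_eigenspace_iff, LieAlgebra.ad_apply, ← hx, ← LieHom.map_lie] at hz
        have hr : ⁅t, x⁆ - μ • x ∈ R := by
          rw [← LieIdeal.quotientMap_eq_zero, map_sub, map_smul, hz, sub_self]
        by_cases hμ : μ = 0
        · subst hμ
          refine Submodule.mem_iSup_of_mem 0 ?_
          rw [zero_smul, sub_zero] at hr
          rw [Module.End.mem_eigenspace_iff, LieAlgebra.ad_apply, hd' _ _ hr, zero_smul]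
        · have ht0 : ⁅t, ⁅t, x⁆ - μ • x⁆ = 0 := by rw [← lie_skew, hc _ hr, neg_zero]
          have h2 : x + μ⁻¹ • (⁅t, x⁆ - μ • x) ∈ ⨆ μ, (LieAlgebra.ad k q t).eigenspace μ := by
            refine Submodule.mem_iSup_of_mem μ ?_
            rw [Module.End.mem_eigenspace_iff, LieAlgebra.ad_apply, lie_add, lie_smul, ht0, smul_add, smul_smul, mul_inv_cancel₀ hμ]
            simp
          have := Submodule.sub_mem _ h2 (Submodule.smul_mem _ μ⁻¹ (hRle hr))
          rwa [add_sub_cancel_right] at this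
    rw [eq_top_iff]
    exact fun x _ => key _ (by rw [htop]; trivial) x rfl
  · intro y hy
    change R.quotientMap y ∈ H
    -- The image of `y` centralizes `H`, hence normalizes it, and Cartan subalgebras are
    -- self-normalizing.
    rw [← LieSubalgebra.IsCartanSubalgebra.self_normalizing (H := H),
      LieSubalgebra.mem_normalizer_iff']
    intro z hz
    obtain ⟨t, rfl⟩ := R.quotientMap_surjective z
    rw [← LieHom.map_lie, hy t hz, map_zero]
    exact H.zero_mem

end CentralRadical

/-! ### Graded subspaces and parity operators -/

namespace SuperSpace

variable {k V : Type*} [Field k] [AddCommGroup V] [Module k V] (S : SuperSpace k V)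

theorem parityOp_parityOp (v : V) : S.parityOp (S.parityOp v) = v :=
  LinearMap.congr_fun S.parityOp_mul_self v

theorem add_parityOp (v : V) : v + S.parityOp v = (2 : k) • S.proj 0 v := by
  nth_rewrite 1 [← S.proj_add_proj v]
  simp only [parityOp, LinearMap.sub_apply, two_smul]; abel

theorem sub_parityOp (v : V) : v - S.parityOp v = (2 : k) • S.proj 1 v := by
  nth_rewrite 1 [← S.proj_add_proj v]
  simp only [parityOp, LinearMap.sub_apply, two_smul]; abel

theorem exists_proj_ne_zero {v : V} (hv : v ≠ 0) : ∃ p, S.proj p v ≠ 0 := by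
  by_contra! h
  exact hv (by rw [← S.proj_add_proj v, h, h, add_zero])

theorem parityOp_mem_of_isGraded {W : Submodule k V} (h : S.IsGraded W) {w : V} (hw : w ∈ W) :
    S.parityOp w ∈ W :=
  Submodule.sub_mem _ (h w hw 0) (h w hw 1)

theorem isGraded_part (p : ZMod 2) : S.IsGraded (S.part p) := by
  intro w hw q
  by_cases h : q = p
  · subst h; exact S.proj_mem _ _
  · rw [S.proj_of_mem_ne h hw]; exact Submodule.zero_mem _

theorem isGraded_of_le_part {W : Submodule k V} {p : ZMod 2} (h : W ≤ S.part p) :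
    S.IsGraded W := by
  intro w hw q
  by_cases hq : q = p
  · subst hq; rwa [S.proj_of_mem (h hw)]
  · rw [S.proj_of_mem_ne hq (h hw)]; exact Submodule.zero_mem _

theorem eq_top_of_part_le {W : Submodule k V} (h : ∀ p, S.part p ≤ W) : W = ⊤ := by
  rw [eq_top_iff]
  rintro v -
  rw [← S.proj_add_proj v]
  exact Submodule.add_mem _ (h 0 (S.proj_mem 0 v)) (h 1 (S.proj_mem 1 v))

variable [CharZero k]

theorem isGraded_of_parityOp_mem {W : Submodule k V} (h : ∀ w ∈ W, S.parityOp w ∈ W) :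
    S.IsGraded W := by
  intro w hw p
  rcases ZMod.two_cases p with rfl | rfl
  · rw [← Submodule.smul_mem_iff W (two_ne_zero (α := k)), ← S.add_parityOp]
    exact Submodule.add_mem _ hw (h w hw)
  · rw [← Submodule.smul_mem_iff W (two_ne_zero (α := k)), ← S.sub_parityOp]
    exact Submodule.sub_mem _ hw (h w hw)

theorem mem_part_iff {p : ZMod 2} {v : V} :
    v ∈ S.part p ↔ S.parityOp v = superSign k 1 p • v := by
  refine ⟨S.parityOp_of_mem, fun h => ?_⟩
  rcases ZMod.two_cases p with rfl | rfl
  · have h2 := S.add_parityOp v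
    rw [h, show superSign k 1 0 = 1 by simp [superSign], one_smul, ← two_smul k] at h2
    rw [smul_right_injective V (two_ne_zero (α := k)) h2]
    exact S.proj_mem 0 v
  · have h2 := S.sub_parityOp v
    rw [h, show superSign k 1 1 = -1 by simp [superSign], neg_smul, one_smul, sub_neg_eq_add,
      ← two_smul k] at h2
    rw [smul_right_injective V (two_ne_zero (α := k)) h2]
    exact S.proj_mem 1 v

end SuperSpace

/-! ### Common kernels of anticommuting operators -/

section Anticommuting

variable {k V : Type*} [Field k] [CharZero k] [AddCommGroup V] [Module k V] [Module.Finite k V]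

/-- Pairwise anticommuting operators on a nonzero finite dimensional space have a common kernel. -/
theorem exists_ne_zero_of_anticommuting (S : Set (Module.End k V))
    (hS : ∀ s ∈ S, ∀ t ∈ S, s * t = -(t * s)) (W : Submodule k V) (hW : W ≠ ⊥)
    (hSW : ∀ s ∈ S, ∀ w ∈ W, s w ∈ W) : ∃ w ∈ W, w ≠ 0 ∧ ∀ s ∈ S, s w = 0 := by
  induction hn : Module.finrank k W using Nat.strong_induction_on generalizing W with
  | _ n ih =>
    by_cases h : ∀ s ∈ S, ∀ w ∈ W, s w = 0
    · obtain ⟨w, hw, h0⟩ := Submodule.exists_mem_ne_zero_of_ne_bot hW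
      exact ⟨w, hw, h0, fun s hs => h s hs w hw⟩
    · push Not at h
      obtain ⟨s, hs, w, hw, h0⟩ := h
      -- Anticommuting with itself, `s` squares to zero. So `W ⊓ ker s` contains `s w ≠ 0`, is
      -- smaller than `W`, and is stable under the other operators: induction on the dimension
      -- applies.
      have hss : ∀ v, s (s v) = 0 := fun v => by
        have h1 : s (s v) = -s (s v) := LinearMap.congr_fun (hS s hs s hs) v
        have h2 : (2 : k) • s (s v) = 0 := by rw [two_smul]; nth_rewrite 1 [h1]; simp
        exact (smul_eq_zero.1 h2).resolve_left two_ne_zero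
      have hlt : W ⊓ LinearMap.ker s < W := by
        refine lt_of_le_of_ne inf_le_left fun he => h0 ?_
        have : w ∈ W ⊓ LinearMap.ker s := by rwa [he]
        exact this.2
      obtain ⟨v, hv, hv0, hvS⟩ := ih _ (hn ▸ Submodule.finrank_lt_finrank_of_lt hlt)
        (W ⊓ LinearMap.ker s) (fun hb => h0 (by
          have : s w ∈ W ⊓ LinearMap.ker s := ⟨hSW s hs w hw, hss w⟩
          rwa [hb] at this)) (fun t ht v hv => ⟨hSW t ht v hv.1, by
          have h1 : s (t v) = -t (s v) := LinearMap.congr_fun (hS s hs t ht) v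
          change s (t v) = 0
          rw [h1, hv.2, map_zero, neg_zero]⟩) rfl
      exact ⟨v, hv.1, hv0, hvS⟩

end Anticommuting

namespace LieSuperalgebra

variable {k g A : Type*} [Field k] [AddCommGroup g] [Module k g] [CommRing A] [Algebra k A]
  (L : LieSuperalgebra k g)

theorem tmul_mem_part {p : ZMod 2} {x : g} (hx : x ∈ L.part p) (a : A) :
    x ⊗ₜ[k] a ∈ (L.map A).part p := ⟨⟨x, hx⟩ ⊗ₜ a, rfl⟩

theorem map_bracket_tmul (x y : g) (a b : A) :
    (L.map A).bracket (x ⊗ₜ a) (y ⊗ₜ b) = L.bracket x y ⊗ₜ (a * b) := rfl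

/-- A subspace of `g ⊗ A` is everything if it contains the homogeneous pure tensors. -/
theorem eq_top_of_tmul_mem {T : Submodule k (g ⊗[k] A)}
    (h : ∀ p, ∀ x ∈ L.part p, ∀ a : A, x ⊗ₜ a ∈ T) : T = ⊤ := by
  rw [eq_top_iff, ← TensorProduct.span_tmul_eq_top, Submodule.span_le]
  rintro _ ⟨x, a, rfl⟩
  rw [← L.proj_add_proj x, TensorProduct.add_tmul]
  exact Submodule.add_mem _ (h 0 _ (L.proj_mem 0 x) a) (h 1 _ (L.proj_mem 1 x) a)

end LieSuperalgebra

/-! ### Ungraded submodules of irreducible modules -/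

namespace LieSuperModule

section General

variable {k g V : Type*} [Field k] [AddCommGroup g] [Module k g]
  [AddCommGroup V] [Module k V] {L : LieSuperalgebra k g} (N : LieSuperModule L V)

theorem act_parityOp {p : ZMod 2} {x : g} (hx : x ∈ L.part p) (v : V) :
    N.act x (N.parityOp v) = superSign k 1 p • N.parityOp (N.act x v) := by
  refine LinearMap.congr_fun (f := N.act x ∘ₗ N.parityOp)
    (g := superSign k 1 p • (N.parityOp ∘ₗ N.act x)) (N.hom_ext fun q v hv => ?_) v
  have e : (1 + 1 : ZMod 2) = 0 := by decide
  rw [LinearMap.comp_apply, LinearMap.smul_apply, LinearMap.comp_apply, N.parityOp_of_mem hv,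
    N.parityOp_of_mem (N.act_mem p q x hx v hv), map_smul, smul_smul]
  congr 1
  rcases ZMod.two_cases p with rfl | rfl <;> rcases ZMod.two_cases q with rfl | rfl <;>
    simp [superSign, e]

theorem act_act {p q : ZMod 2} {x y : g} (hx : x ∈ L.part p) (hy : y ∈ L.part q) (v : V) :
    N.act x (N.act y v) = N.act (L.bracket x y) v + superSign k p q • N.act y (N.act x v) := by
  rw [N.act_bracket p q x hx y hy v, sub_add_cancel]

theorem act_eq_zero_parityOp {p : ZMod 2} {x : g} (hx : x ∈ L.part p) {v : V}
    (hv : N.act x v = 0) : N.act x (N.parityOp v) = 0 := by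
  rw [N.act_parityOp hx, hv, map_zero, smul_zero]

end General

variable {k g A V : Type*} [Field k] [AddCommGroup g] [Module k g] [CommRing A]
  [Algebra k A] [AddCommGroup V] [Module k V] {L : LieSuperalgebra k g}
  (N : LieSuperModule (L.map A) V)

theorem act_mem_of_tmul {U U' : Submodule k V}
    (h : ∀ p, ∀ x ∈ L.part p, ∀ a : A, ∀ u ∈ U, N.act (x ⊗ₜ a) u ∈ U') (z : g ⊗[k] A) :
    ∀ u ∈ U, N.act z u ∈ U' := by
  intro u hu
  have := L.eq_top_of_tmul_mem (A := A) (T := U'.comap (N.act.flip u))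
    fun p x hx a => h p x hx a u hu
  have hz : z ∈ U'.comap (N.act.flip u) := by rw [this]; trivial
  exact hz

/-- The vectors killed by `x ⊗ a` for all `x` in given subspaces `n p` of parity `p`. -/
def invariants (n : ZMod 2 → Submodule k g) : Submodule k V :=
  ⨅ p, ⨅ x : n p, ⨅ a : A, LinearMap.ker (N.act ((x : g) ⊗ₜ a))

theorem mem_invariants {n : ZMod 2 → Submodule k g} {v : V} :
    v ∈ N.invariants n ↔ ∀ p, ∀ x ∈ n p, ∀ a : A, N.act (x ⊗ₜ a) v = 0 := by
  simp [invariants, Submodule.mem_iInf]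

variable [CharZero k] in
theorem isGraded_invariants {n : ZMod 2 → Submodule k g} (hn : ∀ p, n p ≤ L.part p) :
    N.IsGraded (N.invariants n) := by
  refine N.isGraded_of_parityOp_mem fun w hw => ?_
  rw [mem_invariants] at hw ⊢
  exact fun p x hx a => N.act_eq_zero_parityOp (L.tmul_mem_part (hn p hx) a) (hw p x hx a)

/-- The span of the images of `x ⊗ a` for all `x` in given subspaces `n p` of parity `p`. -/
def imageSpan (n : ZMod 2 → Submodule k g) : Submodule k V :=
  ⨆ p, ⨆ x : n p, ⨆ a : A, LinearMap.range (N.act ((x : g) ⊗ₜ a))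

theorem imageSpan_le {n : ZMod 2 → Submodule k g} {U : Submodule k V} :
    N.imageSpan n ≤ U ↔ ∀ p, ∀ x ∈ n p, ∀ (a : A) v, N.act (x ⊗ₜ a) v ∈ U := by
  simp only [imageSpan, iSup_le_iff, LinearMap.range_le_iff_comap, Subtype.forall]
  simp [eq_top_iff, SetLike.le_def]

theorem act_mem_imageSpan {n : ZMod 2 → Submodule k g} {p : ZMod 2} {x : g} (hx : x ∈ n p) (a : A)
    (v : V) : N.act (x ⊗ₜ a) v ∈ N.imageSpan n :=
  N.imageSpan_le.1 le_rfl p x hx a v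

variable [CharZero k]

theorem isGraded_imageSpan {n : ZMod 2 → Submodule k g} (hn : ∀ p, n p ≤ L.part p) :
    N.IsGraded (N.imageSpan n) := by
  refine N.isGraded_of_parityOp_mem fun w hw => ?_
  have : N.imageSpan n ≤ (N.imageSpan n).comap N.parityOp := by
    rw [imageSpan_le]
    intro p x hx a v
    have h := N.act_parityOp (L.tmul_mem_part (hn p hx) a) (N.parityOp v)
    rw [N.parityOp_parityOp] at h
    rw [h, Submodule.mem_comap, map_smul, N.parityOp_parityOp]
    exact Submodule.smul_mem _ _ (N.act_mem_imageSpan hx a _)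
  exact this hw

/-- An irreducible module which is reducible after forgetting the grading has an odd automorphism of
square one. -/
theorem IsIrreducible.exists_odd_automorphism {N : LieSuperModule (L.map A) V}
    (hN : N.IsIrreducible) {X : Submodule k V} (hX : ∀ z, ∀ u ∈ X, N.act z u ∈ X) (hb : X ≠ ⊥)
    (ht : X ≠ ⊤) : ∃ φ : Module.End k V, (∀ z v, φ (N.act z v) = N.act z (φ v)) ∧
      (∀ v, φ (φ v) = v) ∧ ∀ v, φ (N.parityOp v) = -N.parityOp (φ v) := by
  set Y := X.map N.parityOp with hY
  have hYX : ∀ y ∈ Y, N.parityOp y ∈ X := by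
    rintro _ ⟨x, hx, rfl⟩; rwa [N.parityOp_parityOp]
  have hXY : ∀ x ∈ X, N.parityOp x ∈ Y := fun x hx => Submodule.mem_map_of_mem hx
  have hYact : ∀ z, ∀ u ∈ Y, N.act z u ∈ Y := by
    refine N.act_mem_of_tmul fun p x hx a u hu => ?_
    have h := N.act_parityOp (L.tmul_mem_part hx a) (N.parityOp u)
    rw [N.parityOp_parityOp] at h
    rw [h]
    exact Submodule.smul_mem _ _ (hXY _ (hX _ _ (hYX u hu)))
  -- The intersection and the sum of `X` and its image `Y` under the parity operator are graded
  -- submodules, so irreducibility leaves only `V = X ⊕ Y`.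
  have hc : IsCompl X Y := by
    constructor
    · rw [disjoint_iff]
      refine (hN.2 (X ⊓ Y) (N.isGraded_of_parityOp_mem fun w hw => ⟨hYX w hw.2, hXY w hw.1⟩)
        fun z u hu => ⟨hX z u hu.1, hYact z u hu.2⟩).resolve_right fun h => ht ?_
      rw [eq_top_iff, ← h]; exact inf_le_left
    · rw [codisjoint_iff]
      refine (hN.2 (X ⊔ Y) (N.isGraded_of_parityOp_mem fun w hw => ?_)
        fun z u hu => ?_).resolve_left fun h => hb ?_
      · obtain ⟨x, hx, y, hy, rfl⟩ := Submodule.mem_sup.1 hw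
        rw [map_add, add_comm]
        exact Submodule.add_mem_sup (hYX y hy) (hXY x hx)
      · obtain ⟨x, hx, y, hy, rfl⟩ := Submodule.mem_sup.1 hu
        rw [map_add]
        exact Submodule.add_mem_sup (hX z x hx) (hYact z y hy)
      · rw [eq_bot_iff, ← h]; exact le_sup_left
  -- With `X ⊕ Y` viewed as a grading, `φ` is its parity operator: 1 on `X` and -1 on `Y`. The
  -- original parity operator exchanges `X` and `Y`, so `φ` is odd.
  let S : SuperSpace k V := ⟨fun p => if p = 0 then X else Y, by simpa using hc⟩
  have hS0 : S.part 0 = X := rfl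
  have hS1 : S.part 1 = Y := rfl
  refine ⟨S.parityOp, fun z v => ?_, S.parityOp_parityOp, fun v => ?_⟩
  · refine LinearMap.congr_fun (f := S.parityOp ∘ₗ N.act z) (g := N.act z ∘ₗ S.parityOp)
      (S.hom_ext fun p v hv => ?_) v
    have : N.act z v ∈ S.part p := by
      rcases ZMod.two_cases p with rfl | rfl
      · exact hX z v hv
      · exact hYact z v hv
    simp only [LinearMap.comp_apply, S.parityOp_of_mem hv, S.parityOp_of_mem this, map_smul]
  · refine LinearMap.congr_fun (f := S.parityOp ∘ₗ N.parityOp) (g := -(N.parityOp ∘ₗ S.parityOp))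
      (S.hom_ext fun p v hv => ?_) v
    have e : (1 + 1 : ZMod 2) = 0 := by decide
    have : N.parityOp v ∈ S.part (p + 1) := by
      rcases ZMod.two_cases p with rfl | rfl
      · exact hXY v hv
      · rw [e]; exact hYX v hv
    simp only [LinearMap.comp_apply, LinearMap.neg_apply, S.parityOp_of_mem hv,
      S.parityOp_of_mem this, map_smul]
    rcases ZMod.two_cases p with rfl | rfl <;> simp [superSign, e]

variable [Module.Finite k V]

/-- For a Lie superalgebra with a suitable triangular decomposition, irreducible modules remain
irreducible after forgetting the grading. -/
theorem IsIrreducible.eq_bot_or_eq_top_of_triangular {N : LieSuperModule (L.map A) V}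
    (hN : N.IsIrreducible) {np nm : ZMod 2 → Submodule k g} {r m : Submodule k g}
    (hnp : ∀ p, np p ≤ L.part p) (hnm : ∀ p, nm p ≤ L.part p) (hr : r ≤ L.part 0)
    (hm : m ≤ L.part 1) (hspan0 : L.part 0 ≤ nm 0 ⊔ r ⊔ np 0)
    (hspan1 : L.part 1 ≤ nm 1 ⊔ m ⊔ np 1)
    (hnr : ∀ p, ∀ x ∈ np p, ∀ t ∈ r, L.bracket x t ∈ np p)
    (hnm' : ∀ p, ∀ x ∈ np p, ∀ y ∈ m, L.bracket x y ∈ np (p + 1))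
    (hmr : ∀ x ∈ m, ∀ t ∈ r, L.bracket x t ∈ m)
    (hmm : ∀ x ∈ m, ∀ y ∈ m, L.bracket x y = 0)
    (hpos : N.invariants np ≠ ⊥) (hneg : N.imageSpan nm ≠ ⊤) {X : Submodule k V}
    (hX : ∀ z, ∀ u ∈ X, N.act z u ∈ X) : X = ⊥ ∨ X = ⊤ := by
  by_contra! hcon
  obtain ⟨φ, hφ, hφ2, hφP⟩ := hN.exists_odd_automorphism hX hcon.1 hcon.2
  -- a nonzero homogeneous vector killed by `np` and `m`
  let nm2 : ZMod 2 → Submodule k g := fun p => if p = 0 then ⊥ else m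
  have hnm2 : ∀ p, nm2 p ≤ L.part p := by
    intro p
    rcases ZMod.two_cases p with rfl | rfl
    · exact bot_le
    · exact hm
  have hanti : ∀ x ∈ m, ∀ y ∈ m, ∀ (a b : A) v, N.act (x ⊗ₜ a) (N.act (y ⊗ₜ b) v) =
      -N.act (y ⊗ₜ b) (N.act (x ⊗ₜ a) v) := by
    intro x hx y hy a b v
    rw [N.act_act (L.tmul_mem_part (hm hx) a) (L.tmul_mem_part (hm hy) b), L.map_bracket_tmul,
      hmm x hx y hy, TensorProduct.zero_tmul, map_zero, LinearMap.zero_apply, zero_add]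
    simp [superSign]
  -- As `[m, m] = 0`, the operators from `m ⊗ A` anticommute; they preserve the `np`-invariants and
  -- so have a common kernel there.
  obtain ⟨w, hw, hw0, hwm⟩ := exists_ne_zero_of_anticommuting
    {f | ∃ x ∈ m, ∃ a : A, f = N.act (x ⊗ₜ a)} (by
      rintro _ ⟨x, hx, a, rfl⟩ _ ⟨y, hy, b, rfl⟩
      exact LinearMap.ext fun v => hanti x hx y hy a b v) (N.invariants np) hpos (by
      rintro _ ⟨x, hx, a, rfl⟩ w hw
      rw [mem_invariants] at hw ⊢
      intro p y hy b
      rw [N.act_act (L.tmul_mem_part (hnp p hy) b) (L.tmul_mem_part (hm hx) a),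
        L.map_bracket_tmul, hw _ _ (hnm' p y hy x hx), hw p y hy, map_zero, smul_zero, add_zero])
  have hw2 : w ∈ N.invariants nm2 := by
    rw [mem_invariants]
    intro p x hx a
    rcases ZMod.two_cases p with rfl | rfl
    · have : x = 0 := hx
      simp [this]
    · exact hwm _ ⟨x, hx, a, rfl⟩
  obtain ⟨p, hp⟩ := N.exists_proj_ne_zero hw0
  set W := N.part p ⊓ N.invariants np ⊓ N.invariants nm2 with hW
  have hWne : N.proj p w ∈ W := ⟨⟨N.proj_mem p w, N.isGraded_invariants hnp w hw p⟩,
    N.isGraded_invariants hnm2 w hw2 p⟩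
  have hWr : ∀ t ∈ r, ∀ a : A, ∀ w ∈ W, N.act (t ⊗ₜ a) w ∈ W := by
    rintro t ht a w ⟨⟨hw1, hw2⟩, hw3⟩
    have hta := L.tmul_mem_part (hr ht) a
    refine ⟨⟨?_, ?_⟩, ?_⟩
    · simpa using N.act_mem 0 p _ hta w hw1
    · rw [SetLike.mem_coe, mem_invariants] at hw2 ⊢
      intro q x hx b
      rw [N.act_act (L.tmul_mem_part (hnp q hx) b) hta, L.map_bracket_tmul,
        hw2 _ _ (hnr q x hx t ht), hw2 q x hx, map_zero, smul_zero, add_zero]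
    · rw [SetLike.mem_coe, mem_invariants] at hw3 ⊢
      intro q x hx b
      rw [N.act_act (L.tmul_mem_part (hnm2 q hx) b) hta, L.map_bracket_tmul,
        hw3 q x hx, map_zero, smul_zero, add_zero]
      rcases ZMod.two_cases q with rfl | rfl
      · have : x = 0 := hx
        simp [this]
      · exact hw3 1 _ (hmr x hx t ht) _
  -- the submodule generated by `W`
  let C : Set (Submodule k V) := {Y | W ≤ Y ∧ ∀ q, ∀ x ∈ nm q, ∀ (a : A), ∀ y ∈ Y,
    N.act (x ⊗ₜ a) y ∈ Y}
  set Y := sInf C with hYdef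
  have hWY : W ≤ Y := le_sInf fun Z hZ => hZ.1
  have hYn : ∀ q, ∀ x ∈ nm q, ∀ (a : A), ∀ y ∈ Y, N.act (x ⊗ₜ a) y ∈ Y := by
    intro q x hx a y hy
    rw [hYdef, Submodule.mem_sInf] at hy ⊢
    exact fun Z hZ => hZ.2 q x hx a y (hy Z hZ)
  have hYle : ∀ Z ∈ C, Y ≤ Z := fun Z hZ => sInf_le hZ
  have hYact : ∀ z, ∀ y ∈ Y, N.act z y ∈ Y := by
    -- The vectors of `Y` that all of `g ⊗ A` maps into `Y` include `W`, and they are stable under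
    -- `nm`: move the arbitrary element past the one from `nm`, at the cost of a bracket. By
    -- minimality they exhaust `Y`.
    have hle : Y ≤ Y ⊓ ⨅ z, Y.comap (N.act z) := by
      apply hYle
      simp only [C, Set.mem_ofPred_eq, SetLike.le_def, Submodule.mem_inf, Submodule.mem_iInf,
        Submodule.mem_comap]
      refine ⟨fun w hw => ⟨hWY hw, fun z => ?_⟩, fun q x hx a y hy =>
        ⟨hYn q x hx a y hy.1, fun z => ?_⟩⟩
      · refine N.act_mem_of_tmul (U := W) (fun q x hx a u hu => ?_) z w hw
        have hkey : ∀ (s t : g), s ∈ nm q → (N.act (t ⊗ₜ[k] a) u ∈ Y) → ∀ n ∈ np q,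
            N.act ((s + t + n) ⊗ₜ[k] a) u ∈ Y := by
          intro s t hs ht n hn
          rw [TensorProduct.add_tmul, TensorProduct.add_tmul, map_add, map_add,
            LinearMap.add_apply, LinearMap.add_apply, N.mem_invariants.1 hu.1.2 q n hn a, add_zero]
          exact Submodule.add_mem _ (hYn q s hs a u (hWY hu)) ht
        rcases ZMod.two_cases q with rfl | rfl
        · obtain ⟨_, h1, n, hn, rfl⟩ := Submodule.mem_sup.1 (hspan0 hx)
          obtain ⟨s, hs, t, ht, rfl⟩ := Submodule.mem_sup.1 h1
          exact hkey s t hs (hWY (hWr t ht a u hu)) n hn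
        · obtain ⟨_, h1, n, hn, rfl⟩ := Submodule.mem_sup.1 (hspan1 hx)
          obtain ⟨s, hs, t, ht, rfl⟩ := Submodule.mem_sup.1 h1
          refine hkey s t hs ?_ n hn
          rw [N.mem_invariants.1 hu.2 1 t ht a]
          exact Submodule.zero_mem _
      · refine N.act_mem_of_tmul (U := k ∙ (N.act (x ⊗ₜ[k] a) y)) (fun q' x' hx' b u hu => ?_) z _
          (Submodule.mem_span_singleton_self _)
        obtain ⟨c, rfl⟩ := Submodule.mem_span_singleton.1 hu
        rw [map_smul, N.act_act (L.tmul_mem_part hx' b) (L.tmul_mem_part (hnm q hx) a)]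
        exact Submodule.smul_mem _ _ (Submodule.add_mem _ (hy.2 _)
          (Submodule.smul_mem _ _ (hYn q x hx a _ (hy.2 _))))
    intro z y hy
    have := (hle hy).2
    rw [SetLike.mem_coe, Submodule.mem_iInf] at this
    exact this z
  have hYgr : N.IsGraded Y := by
    have hle : Y ≤ Y ⊓ Y.comap N.parityOp := by
      apply hYle
      simp only [C, Set.mem_ofPred_eq, SetLike.le_def, Submodule.mem_inf, Submodule.mem_comap]
      refine ⟨fun w hw => ⟨hWY hw, ?_⟩, fun q x hx a y hy => ⟨hYn q x hx a y hy.1, ?_⟩⟩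
      · rw [N.parityOp_of_mem hw.1.1]
        exact Submodule.smul_mem _ _ (hWY hw)
      · have h := N.act_parityOp (L.tmul_mem_part (hnm q hx) a) (N.parityOp y)
        rw [N.parityOp_parityOp] at h
        rw [h, map_smul, N.parityOp_parityOp]
        exact Submodule.smul_mem _ _ (hYn q x hx a _ hy.2)
    exact N.isGraded_of_parityOp_mem fun w hw => (hle hw).2
  have hYtop : Y = ⊤ := (hN.2 Y hYgr hYact).resolve_left fun h => hp (by
    have := hWY hWne
    rwa [h] at this)
  set Q := N.imageSpan nm with hQ
  have hWQ : W ⊔ Q = ⊤ := by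
    rw [eq_top_iff, ← hYtop]
    exact hYle _ ⟨le_sup_left, fun q x hx a y _ =>
      (le_sup_right : Q ≤ W ⊔ Q) (N.act_mem_imageSpan hx a y)⟩
  -- `W` is purely of parity `p`, so it contributes nothing in parity `p + 1`.
  have hodd : N.part (p + 1) ≤ Q := by
    intro v hv
    have hv' : v ∈ W ⊔ Q := by rw [hWQ]; trivial
    obtain ⟨w, hw, q, hq, rfl⟩ := Submodule.mem_sup.1 hv'
    rw [← N.proj_of_mem hv, map_add, N.proj_of_mem_ne (by simp) hw.1.1, zero_add]
    exact N.isGraded_imageSpan hnm q hq _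
  have hφQ : Q ≤ Q.comap φ := by
    rw [hQ, imageSpan_le]
    intro q x hx a v
    rw [Submodule.mem_comap, hφ]
    exact N.act_mem_imageSpan hx a _
  refine hneg (N.eq_top_of_part_le fun q => ?_)
  by_cases hq : q = p + 1
  · rw [hq]; exact hodd
  · have hqp : q = p := by
      have key : ∀ p q : ZMod 2, ¬q = p + 1 → q = p := by decide
      exact key p q hq
    subst hqp
    intro v hv
    -- For `v` of parity `p`, the vector `φ v` has the other parity and lies in `Q`; so does `v = φ
    -- (φ v)`, as `Q` is stable under `φ`.
    rw [← hφ2 v]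
    refine hφQ (hodd ?_)
    rw [SuperSpace.mem_part_iff]
    have := hφP v
    rw [N.parityOp_of_mem hv, map_smul] at this
    have e : (1 + 1 : ZMod 2) = 0 := by decide
    rw [eq_neg_iff_add_eq_zero] at this
    rw [eq_neg_of_add_eq_zero_right this]
    rcases ZMod.two_cases q with rfl | rfl <;> simp [superSign, e]

end LieSuperModule

/-! ### Diagonalizable and eigenvalue-raising operators -/

section LinearAlgebra

variable {k V : Type*} [Field k] [AddCommGroup V] [Module k V] [Module.Finite k V]

theorem Module.End.inf_iSup_eigenspace {f : Module.End k V} {p : Submodule k V}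
    (h : ∀ x ∈ p, f x ∈ p) : p ⊓ ⨆ μ, f.eigenspace μ = ⨆ μ, p ⊓ f.eigenspace μ :=
  Submodule.inf_iSup_genEigenspace h 1

/-- A space of commuting diagonalizable operators contains an element whose kernel is the common
kernel. -/
theorem Module.End.exists_forall_ker_le [Infinite k] (T : Submodule k (Module.End k V))
    (hcomm : ∀ s ∈ T, ∀ t ∈ T, Commute s t) (hdiag : ∀ t ∈ T, ⨆ μ, t.eigenspace μ = ⊤) :
    ∃ d ∈ T, ∀ t ∈ T, LinearMap.ker d ≤ LinearMap.ker t := by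
  -- The element sought is one whose kernel has minimal dimension.
  let P : ℕ → Prop := fun n => ∃ d ∈ T, Module.finrank k (LinearMap.ker d) = n
  have hP : ∃ n, P n := ⟨_, 0, T.zero_mem, rfl⟩
  classical
  obtain ⟨d, hd, hdn⟩ := Nat.find_spec hP
  refine ⟨d, hd, fun t ht => ?_⟩
  -- On a joint eigenvector with eigenvalues `μ` of `d` and `ν ≠ 0` of `t`, the operator `d + c • t`
  -- vanishes only for `c = -(μ / ν)`. Avoiding these finitely many values makes the kernel of `d +
  -- c • t` the intersection of both kernels.
  have hfin : (Set.image2 (fun μ ν => -(μ / ν)) {μ | d.HasEigenvalue μ}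
      {ν | t.HasEigenvalue ν}).Finite :=
    Set.Finite.image2 _ (Module.End.finite_hasEigenvalue d) (Module.End.finite_hasEigenvalue t)
  obtain ⟨c, hc⟩ := hfin.exists_notMem
  set e := d + c • t with he
  have heT : e ∈ T := T.add_mem hd (T.smul_mem c ht)
  have hker : LinearMap.ker e ≤ LinearMap.ker d ⊓ LinearMap.ker t := by
    have hinv : ∀ x ∈ LinearMap.ker e, t x ∈ LinearMap.ker e := by
      intro x hx
      rw [LinearMap.mem_ker] at hx ⊢
      have h1 : e (t x) = t (e x) := LinearMap.congr_fun (hcomm e heT t ht) x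
      rw [h1, hx, map_zero]
    have h1 := Module.End.inf_iSup_eigenspace hinv
    rw [hdiag t ht, inf_top_eq] at h1
    rw [h1, iSup_le_iff]
    rintro ν x ⟨hx, hxν⟩
    rw [SetLike.mem_coe, LinearMap.mem_ker] at hx
    rw [SetLike.mem_coe, Module.End.mem_eigenspace_iff] at hxν
    have hdx : d x = -(c * ν) • x := by
      rw [neg_smul, eq_neg_iff_add_eq_zero, mul_smul, ← hxν]
      exact hx
    by_cases hx0 : x = 0
    · subst hx0; exact Submodule.zero_mem _
    by_cases hν : ν = 0
    · subst hν
      exact ⟨by simpa using hdx, by simpa using hxν⟩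
    · refine absurd ⟨-(c * ν), ?_, ν, ?_, ?_⟩ hc
      · exact Module.End.hasEigenvalue_of_hasEigenvector ⟨Module.End.mem_eigenspace_iff.2 hdx, hx0⟩
      · exact Module.End.hasEigenvalue_of_hasEigenvector ⟨Module.End.mem_eigenspace_iff.2 hxν, hx0⟩
      · field_simp
  have hle : LinearMap.ker d ⊓ LinearMap.ker t = LinearMap.ker d := by
    refine Submodule.eq_of_le_of_finrank_le inf_le_left ?_
    rw [hdn]
    exact (Nat.find_min' hP ⟨e, heT, rfl⟩).trans (Submodule.finrank_mono hker)
  rw [← hle]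
  exact inf_le_right

/-- Operators which raise the eigenvalues of `f` have a common kernel. -/
theorem Module.End.exists_ne_zero_of_raising [IsAlgClosed k] [CharZero k] [Nontrivial V]
    (χ : k →ₗ[ℚ] ℚ) (f : Module.End k V) (S : Set (Module.End k V))
    (hS : ∀ s ∈ S, ∃ α, 0 < χ α ∧ f * s = s * f + α • s) : ∃ v ≠ 0, ∀ s ∈ S, s v = 0 := by
  -- An eigenvector whose eigenvalue is maximal for `χ` cannot be raised. The functional `χ` serves
  -- to compare elements of `k`, which has no order.
  obtain ⟨μ, hμ, hmax⟩ := Set.exists_max_image {μ | f.HasEigenvalue μ} χ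
    (Module.End.finite_hasEigenvalue f) (Module.End.exists_eigenvalue f)
  obtain ⟨v, hv⟩ := Module.End.HasEigenvalue.exists_hasEigenvector hμ
  refine ⟨v, hv.2, fun s hs => ?_⟩
  obtain ⟨α, hα, h⟩ := hS s hs
  by_contra h0
  have h1 : f (s v) = (μ + α) • s v := by
    have := LinearMap.congr_fun h v
    simp only [Module.End.mul_apply, LinearMap.add_apply, LinearMap.smul_apply,
      hv.apply_eq_smul, map_smul] at this
    rw [this, add_smul]
  have := hmax (μ + α)
    (Module.End.hasEigenvalue_of_hasEigenvector ⟨Module.End.mem_eigenspace_iff.2 h1, h0⟩)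
  rw [map_add] at this
  linarith

end LinearAlgebra

/-! ### Highest weight vectors and lowest weight functionals -/

namespace LieSuperModule

variable {k g A V : Type*} [Field k] [AddCommGroup g] [Module k g] [CommRing A]
  [Algebra k A] [AddCommGroup V] [Module k V] {L : LieSuperalgebra k g}
  (N : LieSuperModule (L.map A) V)

variable {N} in
theorem imageSpan_ne_top {n : ZMod 2 → Submodule k g} {ξ : Module.Dual k V} (hξ : ξ ≠ 0)
    (h : ∀ p, ∀ x ∈ n p, ∀ (a : A), (N.act (x ⊗ₜ a)).dualMap ξ = 0) : N.imageSpan n ≠ ⊤ := by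
  intro ht
  have hle : N.imageSpan n ≤ LinearMap.ker ξ := by
    rw [imageSpan_le]
    exact fun p x hx a v => LinearMap.congr_fun (h p x hx a) v
  rw [ht, top_le_iff, LinearMap.ker_eq_top] at hle
  exact hξ hle

variable {N} in
theorem invariants_ne_bot {n : ZMod 2 → Submodule k g} {v : V} (hv : v ≠ 0)
    (h : ∀ p, ∀ x ∈ n p, ∀ (a : A), N.act (x ⊗ₜ a) v = 0) : N.invariants n ≠ ⊥ := fun hb => hv (by
  have := N.mem_invariants.2 h
  rwa [hb] at this)

theorem act_tmul_one_act {d x : g} (hd : d ∈ L.part 0) {α : k} (hx : L.bracket d x = α • x) (a : A)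
    (v : V) : N.act (d ⊗ₜ 1) (N.act (x ⊗ₜ a) v) =
      N.act (x ⊗ₜ a) (N.act (d ⊗ₜ 1) v) + α • N.act (x ⊗ₜ a) v := by
  have h : ∀ z : g ⊗[k] A, N.act (d ⊗ₜ 1) (N.act z v) =
      N.act ((L.map A).bracket (d ⊗ₜ 1) z) v + N.act z (N.act (d ⊗ₜ 1) v) := by
    intro z
    rw [← (L.map A).proj_add_proj z]
    simp only [map_add, LinearMap.add_apply,
      N.act_act (L.tmul_mem_part hd (1 : A)) ((L.map A).proj_mem 0 z),
      N.act_act (L.tmul_mem_part hd (1 : A)) ((L.map A).proj_mem 1 z)]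
    simp [superSign]; abel
  rw [h, L.map_bracket_tmul, hx, one_mul, ← TensorProduct.smul_tmul', map_smul,
    LinearMap.smul_apply, add_comm]

variable [CharZero k] [Module.Finite k V] [Nontrivial V]

/-- The case of a supercommutative odd subspace. -/
theorem invariants_ne_bot_and_imageSpan_ne_top_of_odd {n : ZMod 2 → Submodule k g} (h0 : n 0 = ⊥)
    (h1 : n 1 ≤ L.part 1) (hb : ∀ x ∈ n 1, ∀ y ∈ n 1, L.bracket x y = 0) :
    N.invariants n ≠ ⊥ ∧ N.imageSpan n ≠ ⊤ := by
  have hanti : ∀ x ∈ n 1, ∀ y ∈ n 1, ∀ (a b : A) v, N.act (x ⊗ₜ a) (N.act (y ⊗ₜ b) v) =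
      -N.act (y ⊗ₜ b) (N.act (x ⊗ₜ a) v) := by
    intro x hx y hy a b v
    rw [N.act_act (L.tmul_mem_part (h1 hx) a) (L.tmul_mem_part (h1 hy) b), L.map_bracket_tmul,
      hb x hx y hy, TensorProduct.zero_tmul, map_zero, LinearMap.zero_apply, zero_add]
    simp [superSign]
  constructor
  · obtain ⟨w, -, hw0, hw⟩ := exists_ne_zero_of_anticommuting
      {f | ∃ x ∈ n 1, ∃ a : A, f = N.act (x ⊗ₜ a)} (by
        rintro _ ⟨x, hx, a, rfl⟩ _ ⟨y, hy, b, rfl⟩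
        exact LinearMap.ext fun v => hanti x hx y hy a b v) ⊤ top_ne_bot (by simp)
    refine invariants_ne_bot hw0 fun p x hx a => ?_
    rcases ZMod.two_cases p with rfl | rfl
    · rw [h0, Submodule.mem_bot] at hx; simp [hx]
    · exact hw _ ⟨x, hx, a, rfl⟩
  -- The transposed operators anticommute as well; a functional they all kill vanishes on the span
  -- of the images.
  · obtain ⟨ξ, -, hξ0, hξ⟩ := exists_ne_zero_of_anticommuting
      {f : Module.End k (Module.Dual k V) | ∃ x ∈ n 1, ∃ a : A, f = (N.act (x ⊗ₜ a)).dualMap} (by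
        rintro _ ⟨x, hx, a, rfl⟩ _ ⟨y, hy, b, rfl⟩
        ext ξ v
        have := hanti y hy x hx b a v
        simp [Module.End.mul_apply, LinearMap.dualMap_apply, this]) ⊤ top_ne_bot (by simp)
    refine imageSpan_ne_top hξ0 fun p x hx a => ?_
    rcases ZMod.two_cases p with rfl | rfl
    · rw [h0, Submodule.mem_bot] at hx
      ext v; simp [hx, LinearMap.dualMap_apply]
    · exact hξ _ ⟨x, hx, a, rfl⟩

variable [IsAlgClosed k]

/-- The case of a subspace of eigenvectors of `d` with positive eigenvalues. -/
theorem invariants_ne_bot_of_pos (χ : k →ₗ[ℚ] ℚ) {d : g} (hd : d ∈ L.part 0)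
    {n : ZMod 2 → Submodule k g}
    (hn : ∀ p, n p ≤ ⨆ α : {α : k // 0 < χ α}, Module.End.eigenspace (L.bracket d) (α : k)) :
    N.invariants n ≠ ⊥ := by
  obtain ⟨v, hv, h⟩ := Module.End.exists_ne_zero_of_raising χ (N.act (d ⊗ₜ 1))
    {f | ∃ α, 0 < χ α ∧ ∃ x, L.bracket d x = α • x ∧ ∃ a : A, f = N.act (x ⊗ₜ a)} (by
      rintro _ ⟨α, hα, x, hx, a, rfl⟩
      exact ⟨α, hα, LinearMap.ext fun v => N.act_tmul_one_act hd hx a v⟩)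
  refine invariants_ne_bot hv fun p x hx a => ?_
  have hle : (⨆ α : {α : k // 0 < χ α}, Module.End.eigenspace (L.bracket d) (α : k)) ≤
      LinearMap.ker (N.act.flip v ∘ₗ (TensorProduct.mk k g A).flip a) :=
    iSup_le fun α x hx => h _ ⟨α, α.2, x, Module.End.mem_eigenspace_iff.1 hx, a, rfl⟩
  exact hle (hn p hx)

/-- The case of a subspace of eigenvectors of `d` with negative eigenvalues. -/
theorem imageSpan_ne_top_of_neg (χ : k →ₗ[ℚ] ℚ) {d : g} (hd : d ∈ L.part 0)
    {n : ZMod 2 → Submodule k g}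
    (hn : ∀ p, n p ≤ ⨆ α : {α : k // χ α < 0}, Module.End.eigenspace (L.bracket d) (α : k)) :
    N.imageSpan n ≠ ⊤ := by
  obtain ⟨ξ, hξ, h⟩ := Module.End.exists_ne_zero_of_raising χ (N.act (d ⊗ₜ 1)).dualMap
    {f | ∃ α, χ α < 0 ∧ ∃ x, L.bracket d x = α • x ∧ ∃ a : A, f = (N.act (x ⊗ₜ a)).dualMap} (by
      rintro _ ⟨α, hα, x, hx, a, rfl⟩
      -- Transposition reverses products, so the transpose of an operator lowering eigenvalues
      -- raises them.
      refine ⟨-α, by simpa using hα, ?_⟩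
      ext ξ v
      have := congrArg ξ (N.act_tmul_one_act hd hx a v)
      simp only [map_add, map_smul] at this
      simp [Module.End.mul_apply, LinearMap.dualMap_apply, this])
  refine imageSpan_ne_top hξ fun p x hx a => LinearMap.ext fun v => ?_
  have hle : (⨆ α : {α : k // χ α < 0}, Module.End.eigenspace (L.bracket d) (α : k)) ≤
      LinearMap.ker (ξ ∘ₗ N.act.flip v ∘ₗ (TensorProduct.mk k g A).flip a) :=
    iSup_le fun α x hx => LinearMap.congr_fun
      (h _ ⟨α, α.2, x, Module.End.mem_eigenspace_iff.1 hx, a, rfl⟩) v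
  exact hle (hn p hx)

end LieSuperModule

/-! ### Regular elements of classical Lie superalgebras -/

namespace LieSuperalgebra

section Bracket

variable {k g : Type*} [Field k] [AddCommGroup g] [Module k g] (L : LieSuperalgebra k g)

theorem bracket_even_bracket {x : g} (hx : x ∈ L.part 0) (y z : g) :
    L.bracket x (L.bracket y z) = L.bracket (L.bracket x y) z + L.bracket y (L.bracket x z) := by
  rw [← L.proj_add_proj y]
  simp only [map_add, LinearMap.add_apply, L.jacobi 0 0 x hx _ (L.proj_mem 0 y),
    L.jacobi 0 1 x hx _ (L.proj_mem 1 y)]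
  simp [superSign]; abel

theorem bracket_even_skew {x : g} (hx : x ∈ L.part 0) (y : g) :
    L.bracket x y = -L.bracket y x := by
  rw [← L.proj_add_proj y]
  simp only [map_add, LinearMap.add_apply, L.bracket_skew 0 0 x hx _ (L.proj_mem 0 y),
    L.bracket_skew 0 1 x hx _ (L.proj_mem 1 y)]
  simp [superSign]; abel

end Bracket

variable {k g : Type*} [Field k] [AddCommGroup g] [Module k g]

section OddModule

variable [CharZero k] (L : LieSuperalgebra k g)

/-- The odd part of a Lie superalgebra is a module over its even part. -/
instance oddLieRingModule : LieRingModule (L.part 0) (L.part 1) where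
  bracket x u := ⟨L.bracket x u, by simpa using L.bracket_mem 0 1 x x.2 u u.2⟩
  add_lie x y u := by ext; simp
  lie_add x u v := by ext; simp
  leibniz_lie x y u := by
    ext
    have h := L.jacobi 0 0 x x.2 y y.2 u
    rw [show superSign k 0 0 = 1 by simp [superSign], one_smul] at h
    exact h

theorem coe_lie_odd (x : L.part 0) (u : L.part 1) : (⁅x, u⁆ : L.part 1) = L.bracket x u := rfl

instance oddLieModule : LieModule k (L.part 0) (L.part 1) where
  smul_lie t x u := by ext; simp [coe_lie_odd]
  lie_smul t x u := by ext; simp [coe_lie_odd]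

end OddModule

variable {L : LieSuperalgebra k g}

/-- The even part of a simple Lie superalgebra acts faithfully on the odd part, if that is not
zero. -/
theorem IsSimple.eq_zero_of_bracket_odd (hL : L.IsSimple) (h1 : L.part 1 ≠ ⊥) {x : g}
    (hx : x ∈ L.part 0) (h : ∀ u ∈ L.part 1, L.bracket x u = 0) : x = 0 := by
  -- The even elements killing the odd part form a graded ideal. By simplicity it is zero, since
  -- otherwise the whole algebra would be even.
  let I : Submodule k g := L.part 0 ⊓ ⨅ u : L.part 1, LinearMap.ker (L.bracket.flip u)
  have hI : ∀ y, y ∈ I ↔ y ∈ L.part 0 ∧ ∀ u ∈ L.part 1, L.bracket y u = 0 := by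
    intro y; simp [I, Submodule.mem_iInf]
  have hle : I ≤ L.part 0 := inf_le_left
  have hst : ∀ y, ∀ z ∈ I, L.bracket y z ∈ I := by
    intro y z hz
    rw [hI] at hz
    have h1 : ∀ y ∈ L.part 1, L.bracket y z = 0 := fun y hy => by
      rw [← neg_eq_zero, ← L.bracket_even_skew hz.1, hz.2 y hy]
    rw [← L.proj_add_proj y, map_add, LinearMap.add_apply, h1 _ (L.proj_mem 1 y), add_zero, hI]
    have hy := L.proj_mem 0 y
    refine ⟨by simpa using L.bracket_mem 0 0 _ hy z hz.1, fun u hu => ?_⟩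
    have := L.bracket_even_bracket hy z u
    rw [hz.2 u hu, map_zero, hz.2 _ (by simpa using L.bracket_mem 0 1 _ hy u hu), add_zero] at this
    exact this.symm
  rcases hL.2 I (L.isGraded_of_le_part hle) hst with h0 | h0
  · have : x ∈ I := (hI x).2 ⟨hx, h⟩
    rwa [h0] at this
  · exfalso
    apply h1
    rw [h0, top_le_iff] at hle
    simpa only [hle, top_inf_eq] using L.isCompl_part.inf_eq_bot

variable [CharZero k]

theorem IsClassical.complementedLattice (hL : L.IsClassical) :
    ComplementedLattice (LieSubmodule k (L.part 0) (L.part 1)) where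
  exists_isCompl W := by
    obtain ⟨W', hle, hst, hinf, hsup⟩ := hL.2 (W.toSubmodule.map (L.part 1).subtype)
      (Submodule.map_subtype_le _ _) (by
        rintro x hx _ ⟨w, hw, rfl⟩
        exact ⟨⁅(⟨x, hx⟩ : L.part 0), w⁆, W.lie_mem hw, rfl⟩)
    let W₂ : LieSubmodule k (L.part 0) (L.part 1) :=
      { toSubmodule := W'.comap (L.part 1).subtype
        lie_mem := fun {x w} hw => hst x x.2 w hw }
    refine ⟨W₂, ?_, ?_⟩
    · rw [disjoint_iff, eq_bot_iff]
      rintro w ⟨hw, hw'⟩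
      have : (w : g) ∈ W.toSubmodule.map (L.part 1).subtype ⊓ W' := ⟨⟨w, hw, rfl⟩, hw'⟩
      rw [hinf, Submodule.mem_bot] at this
      simpa using this
    · rw [codisjoint_iff, eq_top_iff]
      rintro u -
      have hu : (u : g) ∈ W.toSubmodule.map (L.part 1).subtype ⊔ W' := by rw [hsup]; exact u.2
      obtain ⟨_, ⟨w, hw, rfl⟩, w', hw', h⟩ := Submodule.mem_sup.1 hu
      rw [LieSubmodule.mem_sup]
      exact ⟨w, hw, ⟨w', hle hw'⟩, hw', Subtype.ext h⟩

variable [IsAlgClosed k] [Module.Finite k g]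

/-- The odd part is a faithful completely reducible module over the even part. This makes the
radical of the even part central and disjoint from the derived algebra, so that
`LieAlgebra.exists_torus` applies; complete reducibility also carries diagonalizability of the torus
over to the odd part. -/
theorem IsClassical.exists_torus (hL : L.IsClassical) (h1 : L.part 1 ≠ ⊥) :
    ∃ T : Submodule k g, T ≤ L.part 0 ∧ (∀ s ∈ T, ∀ t ∈ T, L.bracket s t = 0) ∧
      (∀ t ∈ T, ⨆ μ, Module.End.eigenspace (L.bracket t) μ = ⊤) ∧
      ∀ y ∈ L.part 0, (∀ t ∈ T, L.bracket t y = 0) → y ∈ T := by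
  have := hL.complementedLattice
  have hf : ∀ x : L.part 0, (∀ u : L.part 1, ⁅x, u⁆ = 0) → x = 0 := fun x hx => by
    ext
    exact hL.1.eq_zero_of_bracket_odd h1 x.2 fun u hu => congrArg Subtype.val (hx ⟨u, hu⟩)
  obtain ⟨T, hT, hdiag, hcent⟩ := LieAlgebra.exists_torus (LieAlgebra.radical k (L.part 0)) rfl
    (fun x hx y => LieModule.lie_eq_zero_of_mem_radical hf hx y)
    (fun x hx hx' => LieModule.eq_zero_of_mem_radical_of_mem_lcs hf hx hx')
  refine ⟨T.map (L.part 0).subtype, Submodule.map_subtype_le _ _, ?_, ?_, ?_⟩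
  · rintro _ ⟨s, hs, rfl⟩ _ ⟨t, ht, rfl⟩
    exact congrArg Subtype.val (hT s hs t ht)
  · rintro _ ⟨t, ht, rfl⟩
    refine L.eq_top_of_part_le fun p => ?_
    rcases ZMod.two_cases p with rfl | rfl
    · refine (L.part 0).map_subtype_top.ge.trans ?_
      rw [← hdiag t ht, Submodule.map_iSup]
      refine iSup_mono fun μ => ?_
      rintro _ ⟨x, hx, rfl⟩
      rw [SetLike.mem_coe, Module.End.mem_eigenspace_iff] at hx
      exact Module.End.mem_eigenspace_iff.2 (congrArg Subtype.val hx)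
    · refine (L.part 1).map_subtype_top.ge.trans ?_
      rw [← LieModule.iSup_eigenspace_toEnd_eq_top (U := L.part 1) t (hdiag t ht), Submodule.map_iSup]
      refine iSup_mono fun μ => ?_
      rintro _ ⟨x, hx, rfl⟩
      rw [SetLike.mem_coe, Module.End.mem_eigenspace_iff] at hx
      exact Module.End.mem_eigenspace_iff.2 (congrArg Subtype.val hx)
  · intro y hy h
    exact ⟨⟨y, hy⟩, hcent _ fun t ht => Subtype.ext (h t ⟨t, ht, rfl⟩), rfl⟩

/-- A classical Lie superalgebra with nonzero odd part has an even diagonalizable element whose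
centralizer is the centralizer of a maximal torus. -/
theorem IsClassical.exists_regular (hL : L.IsClassical) (h1 : L.part 1 ≠ ⊥) :
    ∃ d ∈ L.part 0, ⨆ μ, Module.End.eigenspace (L.bracket d) μ = ⊤ ∧
      ∀ x ∈ L.part 0, L.bracket d x = 0 → ∀ y, L.bracket d y = 0 → L.bracket x y = 0 := by
  obtain ⟨T, hT0, hT, hdiag, hcent⟩ := hL.exists_torus h1
  -- Choose `d` in the torus whose centralizer is that of the whole torus. An even element commuting
  -- with `d` then lies in the torus, and so kills everything that `d` kills.
  obtain ⟨_, ⟨d, hd, rfl⟩, hmin⟩ := Module.End.exists_forall_ker_le (T.map L.bracket) (by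
    rintro _ ⟨s, hs, rfl⟩ _ ⟨t, ht, rfl⟩
    refine LinearMap.ext fun y => ?_
    have := L.bracket_even_bracket (hT0 hs) t y
    rw [hT s hs t ht, map_zero, LinearMap.zero_apply, zero_add] at this
    exact this) (by
    rintro _ ⟨t, ht, rfl⟩
    exact hdiag t ht)
  have hmin' : ∀ t ∈ T, ∀ y, L.bracket d y = 0 → L.bracket t y = 0 := fun t ht y hy =>
    hmin _ ⟨t, ht, rfl⟩ hy
  exact ⟨d, hT0 hd, hdiag d hd, fun x hx hdx y hdy =>
    hmin' x (hcent x hx fun t ht => hmin' t ht x hdx) y hdy⟩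

end LieSuperalgebra

/-! ### Irreducibility without the grading, for the three classes -/

namespace LieSuperModule

variable {k g A V : Type*} [Field k] [AddCommGroup g] [Module k g] [CommRing A]
  [Algebra k A] [AddCommGroup V] [Module k V] {L : LieSuperalgebra k g}
  {N : LieSuperModule (L.map A) V}

/-- Without odd operators each homogeneous part is a submodule. An irreducible module is thus
concentrated in one parity, where every subspace is graded. -/
theorem IsIrreducible.eq_bot_or_eq_top_of_part_one (hN : N.IsIrreducible) (h1 : L.part 1 = ⊥)
    {X : Submodule k V} (hX : ∀ z, ∀ u ∈ X, N.act z u ∈ X) : X = ⊥ ∨ X = ⊤ := by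
  have hst : ∀ z, ∀ u ∈ N.part 0, N.act z u ∈ N.part 0 := by
    refine N.act_mem_of_tmul fun p x hx a u hu => ?_
    rcases ZMod.two_cases p with rfl | rfl
    · simpa using N.act_mem 0 0 _ (L.tmul_mem_part hx a) u hu
    · rw [h1, Submodule.mem_bot] at hx
      simp [hx]
  have hpure : ∃ p, N.part p = ⊤ := by
    rcases hN.2 _ (N.isGraded_part 0) hst with h | h
    · exact ⟨1, by simpa [h] using N.isCompl_part.sup_eq_top⟩
    · exact ⟨0, h⟩
  obtain ⟨p, hp⟩ := hpure
  exact hN.2 X (N.isGraded_of_le_part (p := p) (by rw [hp]; exact le_top)) hX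

variable [CharZero k] [IsAlgClosed k] [Module.Finite k g] [Module.Finite k V]

/-- The triangular decomposition sorts the eigenvalues of a regular element `d` by the sign of `χ`.
Its middle part is the centralizer of `d`, with even part `Z 0` and odd part `Z 1`. By regularity `Z
0` commutes with `Z 1`, so invariance of the form gives `B [x, y] t = B x [y, t] = 0` for `x, y` in
`Z 1` and `t` in `Z 0`; as `B` is nondegenerate on `Z 0`, this forces `[Z 1, Z 1] = 0`. -/
theorem IsIrreducible.eq_bot_or_eq_top_of_isBasicClassical (hN : N.IsIrreducible)
    (hL : L.IsBasicClassical) {X : Submodule k V} (hX : ∀ z, ∀ u ∈ X, N.act z u ∈ X) :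
    X = ⊥ ∨ X = ⊤ := by
  by_cases h1 : L.part 1 = ⊥
  · exact hN.eq_bot_or_eq_top_of_part_one h1 hX
  obtain ⟨hcl, B, hBnd, hBeven, hBinv⟩ := hL
  obtain ⟨d, hd, hdiag, hreg⟩ := hcl.exists_regular h1
  have := hN.1
  -- Finitely many nonzero vectors of a `ℚ`-vector space are all nonzero under some linear
  -- functional.
  obtain ⟨χ, hχ⟩ : ∃ χ : k →ₗ[ℚ] ℚ,
      ∀ α, Module.End.HasEigenvalue (L.bracket d) α → α ≠ 0 → χ α ≠ 0 := by
    have hfin : Finite {α : k // Module.End.HasEigenvalue (L.bracket d) α ∧ α ≠ 0} :=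
      ((Module.End.finite_hasEigenvalue (L.bracket d)).subset fun α h => h.1).to_subtype
    obtain ⟨χ, hχ⟩ := Module.exists_dual_forall_apply_ne_zero (K := ℚ)
      (fun α : {α : k // Module.End.HasEigenvalue (L.bracket d) α ∧ α ≠ 0} => (α : k))
      fun α => α.2.2
    exact ⟨χ, fun α h h0 => hχ ⟨α, h, h0⟩⟩
  have hadd : ∀ p, ∀ x ∈ L.part p, L.bracket d x ∈ L.part p := fun p x hx => by
    simpa using L.bracket_mem 0 p d hd x hx
  have hdecomp : ∀ p, L.part p = ⨆ α, L.part p ⊓ Module.End.eigenspace (L.bracket d) α := by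
    intro p
    rw [← Module.End.inf_iSup_eigenspace (hadd p), hdiag, inf_top_eq]
  let E : (k → Prop) → ZMod 2 → Submodule k g := fun P p =>
    ⨆ α : {α : k // P α}, L.part p ⊓ Module.End.eigenspace (L.bracket d) (α : k)
  let Z : ZMod 2 → Submodule k g := fun p => L.part p ⊓ LinearMap.ker (L.bracket d)
  have hEle : ∀ P p, E P p ≤ L.part p := fun P p => iSup_le fun α => inf_le_left
  have hspan : ∀ p, L.part p ≤ E (χ · < 0) p ⊔ Z p ⊔ E (0 < χ ·) p := by
    intro p
    conv_lhs => rw [hdecomp p]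
    refine iSup_le fun α => ?_
    rintro x ⟨hx, hxα⟩
    rw [SetLike.mem_coe] at hxα
    by_cases hx0 : x = 0
    · subst hx0; exact Submodule.zero_mem _
    by_cases hα : α = 0
    · subst hα
      rw [Module.End.mem_eigenspace_iff, zero_smul] at hxα
      exact Submodule.mem_sup_left (Submodule.mem_sup_right ⟨hx, hxα⟩)
    have hne := hχ α (Module.End.hasEigenvalue_of_hasEigenvector ⟨hxα, hx0⟩) hα
    rcases lt_or_gt_of_ne hne with h | h
    · exact Submodule.mem_sup_left (Submodule.mem_sup_left
        (Submodule.mem_iSup_of_mem (⟨α, h⟩ : {α : k // χ α < 0}) ⟨hx, hxα⟩))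
    · exact Submodule.mem_sup_right
        (Submodule.mem_iSup_of_mem (⟨α, h⟩ : {α : k // 0 < χ α}) ⟨hx, hxα⟩)
  have hEZ : ∀ P p q, ∀ x ∈ E P p, ∀ t ∈ Z q, L.bracket x t ∈ E P (p + q) := by
    intro P p q x hx t ht
    have hle : E P p ≤ (E P (p + q)).comap (L.bracket.flip t) := by
      refine iSup_le fun α => ?_
      rintro x ⟨hx, hxα⟩
      refine Submodule.mem_iSup_of_mem α ⟨L.bracket_mem p q x hx t ht.1, ?_⟩
      rw [SetLike.mem_coe, Module.End.mem_eigenspace_iff] at hxα ⊢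
      have ht2 : L.bracket d t = 0 := ht.2
      rw [LinearMap.flip_apply, L.bracket_even_bracket hd, hxα, ht2]
      simp
    exact hle hx
  have hZZ : ∀ p q, ∀ x ∈ Z p, ∀ t ∈ Z q, L.bracket x t ∈ Z (p + q) := by
    intro p q x hx t ht
    refine ⟨L.bracket_mem p q x hx.1 t ht.1, ?_⟩
    have hx2 : L.bracket d x = 0 := hx.2
    have ht2 : L.bracket d t = 0 := ht.2
    rw [SetLike.mem_coe, LinearMap.mem_ker, L.bracket_even_bracket hd, hx2, ht2]
    simp
  have hZnd : ∀ y ∈ Z 0, (∀ t ∈ Z 0, B y t = 0) → y = 0 := by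
    rintro y ⟨hy, hdy⟩ h
    apply hBnd.1
    have hker : LinearMap.ker (B y) = ⊤ := by
      refine L.eq_top_of_part_le fun p => ?_
      rcases ZMod.two_cases p with rfl | rfl
      · rw [hdecomp 0, iSup_le_iff]
        rintro α x ⟨hx, hxα⟩
        rw [SetLike.mem_coe, Module.End.mem_eigenspace_iff] at hxα
        by_cases hα : α = 0
        · subst hα
          exact h x ⟨hx, by simpa using hxα⟩
        -- `α B y x = B y [d, x] = B [y, d] x = 0`: the centralizer of `d` is orthogonal to the
        -- eigenvectors with nonzero eigenvalue.
        · have h2 := hBinv y d x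
          have h3 : L.bracket y d = 0 := by
            rw [L.bracket_even_skew hy, neg_eq_zero]; exact hdy
          rw [hxα, h3, map_zero, LinearMap.zero_apply, map_smul, smul_eq_mul, eq_comm,
            mul_eq_zero] at h2
          exact h2.resolve_left hα
      · exact fun x hx => hBeven 0 1 (by decide) y hy x hx
    exact fun x => LinearMap.mem_ker.1 (by rw [hker]; trivial)
  have e : (1 + 1 : ZMod 2) = 0 := by decide
  refine hN.eq_bot_or_eq_top_of_triangular (np := E (0 < χ ·)) (nm := E (χ · < 0)) (r := Z 0)
    (m := Z 1) (hEle _) (hEle _) inf_le_left inf_le_left (hspan 0) (hspan 1)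
    (fun p x hx t ht => by simpa using hEZ _ p 0 x hx t ht)
    (fun p x hx t ht => hEZ _ p 1 x hx t ht) (fun x hx t ht => by simpa using hZZ 1 0 x hx t ht)
    (fun x hx y hy => ?_)
    (N.invariants_ne_bot_of_pos χ hd fun p => iSup_mono fun α => inf_le_right)
    (N.imageSpan_ne_top_of_neg χ hd fun p => iSup_mono fun α => inf_le_right) hX
  refine hZnd _ (by rw [← e]; exact hZZ 1 1 x hx y hy) fun t ht => ?_
  rw [hBinv, ← neg_neg (L.bracket y t), ← L.bracket_even_skew ht.1 y,
    hreg t ht.1 ht.2 y hy.2, neg_zero, map_zero]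

omit [IsAlgClosed k] [Module.Finite k g] in
open Matrix in
-- The block decomposition is triangular: the strictly upper and strictly lower block matrices are
-- odd and supercommutative, the block diagonal ones are the even part, and `m = 0`. Highest and
-- lowest weight vectors come from anticommuting operators, without any torus.
theorem IsIrreducible.eq_bot_or_eq_top_of_slSuper (hN : N.IsIrreducible) {n : ℕ}
    (hL : L.IsIsomorphic (slSuper k n)) {X : Submodule k V} (hX : ∀ z, ∀ u ∈ X, N.act z u ∈ X) :
    X = ⊥ ∨ X = ⊤ := by
  obtain ⟨f, hf⟩ := hL
  have := hN.1
  let F : g →ₗ[k] SuperMat k n := (LinearMap.ker (SuperMat.str k n)).subtype ∘ₗ f.toLinearMap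
  have hFinj : ∀ x, F x = 0 → x = 0 := fun x hx =>
    hf.1 (by rw [map_zero]; exact Subtype.ext hx)
  have hFpart : ∀ p, ∀ x ∈ L.part p, F x ∈ SuperMat.part k n p := fun p x hx => f.map_mem p x hx
  have hFb : ∀ p q, ∀ x ∈ L.part p, ∀ y ∈ L.part q,
      F (L.bracket x y) = F x * F y - superSign k p q • (F y * F x) := fun p q x hx y hy => by
    have h := congrArg Subtype.val (f.map_bracket x y)
    exact h.trans (SuperMat.comm_of_mem (hFpart p x hx) (hFpart q y hy))
  let b12 : SuperMat k n →ₗ[k] Matrix (Fin n) (Fin n) k :=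
    { toFun := toBlocks₁₂, map_add' := fun _ _ => rfl, map_smul' := fun _ _ => rfl }
  let b21 : SuperMat k n →ₗ[k] Matrix (Fin n) (Fin n) k :=
    { toFun := toBlocks₂₁, map_add' := fun _ _ => rfl, map_smul' := fun _ _ => rfl }
  let up : Submodule k g := L.part 1 ⊓ LinearMap.ker (b21 ∘ₗ F)
  let low : Submodule k g := L.part 1 ⊓ LinearMap.ker (b12 ∘ₗ F)
  have hup : ∀ x ∈ up, F x = fromBlocks 0 (F x).toBlocks₁₂ 0 0 := by
    rintro x ⟨hx, hx'⟩
    have h21 : (F x).toBlocks₂₁ = 0 := hx'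
    have := SuperMat.mem_part_one' (hFpart 1 x hx)
    rwa [h21] at this
  have hlow : ∀ x ∈ low, F x = fromBlocks 0 0 (F x).toBlocks₂₁ 0 := by
    rintro x ⟨hx, hx'⟩
    have h12 : (F x).toBlocks₁₂ = 0 := hx'
    have := SuperMat.mem_part_one' (hFpart 1 x hx)
    rwa [h12] at this
  have hupup : ∀ x ∈ up, ∀ y ∈ up, L.bracket x y = 0 := fun x hx y hy => hFinj _ (by
    rw [hFb 1 1 x hx.1 y hy.1, hup x hx, hup y hy]
    simp [fromBlocks_multiply])
  have hlowlow : ∀ x ∈ low, ∀ y ∈ low, L.bracket x y = 0 := fun x hx y hy => hFinj _ (by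
    rw [hFb 1 1 x hx.1 y hy.1, hlow x hx, hlow y hy]
    simp [fromBlocks_multiply])
  have hupr : ∀ x ∈ up, ∀ t ∈ L.part 0, L.bracket x t ∈ up := by
    refine fun x hx t ht => ⟨by simpa using L.bracket_mem 1 0 x hx.1 t ht, ?_⟩
    change (F (L.bracket x t)).toBlocks₂₁ = 0
    rw [hFb 1 0 x hx.1 t ht, hup x hx, SuperMat.mem_part_zero' (hFpart 0 t ht)]
    simp [fromBlocks_multiply, superSign, sub_eq_add_neg, fromBlocks_neg, fromBlocks_add]
  have hspan : L.part 1 ≤ low ⊔ up := by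
    intro x hx
    -- `y` corresponds to the upper right block of `x`, a matrix of supertrace zero; it is odd
    -- because `F` is injective and respects parity.
    obtain ⟨y, hy⟩ := hf.2 ⟨fromBlocks 0 (F x).toBlocks₁₂ 0 0, by simp⟩
    have hFy : F y = fromBlocks 0 (F x).toBlocks₁₂ 0 0 := congrArg Subtype.val hy
    have hy1 : y ∈ L.part 1 := by
      have h0 : F (L.proj 0 y) = 0 := by
        have h1 := SuperMat.mem_part_one.1 (hFpart 1 _ (L.proj_mem 1 y))
        have h2 := SuperMat.mem_part_zero.1 (hFpart 0 _ (L.proj_mem 0 y))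
        have h3 : SuperMat.diag k n (F y) = 0 := by rw [hFy]; simp
        rw [← L.proj_add_proj y, map_add, map_add, h1, h2, add_zero] at h3
        exact h3
      rw [← L.proj_add_proj y, hFinj _ h0, zero_add]
      exact L.proj_mem 1 y
    rw [← sub_add_cancel x y]
    refine Submodule.add_mem_sup ⟨Submodule.sub_mem _ hx hy1, ?_⟩ ⟨hy1, ?_⟩
    · have h2 : b12 (F y) = (F x).toBlocks₁₂ := by
        rw [hFy]; exact toBlocks_fromBlocks₁₂ _ _ _ _
      change b12 (F (x - y)) = 0
      rw [map_sub, map_sub, h2]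
      exact sub_self _
    · change b21 (F y) = 0
      rw [hFy]
      exact toBlocks_fromBlocks₂₁ _ _ _ _
  let np : ZMod 2 → Submodule k g := fun p => if p = 0 then ⊥ else up
  let nm : ZMod 2 → Submodule k g := fun p => if p = 0 then ⊥ else low
  have hnp : ∀ p, np p ≤ L.part p := fun p => by
    rcases ZMod.two_cases p with rfl | rfl
    · exact bot_le
    · exact inf_le_left
  have hnm : ∀ p, nm p ≤ L.part p := fun p => by
    rcases ZMod.two_cases p with rfl | rfl
    · exact bot_le
    · exact inf_le_left
  refine hN.eq_bot_or_eq_top_of_triangular (np := np) (nm := nm) (r := L.part 0) (m := ⊥) hnp hnm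
    le_rfl bot_le (le_sup_of_le_left le_sup_right) (by rw [sup_bot_eq]; exact hspan) ?_ ?_ ?_ ?_
    (N.invariants_ne_bot_and_imageSpan_ne_top_of_odd rfl (hnp 1) hupup).1
    (N.invariants_ne_bot_and_imageSpan_ne_top_of_odd rfl (hnm 1) hlowlow).2 hX
  · intro p x hx t ht
    rcases ZMod.two_cases p with rfl | rfl
    · have : x = 0 := hx
      rw [this]; simp
    · exact hupr x hx t ht
  · rintro p x - y rfl; simp
  · rintro x rfl t -; simp
  · rintro x rfl t -; simp

/-- Irreducible modules over the map superalgebras considered here remain irreducible after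
forgetting the grading. -/
theorem IsIrreducible.eq_bot_or_eq_top (hN : N.IsIrreducible)
    (hL : L.IsReductive ∨ L.IsBasicClassical ∨ ∃ n : ℕ, 1 ≤ n ∧ L.IsIsomorphic (slSuper k n))
    {X : Submodule k V} (hX : ∀ z, ∀ u ∈ X, N.act z u ∈ X) : X = ⊥ ∨ X = ⊤ := by
  rcases hL with h | h | ⟨n, -, h⟩
  · exact hN.eq_bot_or_eq_top_of_part_one h.1 hX
  · exact hN.eq_bot_or_eq_top_of_isBasicClassical h hX
  · exact hN.eq_bot_or_eq_top_of_slSuper h hX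

end LieSuperModule

/-- **Burnside's theorem**: an irreducible algebra of operators on a finite dimensional space over
an algebraically closed field contains all operators. -/
theorem Subalgebra.eq_top_of_irreducible {k V : Type*} [Field k] [IsAlgClosed k] [AddCommGroup V]
    [Module k V] [Module.Finite k V] [Nontrivial V] (R : Subalgebra k (Module.End k V))
    (hR : ∀ X : Submodule k V, (∀ r ∈ R, ∀ x ∈ X, r x ∈ X) → X = ⊥ ∨ X = ⊤) : R = ⊤ := by
  have hsub : ∀ X : Submodule R V, X = ⊥ ∨ X = ⊤ := by
    intro X
    rcases hR (X.restrictScalars k) (fun r hr x hx => X.smul_mem ⟨r, hr⟩ hx) with h | h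
    · left
      rw [eq_bot_iff]
      intro x hx
      have : x ∈ X.restrictScalars k := hx
      rwa [h] at this
    · right
      rw [eq_top_iff]
      intro x _
      have : x ∈ X.restrictScalars k := by rw [h]; trivial
      exact this
  have : IsSimpleModule R V := by
    rw [isSimpleModule_iff]
    exact { exists_pair_ne := ⟨⊥, ⊤, bot_ne_top⟩, eq_bot_or_eq_top := hsub }
  -- Schur's lemma. Since the endomorphisms over `R` are scalars, every linear `T` commutes with
  -- them, and the density theorem, applied to a basis, produces `T` within `R`.
  have hscalar : ∀ f : Module.End R V, ∃ c : k, ∀ v, f v = c • v := by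
    intro f
    obtain ⟨c, hc⟩ := Module.End.exists_eigenvalue (K := k)
      ((f : V →ₗ[R] V).restrictScalars k : Module.End k V)
    obtain ⟨v, hv⟩ := hc.exists_hasEigenvector
    let X : Submodule R V :=
      { carrier := {v | f v = c • v}
        add_mem' := fun {a b} ha hb => by
          simp only [Set.mem_ofPred_eq] at ha hb ⊢
          rw [map_add, ha, hb, smul_add]
        zero_mem' := by simp
        smul_mem' := fun r a ha => by
          simp only [Set.mem_ofPred_eq] at ha ⊢
          rw [map_smul, ha, smul_comm] }
    rcases hsub X with h | h
    · have : v ∈ X := hv.apply_eq_smul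
      rw [h] at this
      exact absurd this hv.2
    · refine ⟨c, fun v => ?_⟩
      have : v ∈ X := by rw [h]; trivial
      exact this
  rw [eq_top_iff]
  rintro T -
  let T' : Module.End (Module.End R V) V :=
    { toFun := T
      map_add' := T.map_add
      map_smul' := fun f v => by
        obtain ⟨c, hc⟩ := hscalar f
        simp only [Module.End.smul_def, RingHom.id_apply, hc, map_smul] }
  classical
  let b := Module.finBasis k V
  obtain ⟨r, hr⟩ := jacobson_density T' (Finset.univ.image b)
  have : T = r := b.ext fun i => hr (b i) (Finset.mem_image_of_mem _ (Finset.mem_univ i))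
  rw [this]
  exact r.2

/-! ### Submodules, parity shifts and change of coefficients -/

namespace SuperSpace

variable {k V : Type*} [Field k] [AddCommGroup V] [Module k V]

/-- The grading induced on a graded subspace. -/
def restrict (S : SuperSpace k V) (U : Submodule k V) (hU : S.IsGraded U) : SuperSpace k U where
  part p := (S.part p).comap U.subtype
  isCompl_part := by
    constructor
    · rw [Submodule.disjoint_def]
      intro u h0 h1
      exact Subtype.ext (Submodule.disjoint_def.1 S.isCompl_part.disjoint _ h0 h1)
    · rw [codisjoint_iff, eq_top_iff]
      rintro u -
      exact Submodule.mem_sup.2 ⟨⟨_, hU u u.2 0⟩, S.proj_mem 0 _, ⟨_, hU u u.2 1⟩, S.proj_mem 1 _,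
        Subtype.ext (S.proj_add_proj u)⟩

theorem coe_restrict_parityOp (S : SuperSpace k V) (U : Submodule k V) (hU : S.IsGraded U) (u : U) :
    ((S.restrict U hU).parityOp u : V) = S.parityOp u :=
  LinearMap.congr_fun (f := U.subtype ∘ₗ (S.restrict U hU).parityOp)
    (g := S.parityOp ∘ₗ U.subtype) ((S.restrict U hU).hom_ext fun p v hv => by
      have hv' : (v : V) ∈ S.part p := hv
      simp [(S.restrict U hU).parityOp_of_mem hv, S.parityOp_of_mem hv']) u

/-- The same space with the parities shifted by `s`. -/
def shift (S : SuperSpace k V) (s : ZMod 2) : SuperSpace k V where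
  part p := S.part (p + s)
  isCompl_part := by
    rw [zero_add, add_comm]; exact S.isCompl' s

theorem shift_parityOp (S : SuperSpace k V) (s : ZMod 2) :
    (S.shift s).parityOp = superSign k 1 s • S.parityOp := by
  refine (S.shift s).hom_ext fun p v hv => ?_
  have hv' : v ∈ S.part (p + s) := hv
  have e : (1 + 1 : ZMod 2) = 0 := by decide
  rw [(S.shift s).parityOp_of_mem hv, LinearMap.smul_apply, S.parityOp_of_mem hv', smul_smul]
  congr 1
  rcases ZMod.two_cases p with rfl | rfl <;> rcases ZMod.two_cases s with rfl | rfl <;>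
    simp [superSign, e]

end SuperSpace

namespace LieSuperModule

section General

variable {k g V : Type*} [Field k] [AddCommGroup g] [Module k g]
  [AddCommGroup V] [Module k V] {L : LieSuperalgebra k g} (N : LieSuperModule L V)

/-- The restriction of a module to a graded submodule. -/
def restrict (U : Submodule k V) (hU : N.IsGraded U) (hact : ∀ x, ∀ u ∈ U, N.act x u ∈ U) :
    LieSuperModule L U where
  toSuperSpace := N.toSuperSpace.restrict U hU
  act := LinearMap.mk₂ k (fun x u => ⟨N.act x u, hact x u u.2⟩)
    (fun x y u => by ext; simp) (fun c x u => by ext; simp) (fun x u v => by ext; simp)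
    (fun c x u => by ext; simp)
  act_mem p q x hx u hu := N.act_mem p q x hx u hu
  act_bracket p q x hx y hy u := Subtype.ext (N.act_bracket p q x hx y hy u)

/-- The module with parities shifted by `s` (and the same action). -/
def shift (s : ZMod 2) : LieSuperModule L V where
  toSuperSpace := N.toSuperSpace.shift s
  act := N.act
  act_mem p q x hx u hu := by
    have := N.act_mem p (q + s) x hx u hu
    rwa [← add_assoc] at this
  act_bracket := N.act_bracket

theorem exists_irreducible_submodule [Module.Finite k V] [Nontrivial V] :
    ∃ (U : Submodule k V) (hU : N.IsGraded U) (hact : ∀ x, ∀ u ∈ U, N.act x u ∈ U),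
      (N.restrict U hU hact).IsIrreducible := by
  let C : Set (Submodule k V) := {U | U ≠ ⊥ ∧ N.IsGraded U ∧ ∀ x, ∀ u ∈ U, N.act x u ∈ U}
  have hC : C.Nonempty := ⟨⊤, top_ne_bot, fun _ _ _ => trivial, fun _ _ _ => trivial⟩
  obtain ⟨U, ⟨hb, hU, hact⟩, hmin⟩ := wellFounded_lt.has_min C hC
  refine ⟨U, hU, hact, (Submodule.nontrivial_iff_ne_bot).2 hb, fun X hX hXact => ?_⟩
  by_cases hX0 : X = ⊥
  · exact Or.inl hX0
  right
  have hm : X.map U.subtype ∈ C := by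
    refine ⟨fun h => hX0 ?_, ?_, ?_⟩
    · rw [eq_bot_iff]
      intro x hx
      have : (x : V) ∈ X.map U.subtype := ⟨x, hx, rfl⟩
      rw [h, Submodule.mem_bot] at this
      simpa using this
    · rintro _ ⟨x, hx, rfl⟩ p
      refine ⟨_, hX x hx p, ?_⟩
      refine LinearMap.congr_fun (f := U.subtype ∘ₗ (N.toSuperSpace.restrict U hU).proj p)
        (g := N.proj p ∘ₗ U.subtype) ((N.toSuperSpace.restrict U hU).hom_ext fun q v hv => ?_) x
      have hv' : (v : V) ∈ N.part q := hv
      by_cases hpq : p = q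
      · subst hpq
        simp [(N.toSuperSpace.restrict U hU).proj_of_mem hv, N.proj_of_mem hv']
      · simp [(N.toSuperSpace.restrict U hU).proj_of_mem_ne hpq hv, N.proj_of_mem_ne hpq hv']
    · rintro x _ ⟨u, hu, rfl⟩
      exact ⟨_, hXact x u hu, rfl⟩
  have hle : X.map U.subtype ≤ U := Submodule.map_subtype_le _ _
  have heq : X.map U.subtype = U := by
    by_contra hne
    exact hmin _ hm (lt_of_le_of_ne hle hne)
  rw [eq_top_iff]
  rintro u -
  have : (u : V) ∈ X.map U.subtype := by rw [heq]; exact u.2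
  obtain ⟨v, hv, h⟩ := this
  rwa [← Subtype.ext h]

end General

variable {k g A V : Type*} [Field k] [AddCommGroup g] [Module k g] [CommRing A]
  [Algebra k A] [AddCommGroup V] [Module k V] {L : LieSuperalgebra k g}

/-- A module over `g ⊗ A` on which `g ⊗ I` acts by zero is a module over `g ⊗ (A / I)`. -/
theorem exists_descend (P : LieSuperModule (L.map A) V) (I : Ideal A)
    (hI : ∀ x : g, ∀ b ∈ I, ∀ v, P.act (x ⊗ₜ b) v = 0) :
    ∃ Q : LieSuperModule (L.map (A ⧸ I)) V, Q.toSuperSpace = P.toSuperSpace ∧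
      ∀ z, Q.act ((Ideal.Quotient.mkₐ k I).toLinearMap.lTensor g z) = P.act z := by
  -- A linear section of `A → A ⧸ I` suffices: it need not be multiplicative, as the error lies in
  -- `I` and acts by zero.
  obtain ⟨σ, hσ⟩ := LinearMap.exists_rightInverse_of_surjective
    (Ideal.Quotient.mkₐ k I).toLinearMap
    (LinearMap.range_eq_top.2 (Ideal.Quotient.mkₐ_surjective k I))
  set π := (Ideal.Quotient.mkₐ k I).toLinearMap with hπ
  have hπσ : ∀ z, π.lTensor g (σ.lTensor g z) = z := fun z => by
    rw [← LinearMap.comp_apply, ← LinearMap.lTensor_comp, hσ, LinearMap.lTensor_id,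
      LinearMap.id_apply]
  have hact : ∀ z, P.act (σ.lTensor g (π.lTensor g z)) = P.act z := by
    intro z
    induction z with
    | zero => simp
    | add x y hx hy => simp only [map_add, hx, hy]
    | tmul x a =>
      rw [LinearMap.lTensor_tmul, LinearMap.lTensor_tmul, ← sub_eq_zero, ← map_sub,
        ← TensorProduct.tmul_sub]
      refine LinearMap.ext fun v => hI x _ ?_ v
      rw [← Ideal.Quotient.eq_zero_iff_mem, map_sub, sub_eq_zero]
      exact LinearMap.congr_fun hσ (π a)
  have hpart : ∀ p, ∀ z ∈ (L.map (A ⧸ I)).part p, σ.lTensor g z ∈ (L.map A).part p := by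
    rintro p _ ⟨t, rfl⟩
    refine ⟨σ.lTensor _ t, ?_⟩
    rw [← LinearMap.comp_apply, ← LinearMap.comp_apply, LinearMap.rTensor_comp_lTensor,
      LinearMap.lTensor_comp_rTensor]
  have hbr : ∀ x y, π.lTensor g ((L.map A).bracket x y) =
      (L.map (A ⧸ I)).bracket (π.lTensor g x) (π.lTensor g y) := fun x y =>
    congrFun ((L.evalHom fun _ : Unit => I).map_bracket x y) ()
  refine ⟨{ toSuperSpace := P.toSuperSpace
            act := P.act ∘ₗ σ.lTensor g
            act_mem := fun p q x hx v hv => P.act_mem p q _ (hpart p x hx) v hv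
            act_bracket := fun p q x hx y hy v => ?_ }, rfl, hact⟩
  have h := P.act_bracket p q _ (hpart p x hx) _ (hpart q y hy) v
  rw [← hact, hbr, hπσ, hπσ] at h
  exact h

/-- The action of `g ⊗ A` obtained by composition with multiplication by an element of `A` which is
idempotent modulo the annihilator. -/
def site (N : LieSuperModule (L.map A) V) (a : A)
    (ha : ∀ (x : g) (b : A), N.act (x ⊗ₜ (a * a * b)) = N.act (x ⊗ₜ (a * b))) :
    LieSuperModule (L.map A) V where
  toSuperSpace := N.toSuperSpace
  act := N.act ∘ₗ (LinearMap.mulLeft k a).lTensor g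
  act_mem := by
    rintro p q _ ⟨t, rfl⟩ v hv
    refine N.act_mem p q _ ⟨(LinearMap.mulLeft k a).lTensor _ t, ?_⟩ v hv
    rw [← LinearMap.comp_apply, ← LinearMap.comp_apply, LinearMap.rTensor_comp_lTensor,
      LinearMap.lTensor_comp_rTensor]
  act_bracket := by
    rintro p q _ ⟨x, rfl⟩ _ ⟨y, rfl⟩ v
    induction x with
    | zero => simp
    | add x x' hx hx' =>
      simp only [map_add, LinearMap.add_apply, hx, hx', smul_add]; abel
    | tmul x b =>
      induction y with
      | zero => simp
      | add y y' hy hy' =>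
        simp only [map_add, LinearMap.add_apply, hy, hy', smul_add]; abel
      | tmul y c =>
        have h := N.act_bracket p q _ (L.tmul_mem_part x.2 (a * b)) _ (L.tmul_mem_part y.2 (a * c)) v
        rw [L.map_bracket_tmul, mul_mul_mul_comm, ha] at h
        simpa [L.map_bracket_tmul] using h

theorem site_act_tmul (N : LieSuperModule (L.map A) V) (a : A)
    (ha : ∀ (x : g) (b : A), N.act (x ⊗ₜ (a * a * b)) = N.act (x ⊗ₜ (a * b))) (x : g) (b : A) :
    (N.site a ha).act (x ⊗ₜ b) = N.act (x ⊗ₜ (a * b)) := rfl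

end LieSuperModule

/-! ### Supercommuting actions -/

/-- Linear maps from a Lie superalgebra to the operators on a super vector space which preserve the
grading, supercommute with each other, and act irreducibly together. -/
structure SupercommutingActions {k g V ι : Type*} [Field k] [AddCommGroup g] [Module k g]
    [AddCommGroup V] [Module k V] (L : LieSuperalgebra k g) (S : SuperSpace k V)
    (ρ : ι → g →ₗ[k] Module.End k V) : Prop where
  mem : ∀ i p q, ∀ x ∈ L.part p, ∀ v ∈ S.part q, ρ i x v ∈ S.part (p + q)
  comm : ∀ i j, i ≠ j → ∀ p q, ∀ x ∈ L.part p, ∀ y ∈ L.part q,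
    ρ i x * ρ j y = superSign k p q • (ρ j y * ρ i x)
  irreducible : ∀ U : Submodule k V, S.IsGraded U → (∀ i x, ∀ u ∈ U, ρ i x u ∈ U) → U = ⊥ ∨ U = ⊤

/-- The `p`-th power of the parity operator. -/
def SuperSpace.parityPow {k V : Type*} [Field k] [AddCommGroup V] [Module k V]
    (S : SuperSpace k V) (p : ZMod 2) : Module.End k V := if p = 1 then S.parityOp else 1

namespace SuperSpace

variable {k V : Type*} [Field k] [AddCommGroup V] [Module k V] (S : SuperSpace k V)

theorem parityPow_zero : S.parityPow 0 = 1 := rfl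

theorem parityPow_one : S.parityPow 1 = S.parityOp := rfl

theorem parityPow_mul_self (p : ZMod 2) : S.parityPow p * S.parityPow p = 1 := by
  rcases ZMod.two_cases p with rfl | rfl
  · rw [parityPow_zero, mul_one]
  · rw [parityPow_one, parityOp_mul_self]

theorem parityPow_mem {p : ZMod 2} {U : Submodule k V} (hU : S.IsGraded U) {u : V} (hu : u ∈ U) :
    S.parityPow p u ∈ U := by
  rcases ZMod.two_cases p with rfl | rfl
  · exact hu
  · exact S.parityOp_mem_of_isGraded hU hu

theorem parityOp_mul_of_mem {f : Module.End k V} {p : ZMod 2}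
    (hf : ∀ q, ∀ v ∈ S.part q, f v ∈ S.part (p + q)) :
    S.parityOp * f = superSign k 1 p • (f * S.parityOp) := by
  refine S.hom_ext fun q v hv => ?_
  have e : (1 + 1 : ZMod 2) = 0 := by decide
  simp only [LinearMap.smul_apply, Module.End.mul_apply, S.parityOp_of_mem hv,
    S.parityOp_of_mem (hf q v hv), map_smul, smul_smul]
  congr 1
  rcases ZMod.two_cases p with rfl | rfl <;> rcases ZMod.two_cases q with rfl | rfl <;>
    simp [superSign, e]

theorem mem_of_parityOp_mul [CharZero k] {f : Module.End k V} {p : ZMod 2}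
    (hf : S.parityOp * f = superSign k 1 p • (f * S.parityOp)) {q : ZMod 2} {v : V}
    (hv : v ∈ S.part q) : f v ∈ S.part (q + p) := by
  rw [mem_part_iff]
  have h := LinearMap.congr_fun hf v
  simp only [LinearMap.smul_apply, Module.End.mul_apply, S.parityOp_of_mem hv, map_smul,
    smul_smul] at h
  rw [h]
  congr 1
  have e : (1 + 1 : ZMod 2) = 0 := by decide
  rcases ZMod.two_cases p with rfl | rfl <;> rcases ZMod.two_cases q with rfl | rfl <;>
    simp [superSign, e]

end SuperSpace

namespace SupercommutingActions

variable {k g V ι : Type*} [Field k] [AddCommGroup g] [Module k g]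
  [AddCommGroup V] [Module k V] {L : LieSuperalgebra k g} {S : SuperSpace k V}
  {ρ : ι → g →ₗ[k] Module.End k V}

theorem parityOp_mul (h : SupercommutingActions L S ρ) (i : ι) {p : ZMod 2} {x : g}
    (hx : x ∈ L.part p) : S.parityOp * ρ i x = superSign k 1 p • (ρ i x * S.parityOp) :=
  S.parityOp_mul_of_mem fun q v hv => h.mem i p q x hx v hv

/-- Twisting an operator of parity `p` by the `p`-th power of the parity operator turns
supercommutation into commutation, which passes from generators to the algebra they generate. -/
theorem commute_parityPow (h : SupercommutingActions L S ρ) {i j : ι} (hij : i ≠ j) {p : ZMod 2}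
    {x : g} (hx : x ∈ L.part p) {r : Module.End k V}
    (hr : r ∈ Algebra.adjoin k (Set.range (ρ j))) : Commute (ρ i x * S.parityPow p) r := by
  have hgen : ∀ q, ∀ y ∈ L.part q, Commute (ρ i x * S.parityPow p) (ρ j y) := by
    intro q y hy
    change ρ i x * S.parityPow p * ρ j y = ρ j y * (ρ i x * S.parityPow p)
    rcases ZMod.two_cases p with rfl | rfl
    · rw [S.parityPow_zero, mul_one, h.comm i j hij 0 q x hx y hy]
      simp [superSign]
    · rw [S.parityPow_one, mul_assoc, h.parityOp_mul j hy, mul_smul_comm, ← mul_assoc,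
        h.comm i j hij 1 q x hx y hy, smul_mul_assoc, smul_smul, SuperSpace.sign_mul_self, one_smul,
        mul_assoc]
  induction hr using Algebra.adjoin_induction with
  | mem r hr =>
    obtain ⟨y, rfl⟩ := hr
    rw [← L.proj_add_proj y, map_add]
    exact (hgen 0 _ (L.proj_mem 0 y)).add_right (hgen 1 _ (L.proj_mem 1 y))
  | algebraMap c => exact Algebra.commute_algebraMap_right _ _
  | add r s _ _ hr hs => exact hr.add_right hs
  | mul r s _ _ hr hs => exact hr.mul_right hs

theorem conj_mem (h : SupercommutingActions L S ρ) (j : ι) {r : Module.End k V}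
    (hr : r ∈ Algebra.adjoin k (Set.range (ρ j))) :
    S.parityOp * r * S.parityOp ∈ Algebra.adjoin k (Set.range (ρ j)) := by
  induction hr using Algebra.adjoin_induction with
  | mem r hr =>
    obtain ⟨y, rfl⟩ := hr
    rw [← L.proj_add_proj y, map_add, mul_add, add_mul, h.parityOp_mul j (L.proj_mem 0 y),
      h.parityOp_mul j (L.proj_mem 1 y), smul_mul_assoc, smul_mul_assoc, mul_assoc, mul_assoc,
      S.parityOp_mul_self, mul_one, mul_one]
    exact Subalgebra.add_mem _
      (Subalgebra.smul_mem _ (Algebra.subset_adjoin (Set.mem_range_self _)) _)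
      (Subalgebra.smul_mem _ (Algebra.subset_adjoin (Set.mem_range_self _)) _)
  | algebraMap c =>
    rw [← Algebra.commutes, mul_assoc, S.parityOp_mul_self, mul_one]
    exact Subalgebra.algebraMap_mem _ c
  | add r s _ _ hr hs => rw [mul_add, add_mul]; exact Subalgebra.add_mem _ hr hs
  | mul r s _ _ hr hs =>
    have : S.parityOp * (r * s) * S.parityOp =
        S.parityOp * r * S.parityOp * (S.parityOp * s * S.parityOp) := by
      simp only [mul_assoc]
      rw [← mul_assoc S.parityOp S.parityOp, S.parityOp_mul_self, one_mul]
    rw [this]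
    exact Subalgebra.mul_mem _ hr hs

/-- This is the source of the Koszul signs: moving `ρ i x` to the right past `r` conjugates `r` by a
power of the parity operator. -/
theorem mul_eq_conj_mul (h : SupercommutingActions L S ρ) {i j : ι} (hij : i ≠ j) {p : ZMod 2}
    {x : g} (hx : x ∈ L.part p) {r : Module.End k V}
    (hr : r ∈ Algebra.adjoin k (Set.range (ρ j))) :
    ρ i x * r = S.parityPow p * r * S.parityPow p * ρ i x := by
  have hconj : S.parityPow p * r * S.parityPow p ∈ Algebra.adjoin k (Set.range (ρ j)) := by
    rcases ZMod.two_cases p with rfl | rfl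
    · simpa [S.parityPow_zero] using hr
    · rw [S.parityPow_one]
      exact h.conj_mem j hr
  have h1 := (h.commute_parityPow hij hx hconj).eq
  have h2 := congrArg (· * S.parityPow p) h1
  simp only [mul_assoc, S.parityPow_mul_self, mul_one] at h2
  rw [← mul_assoc (S.parityPow p) (S.parityPow p), S.parityPow_mul_self, one_mul] at h2
  rw [h2]
  simp only [mul_assoc]

variable [CharZero k]

/-- The algebra generated by one of the actions is faithful on each of its nonzero graded
modules. -/
theorem eq_zero_of_forall_mem (h : SupercommutingActions L S ρ) {j : ι} {U : Submodule k V}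
    (hU0 : U ≠ ⊥) (hUgr : S.IsGraded U) (hU : ∀ x, ∀ u ∈ U, ρ j x u ∈ U) {r : Module.End k V}
    (hr : r ∈ Algebra.adjoin k (Set.range (ρ j))) (hrU : ∀ u ∈ U, r u = 0) : r = 0 := by
  let R := Algebra.adjoin k (Set.range (ρ j))
  -- `X` consists of the vectors killed by every `s` in `R` that vanishes on `U`. It contains `U`
  -- and is graded and stable under all actions: for `ρ j` because `s * ρ j x` again vanishes on
  -- `U`, for the others by commutation up to parity. Hence it is all of `V`.
  let X : Submodule k V := ⨅ s : {s // s ∈ R ∧ ∀ u ∈ U, s u = 0}, LinearMap.ker (s : Module.End k V)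
  have hX : ∀ v, v ∈ X ↔ ∀ s ∈ R, (∀ u ∈ U, s u = 0) → s v = 0 := by
    intro v
    simp [X, Submodule.mem_iInf]
  have hXP : ∀ v ∈ X, S.parityOp v ∈ X := by
    intro v hv
    rw [hX] at hv ⊢
    intro s hs hsU
    have h1 := hv _ (h.conj_mem j hs) fun u hu => by
      rw [Module.End.mul_apply, Module.End.mul_apply, hsU _ (S.parityOp_mem_of_isGraded hUgr hu),
        map_zero]
    have h2 := congrArg S.parityOp h1
    rwa [Module.End.mul_apply, Module.End.mul_apply, S.parityOp_parityOp, map_zero] at h2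
  have hXgr : S.IsGraded X := S.isGraded_of_parityOp_mem hXP
  have hst : ∀ i x, ∀ v ∈ X, ρ i x v ∈ X := by
    intro i x v hv
    by_cases hij : i = j
    · subst hij
      rw [hX]
      intro s hs hsU
      exact (hX v).1 hv (s * ρ i x) (Subalgebra.mul_mem _ hs
        (Algebra.subset_adjoin (Set.mem_range_self x))) fun u hu => hsU _ (hU x u hu)
    · have key : ∀ p, ∀ y ∈ L.part p, ρ i y v ∈ X := by
        intro p y hy
        rw [hX]
        intro s hs hsU
        have h1 := (h.commute_parityPow hij hy hs).eq
        have h2 := LinearMap.congr_fun h1 (S.parityPow p v)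
        have h3 : S.parityPow p (S.parityPow p v) = v :=
          LinearMap.congr_fun (S.parityPow_mul_self p) v
        simp only [Module.End.mul_apply, h3] at h2
        rw [← h2, (hX _).1 (S.parityPow_mem hXgr hv) s hs hsU, map_zero, map_zero]
      rw [← L.proj_add_proj x, map_add]
      exact X.add_mem (key 0 _ (L.proj_mem 0 x)) (key 1 _ (L.proj_mem 1 x))
  rcases h.irreducible X hXgr hst with h0 | h0
  · refine absurd ?_ hU0
    rw [eq_bot_iff, ← h0]
    intro u hu
    exact (hX u).2 fun s _ hs => hs u hu
  · have : ∀ v, r v = 0 := fun v => (hX v).1 (by rw [h0]; trivial) r hr hrU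
    exact LinearMap.ext this

variable [IsAlgClosed k] [Module.Finite k V]

/-- The matrix units in the algebra generated by one of the actions. -/
theorem exists_matrixUnits (h : SupercommutingActions L S ρ) {j : ι} {W : Submodule k V}
    (hW0 : W ≠ ⊥) (hWgr : S.IsGraded W) (hW : ∀ x, ∀ w ∈ W, ρ j x w ∈ W)
    (hirr : ∀ X : Submodule k W, (∀ x, ∀ u : W, u ∈ X → ⟨ρ j x u, hW x u u.2⟩ ∈ X) →
      X = ⊥ ∨ X = ⊤) :
    ∃ (p : ZMod 2) (w : W) (τ : W →ₗ[k] Module.End k V), (w : V) ∈ S.part p ∧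
      (∀ u, τ u ∈ Algebra.adjoin k (Set.range (ρ j))) ∧
      (∀ x u, ρ j x * τ u = τ ⟨ρ j x u, hW x u u.2⟩) ∧
      (∀ u, S.parityOp * τ u * S.parityOp = superSign k 1 p • τ ((S.restrict W hWgr).parityOp u)) ∧
      (∀ e : Module.Dual k W, ∃ s ∈ Algebra.adjoin k (Set.range (ρ j)), ∀ u,
        s * τ u = e u • τ w) ∧ τ w ≠ 0 := by
  set R := Algebra.adjoin k (Set.range (ρ j)) with hR
  have hntW : Nontrivial W := Submodule.nontrivial_iff_ne_bot.2 hW0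
  have huniq : ∀ r ∈ R, ∀ s ∈ R, (∀ w ∈ W, r w = s w) → r = s := fun r hr s hs hrs => by
    rw [← sub_eq_zero]
    exact h.eq_zero_of_forall_mem hW0 hWgr hW (Subalgebra.sub_mem _ hr hs) fun w hw => by
      rw [LinearMap.sub_apply, hrs w hw, sub_self]
  -- By Burnside's theorem every operator on `W` is the restriction of an element of `R`, and by
  -- faithfulness of only one. The inverse of restriction is the multiplicative map `B` below.
  let R' : Subalgebra k (Module.End k W) :=
    { carrier := {T | ∃ r ∈ R, ∀ w : W, r w = T w}
      mul_mem' := by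
        rintro T T' ⟨r, hr, h1⟩ ⟨r', hr', h1'⟩
        exact ⟨r * r', R.mul_mem hr hr', fun w => by
          rw [Module.End.mul_apply, h1', h1, Module.End.mul_apply]⟩
      add_mem' := by
        rintro T T' ⟨r, hr, h1⟩ ⟨r', hr', h1'⟩
        exact ⟨r + r', R.add_mem hr hr', fun w => by
          rw [LinearMap.add_apply, h1', h1, LinearMap.add_apply, Submodule.coe_add]⟩
      algebraMap_mem' := fun c => ⟨algebraMap k _ c, R.algebraMap_mem c, fun w => rfl⟩ }
  have hR' : R' = ⊤ := by
    refine Subalgebra.eq_top_of_irreducible R' fun X hX => hirr X fun x u hu => ?_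
    refine hX ((ρ j x).restrict (hW x)) ⟨ρ j x, Algebra.subset_adjoin (Set.mem_range_self x),
      fun w => rfl⟩ u hu
  have hex : ∀ T : Module.End k W, ∃ r ∈ R, ∀ w : W, r w = T w := fun T => by
    have : T ∈ R' := by rw [hR']; trivial
    exact this
  choose β hβR hβ using hex
  let B : Module.End k W →ₗ[k] Module.End k V :=
    { toFun := β
      map_add' := fun T T' => huniq _ (hβR _) _ (R.add_mem (hβR _) (hβR _)) fun w hw => by
        rw [LinearMap.add_apply, hβ _ ⟨w, hw⟩, hβ _ ⟨w, hw⟩, hβ _ ⟨w, hw⟩, LinearMap.add_apply,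
          Submodule.coe_add]
      map_smul' := fun c T => huniq _ (hβR _) _ (R.smul_mem (hβR _) _) fun w hw => by
        rw [RingHom.id_apply, LinearMap.smul_apply, hβ _ ⟨w, hw⟩, hβ _ ⟨w, hw⟩,
          LinearMap.smul_apply, Submodule.coe_smul] }
  have hB : ∀ T (w : W), B T w = T w := hβ
  have hBR : ∀ T, B T ∈ R := hβR
  have hBmul : ∀ r ∈ R, ∀ T T' : Module.End k W, (∀ w : W, r (T w) = T' w) → r * B T = B T' :=
    fun r hr T T' hrT => huniq _ (R.mul_mem hr (hBR _)) _ (hBR _) fun w hw => by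
      rw [Module.End.mul_apply, hB _ ⟨w, hw⟩, hB _ ⟨w, hw⟩, hrT]
  set SW := S.restrict W hWgr with hSW
  obtain ⟨v, hv⟩ := exists_ne (0 : W)
  obtain ⟨p, hp⟩ := SW.exists_proj_ne_zero hv
  set w := SW.proj p v with hw
  have hwp : w ∈ SW.part p := SW.proj_mem p v
  obtain ⟨f₁, hf₁⟩ : ∃ f₁ : Module.Dual k W, f₁ w ≠ 0 := by
    by_contra! hcon
    exact hp ((Module.forall_dual_apply_eq_zero_iff k w).1 hcon)
  let f₀ : Module.Dual k W := (f₁ w)⁻¹ • f₁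
  -- A homogeneous functional with `f w = 1`. The rank one operators `f ⊗ u` form a copy of `W` in
  -- `End W`, and `e ⊗ w` takes `f ⊗ u` to `e u • (f ⊗ w)`.
  let f : Module.Dual k W := f₀ ∘ₗ SW.proj p
  have hfw : f w = 1 := by
    simp only [f, LinearMap.comp_apply, SW.proj_of_mem hwp]
    exact inv_mul_cancel₀ hf₁
  have hfP : ∀ u, f (SW.parityOp u) = superSign k 1 p • f u := by
    refine fun u => LinearMap.congr_fun (f := f ∘ₗ SW.parityOp) (g := superSign k 1 p • f)
      (SW.hom_ext fun q u hu => ?_) u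
    rw [LinearMap.comp_apply, SW.parityOp_of_mem hu, map_smul, LinearMap.smul_apply]
    by_cases hpq : p = q
    · rw [hpq]
    · simp [f, SW.proj_of_mem_ne hpq hu]
  let τ : W →ₗ[k] Module.End k V := B ∘ₗ LinearMap.smulRightₗ f
  have hτ : ∀ u, τ u = B (f.smulRight u) := fun u => rfl
  refine ⟨p, w, τ, hwp, fun u => hBR _, fun x u => ?_, fun u => ?_, fun e => ?_, fun h0 => ?_⟩
  · refine hBmul _ (Algebra.subset_adjoin (Set.mem_range_self x)) _ _ fun w' => ?_
    simp
  · rw [hτ, hτ, ← map_smul]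
    refine huniq _ (h.conj_mem j (hBR _)) _ (hBR _) fun w' hw' => ?_
    have h1 : S.parityOp w' = (SW.parityOp ⟨w', hw'⟩ : W) :=
      (S.coe_restrict_parityOp W hWgr ⟨w', hw'⟩).symm
    rw [Module.End.mul_apply, Module.End.mul_apply, h1, hB, hB _ ⟨w', hw'⟩,
      ← S.coe_restrict_parityOp W hWgr]
    have h2 := hfP ⟨w', hw'⟩
    rw [hSW] at h2
    simp [h2, smul_smul, hSW]
  · refine ⟨B (e.smulRight w), hBR _, fun u => ?_⟩
    rw [hτ, hτ, ← map_smul]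
    refine hBmul _ (hBR _) _ _ fun w' => ?_
    rw [hB]
    simp [smul_smul, mul_comm]
  · have h1 := hB (f.smulRight w) w
    rw [← hτ, h0] at h1
    simp [hfw] at h1
    exact hp (Subtype.ext h1.symm)

end SupercommutingActions

/-! ### Products of operators -/

/-- This computes the action on a product of matrix units: `x` passes the factors before the `i`-th,
altering each, and is absorbed by the `i`-th. -/
theorem List.mul_prod_ofFn_of_pass {M : Type*} [Monoid M] {n : ℕ} {t t' : Fin n → M} {x : M}
    (i : Fin n) (hlt : ∀ j < i, x * t j = t' j * x) (heq : x * t i = t' i)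
    (hgt : ∀ j > i, t j = t' j) : x * (List.ofFn t).prod = (List.ofFn t').prod := by
  induction n with
  | zero => exact i.elim0
  | succ n ih =>
    rw [List.ofFn_succ, List.ofFn_succ, List.prod_cons, List.prod_cons]
    refine Fin.cases (fun _ heq hgt => ?_) (fun i hlt heq hgt => ?_) i hlt heq hgt
    · rw [← mul_assoc, heq]
      congr 3
      exact funext fun j => hgt _ j.succ_pos
    · rw [← mul_assoc, hlt 0 i.succ_pos, mul_assoc]
      congr 1
      exact ih i (fun j hj => hlt _ (Fin.succ_lt_succ_iff.2 hj)) heq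
        fun j hj => hgt _ (Fin.succ_lt_succ_iff.2 hj)

theorem List.commute_prod_left {M : Type*} [Monoid M] {l : List M} {x : M}
    (h : ∀ y ∈ l, Commute y x) : Commute l.prod x := by
  induction l with
  | nil => exact Commute.one_left x
  | cons y l ih =>
    rw [List.prod_cons]
    exact (h y List.mem_cons_self).mul_left (ih fun z hz => h z (List.mem_cons_of_mem _ hz))

/-- In reversed order `s 0` meets `t 0` first; the resulting `ε 0` commutes with the remaining `s j`
and moves to the front, leaving a shorter product. -/
theorem List.prod_reverse_ofFn_mul_prod_ofFn {k R : Type*} [CommRing k] [Ring R] [Algebra k R]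
    {n : ℕ} {s t ε : Fin n → R} {c : Fin n → k} (hst : ∀ i, s i * t i = c i • ε i)
    (hcomm : ∀ i j, i ≠ j → Commute (s j) (ε i)) :
    (List.ofFn s).reverse.prod * (List.ofFn t).prod = (∏ i, c i) • (List.ofFn ε).prod := by
  induction n with
  | zero => simp
  | succ n ih =>
    have h1 : Commute (List.ofFn fun i : Fin n => s i.succ).reverse.prod (ε 0) := by
      refine List.commute_prod_left fun y hy => ?_
      rw [List.mem_reverse, List.mem_ofFn] at hy
      obtain ⟨j, rfl⟩ := hy
      exact hcomm _ _ (Fin.succ_ne_zero j).symm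
    have h2 := ih (s := fun i => s i.succ) (t := fun i => t i.succ) (ε := fun i => ε i.succ)
      (c := fun i => c i.succ) (fun i => hst _)
      fun i j hij => hcomm _ _ fun h => hij (Fin.succ_injective _ h)
    rw [List.ofFn_succ, List.ofFn_succ, List.ofFn_succ, List.reverse_cons, List.prod_append,
      List.prod_cons, List.prod_cons, List.prod_cons, List.prod_nil, mul_one, mul_assoc,
      ← mul_assoc (s 0), hst, smul_mul_assoc, mul_smul_comm, ← mul_assoc, h1.eq, mul_assoc, h2,
      mul_smul_comm, smul_smul, Fin.prod_univ_succ]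

namespace SuperSpace

variable {k V : Type*} [Field k] [AddCommGroup V] [Module k V] (S : SuperSpace k V)

theorem prod_ofFn_mem {n : ℕ} {t : Fin n → Module.End k V} {d : Fin n → ZMod 2}
    (ht : ∀ i q, ∀ v ∈ S.part q, t i v ∈ S.part (q + d i)) {q : ZMod 2} {v : V}
    (hv : v ∈ S.part q) : (List.ofFn t).prod v ∈ S.part (q + ∑ i, d i) := by
  induction n with
  | zero => simpa using hv
  | succ n ih =>
    rw [List.ofFn_succ, List.prod_cons, Fin.sum_univ_succ, add_comm (d 0), ← add_assoc]
    exact ht 0 _ _ (ih fun i => ht i.succ)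

end SuperSpace

namespace SupercommutingActions

variable {k g V ι : Type*} [Field k] [AddCommGroup g] [Module k g]
  [AddCommGroup V] [Module k V] {L : LieSuperalgebra k g} {S : SuperSpace k V}
  {ρ : ι → g →ₗ[k] Module.End k V}

theorem commute_of_even (h : SupercommutingActions L S ρ) {i j : ι} (hij : i ≠ j) (x : g)
    {r : Module.End k V} (hr : r ∈ Algebra.adjoin k (Set.range (ρ j)))
    (hP : S.parityOp * r * S.parityOp = r) : Commute (ρ i x) r := by
  have key : ∀ p, ∀ x ∈ L.part p, Commute (ρ i x) r := by
    intro p x hx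
    have h1 := h.mul_eq_conj_mul hij hx hr
    rcases ZMod.two_cases p with rfl | rfl
    · rwa [S.parityPow_zero, one_mul, mul_one] at h1
    · rwa [S.parityPow_one, hP] at h1
  rw [← L.proj_add_proj x, map_add]
  exact (key 0 _ (L.proj_mem 0 x)).add_left (key 1 _ (L.proj_mem 1 x))

theorem commute_adjoin_of_even (h : SupercommutingActions L S ρ) {i j : ι} (hij : i ≠ j)
    {s r : Module.End k V} (hs : s ∈ Algebra.adjoin k (Set.range (ρ i)))
    (hr : r ∈ Algebra.adjoin k (Set.range (ρ j)))
    (hP : S.parityOp * r * S.parityOp = r) : Commute s r := by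
  induction hs using Algebra.adjoin_induction with
  | mem s hs => obtain ⟨x, rfl⟩ := hs; exact h.commute_of_even hij x hr hP
  | algebraMap c => exact Algebra.commute_algebraMap_left _ _
  | add r s _ _ hr hs => exact hr.add_left hs
  | mul r s _ _ hr hs => exact hr.mul_left hs

/-- By induction, the range of the product of the later `ε j` is nonzero. It is graded and stable
under the `i`-th action since even elements of the other algebras commute with it, and a nonzero `ε
i` cannot vanish there by faithfulness. -/
theorem map_prod_ne_bot [CharZero k] (h : SupercommutingActions L S ρ) {ε : ι → Module.End k V}
    (hε : ∀ i, ε i ∈ Algebra.adjoin k (Set.range (ρ i)))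
    (hP : ∀ i, S.parityOp * ε i * S.parityOp = ε i) (hε0 : ∀ i, ε i ≠ 0) [Nontrivial V] (l : List ι)
    (hl : l.Nodup) : LinearMap.range (l.map ε).prod ≠ ⊥ := by
  induction l with
  | nil =>
    rw [List.map_nil, List.prod_nil]
    exact fun h0 => one_ne_zero (LinearMap.range_eq_bot.1 h0)
  | cons i l ih =>
    obtain ⟨hil, hl⟩ := List.nodup_cons.1 hl
    have hcomm : Commute (l.map ε).prod S.parityOp := by
      refine List.commute_prod_left fun y hy => ?_
      obtain ⟨j, -, rfl⟩ := List.mem_map.1 hy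
      change ε j * S.parityOp = S.parityOp * ε j
      conv_lhs => rw [← hP j]
      rw [mul_assoc, S.parityOp_mul_self, mul_one]
    intro h0
    rw [List.map_cons, List.prod_cons] at h0
    refine hε0 i (h.eq_zero_of_forall_mem (ih hl) (S.isGraded_of_parityOp_mem ?_) ?_ (hε i) ?_)
    · rintro _ ⟨v, rfl⟩
      exact ⟨S.parityOp v, LinearMap.congr_fun hcomm.eq v⟩
    · rintro x _ ⟨v, rfl⟩
      have hx : Commute (l.map ε).prod (ρ i x) := by
        refine List.commute_prod_left fun y hy => ?_
        obtain ⟨j, hj, rfl⟩ := List.mem_map.1 hy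
        have hij : i ≠ j := fun hij => hil (by rwa [hij])
        exact (h.commute_of_even hij x (hε j) (hP j)).symm
      exact ⟨ρ i x v, LinearMap.congr_fun hx.eq v⟩
    · rintro _ ⟨v, rfl⟩
      exact LinearMap.congr_fun (LinearMap.range_eq_bot.1 h0) v

end SupercommutingActions

namespace SuperSpace

variable {k V : Type*} [Field k] [AddCommGroup V] [Module k V]

theorem isGraded_range {V' : Type*} [AddCommGroup V'] [Module k V'] (S' : SuperSpace k V')
    (S : SuperSpace k V) {f : V' →ₗ[k] V} (hf : ∀ p, ∀ t ∈ S'.part p, f t ∈ S.part p) :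
    S.IsGraded (LinearMap.range f) := by
  rintro _ ⟨t, rfl⟩ p
  refine ⟨S'.proj p t, LinearMap.congr_fun (f := f ∘ₗ S'.proj p) (g := S.proj p ∘ₗ f)
    (S'.hom_ext fun q v hv => ?_) t⟩
  by_cases hpq : p = q
  · subst hpq
    simp [S'.proj_of_mem hv, S.proj_of_mem (hf p v hv)]
  · simp [S'.proj_of_mem_ne hpq hv, S.proj_of_mem_ne hpq (hf q v hv)]

end SuperSpace

/-! ### Tensor product decomposition -/

namespace SupercommutingActions

open PiTensorProduct

variable {k g V : Type*} [Field k] [CharZero k] [AddCommGroup g] [Module k g]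
  [AddCommGroup V] [Module k V] {L : LieSuperalgebra k g} {S : SuperSpace k V} {n : ℕ}
  {ρ : Fin (n + 1) → g →ₗ[k] Module.End k V}

/-- A space with supercommuting actions is the tensor product of irreducible modules for them. -/
theorem exists_tensorEquiv [IsAlgClosed k] [Module.Finite k V] [Nontrivial V]
    (h : SupercommutingActions L S ρ) (W : Fin (n + 1) → Submodule k V) (hW0 : ∀ i, W i ≠ ⊥)
    (hWgr : ∀ i, S.IsGraded (W i)) (hW : ∀ i x, ∀ w ∈ W i, ρ i x w ∈ W i)
    (hirr : ∀ i, ∀ X : Submodule k (W i),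
      (∀ x, ∀ u : W i, u ∈ X → ⟨ρ i x u, hW i x u u.2⟩ ∈ X) → X = ⊥ ∨ X = ⊤) :
    ∃ (c : Fin (n + 1) → ZMod 2) (e : (⨂[k] i, W i) ≃ₗ[k] V),
      (∀ p, ∀ t ∈ (SuperSpace.tensor fun i => (S.restrict (W i) (hWgr i)).shift (c i)).part p,
        e t ∈ S.part p) ∧
      ∀ i p, ∀ x ∈ L.part p, ∀ u : ∀ i, W i, e (tprod k (Function.update
        (fun j => if j < i ∧ p = 1 then ((S.restrict (W j) (hWgr j)).shift (c j)).parityOp (u j)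
          else u j) i ⟨ρ i x (u i), hW i x _ (u i).2⟩)) = ρ i x (e (tprod k u)) := by
  choose d w τ hwd hτR hτρ hτP hτs hτw using fun i =>
    h.exists_matrixUnits (hW0 i) (hWgr i) (hW i) (hirr i)
  have hsign : ∀ p q : ZMod 2, superSign k 1 p * (superSign k 1 (q + p)) = superSign k 1 q := by
    intro p q
    have e : (1 + 1 : ZMod 2) = 0 := by decide
    rcases ZMod.two_cases p with rfl | rfl <;> rcases ZMod.two_cases q with rfl | rfl <;>
      simp [superSign, e]
  have hτmem : ∀ i (q : ZMod 2) (u : W i), (u : V) ∈ S.part (q + d i) → ∀ r, ∀ v ∈ S.part r,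
      τ i u v ∈ S.part (r + q) := by
    intro i q u hu r v hv
    refine S.mem_of_parityOp_mul ?_ hv
    have h1 := hτP i u
    rw [(S.restrict (W i) (hWgr i)).parityOp_of_mem (q := q + d i) hu, map_smul, smul_smul,
      hsign] at h1
    rw [← smul_mul_assoc, ← h1, mul_assoc, S.parityOp_mul_self, mul_one]
  let ε : Fin (n + 1) → Module.End k V := fun i => τ i (w i)
  have hεP : ∀ i, S.parityOp * ε i * S.parityOp = ε i := by
    intro i
    have h1 := hτP i (w i)
    have h2 := hsign (d i) 0
    rw [zero_add] at h2
    rw [(S.restrict (W i) (hWgr i)).parityOp_of_mem (q := d i) (hwd i), map_smul, smul_smul,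
      h2] at h1
    simpa [superSign] using h1
  have hεprod : (List.ofFn ε).prod ≠ 0 := by
    intro h0
    refine h.map_prod_ne_bot (ε := ε) (fun i => hτR i _) hεP hτw (List.finRange (n + 1))
      (List.nodup_finRange _) ?_
    rw [← List.ofFn_eq_map, h0, LinearMap.range_zero]
  obtain ⟨r, v₀, hv₀, hεv₀⟩ : ∃ r, ∃ v₀ ∈ S.part r, (List.ofFn ε).prod v₀ ≠ 0 := by
    by_contra! hcon
    exact hεprod (S.hom_ext fun r v hv => by rw [hcon r v hv, LinearMap.zero_apply])
  -- The isomorphism sends `u_0 ⊗ ⋯ ⊗ u_n` to `τ_0(u_0) ⋯ τ_n(u_n) v₀`, where `v₀` is not killed by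
  -- the product of the even operators `ε i = τ i (w i)`.
  let M : MultilinearMap k (fun i => W i) (Module.End k V) :=
    (MultilinearMap.mkPiAlgebraFin k (n + 1) (Module.End k V)).compLinearMap τ
  have hM : ∀ u, M u = (List.ofFn fun i => τ i (u i)).prod := fun u => rfl
  let T : (⨂[k] i, W i) →ₗ[k] Module.End k V := PiTensorProduct.lift M
  have hT : ∀ u : ∀ i, W i, T (tprod k u) = (List.ofFn fun i => τ i (u i)).prod := fun u => by
    rw [PiTensorProduct.lift.tprod, hM]
  let Φ : (⨂[k] i, W i) →ₗ[k] V := T.flip v₀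
  have hΦ : ∀ t, Φ t = T t v₀ := fun t => rfl
  -- With `W i` shifted by `d i`, the operator `τ i u` has the parity of `u`. The parity `r` of `v₀`
  -- is absorbed by the last factor, which no Koszul sign involves.
  let c : Fin (n + 1) → ZMod 2 := fun i => d i + if i = Fin.last n then r else 0
  have hΦmem : ∀ p, ∀ t ∈ (SuperSpace.tensor fun i =>
      (S.restrict (W i) (hWgr i)).shift (c i)).part p, Φ t ∈ S.part p := by
    intro p t ht
    change t ∈ SuperSpace.tensorPart _ p at ht
    induction ht using Submodule.span_induction with
    | zero => rw [map_zero]; exact Submodule.zero_mem _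
    | add x y _ _ hx hy => rw [map_add]; exact Submodule.add_mem _ hx hy
    | smul a x _ hx => rw [map_smul]; exact Submodule.smul_mem _ _ hx
    | mem t ht =>
      obtain ⟨q, u, hu, rfl, rfl⟩ := ht
      rw [hΦ, hT]
      have h1 := S.prod_ofFn_mem (t := fun i => τ i (u i))
        (d := fun i => q i + if i = Fin.last n then r else 0)
        (fun i s v hv => hτmem i _ (u i) (by
          have h2 : (u i : V) ∈ S.part (q i + c i) := hu i
          rwa [show q i + c i = q i + (if i = Fin.last n then r else 0) + d i by
            simp only [c]; ring] at h2) s v hv) hv₀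
      rwa [Finset.sum_add_distrib, Finset.sum_ite_eq' Finset.univ, if_pos (Finset.mem_univ _),
        add_comm, add_assoc, CharTwo.add_self_eq_zero, add_zero] at h1
  have hΦact : ∀ i p, ∀ x ∈ L.part p, ∀ u : ∀ i, W i, Φ (tprod k (Function.update
        (fun j => if j < i ∧ p = 1 then ((S.restrict (W j) (hWgr j)).shift (c j)).parityOp (u j)
          else u j) i ⟨ρ i x (u i), hW i x _ (u i).2⟩)) = ρ i x (Φ (tprod k u)) := by
    intro i p x hx u
    rw [hΦ, hΦ, hT, hT, ← Module.End.mul_apply]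
    congr 1
    refine (List.mul_prod_ofFn_of_pass i (fun j hj => ?_) ?_ fun j hj => ?_).symm
    · rw [h.mul_eq_conj_mul hj.ne' hx (hτR j _), Function.update_of_ne hj.ne]
      congr 1
      have hcj : c j = d j := by
        simp only [c]
        rw [if_neg (hj.trans_le (Fin.le_last i)).ne, add_zero]
      rcases ZMod.two_cases p with rfl | rfl
      · simp [S.parityPow_zero]
      · rw [S.parityPow_one, hτP, if_pos ⟨hj, rfl⟩, SuperSpace.shift_parityOp, hcj,
          LinearMap.smul_apply, map_smul]
    · rw [Function.update_self, hτρ]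
    · rw [Function.update_of_ne hj.ne', if_neg fun hh => (hh.1.trans hj).false]
  have hΦstab : ∀ i x, ∀ v ∈ LinearMap.range Φ, ρ i x v ∈ LinearMap.range Φ := by
    have key : ∀ i p, ∀ x ∈ L.part p, ∀ t, ρ i x (Φ t) ∈ LinearMap.range Φ := by
      intro i p x hx t
      induction t using PiTensorProduct.induction_on with
      | smul_tprod a u =>
        rw [map_smul, map_smul, ← hΦact i p x hx u]
        exact Submodule.smul_mem _ _ ⟨_, rfl⟩
      | add s t hs ht => rw [map_add, map_add]; exact Submodule.add_mem _ hs ht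
    rintro i x _ ⟨t, rfl⟩
    rw [← L.proj_add_proj x, map_add]
    exact Submodule.add_mem _ (key i 0 _ (L.proj_mem 0 x) t) (key i 1 _ (L.proj_mem 1 x) t)
  have hsurj : Function.Surjective Φ := by
    rw [← LinearMap.range_eq_top]
    refine (h.irreducible _ (SuperSpace.isGraded_range _ S hΦmem) hΦstab).resolve_left fun h0 => ?_
    refine hεv₀ ?_
    have h1 : Φ (tprod k w) = 0 := by rw [LinearMap.range_eq_bot.1 h0, LinearMap.zero_apply]
    rwa [hΦ, hT] at h1
  have hinj : Function.Injective Φ := by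
    rw [← LinearMap.ker_eq_bot, eq_bot_iff]
    intro t ht
    let b := fun i => Module.finBasis k (W i)
    choose σ hσR hσ using fun i => hτs i
    -- Products of matrix units extract the coordinates of a tensor: `s a` times the image of `t` is
    -- the coordinate of `t` at `a` times the product of the `ε i`, which does not kill `v₀`.
    let s : (∀ i, Fin (Module.finrank k (W i))) → Module.End k V := fun a =>
      (List.ofFn fun i => σ i ((b i).coord (a i))).reverse.prod
    have hs : ∀ a t, s a * T t = (Basis.piTensorProduct b).repr t a • (List.ofFn ε).prod := by
      intro a t
      induction t using PiTensorProduct.induction_on with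
      | smul_tprod z u =>
        rw [map_smul, mul_smul_comm, hT, map_smul, Finsupp.smul_apply, smul_eq_mul, ← smul_smul,
          Basis.piTensorProduct_repr_tprod_apply]
        congr 1
        exact List.prod_reverse_ofFn_mul_prod_ofFn (fun i => hσ i _ _) fun i j hij =>
          h.commute_adjoin_of_even hij.symm (hσR j _) (hτR i _) (hεP i)
      | add t t' ht ht' => rw [map_add, mul_add, ht, ht', map_add, Finsupp.add_apply, add_smul]
    rw [Submodule.mem_bot, ← (Basis.piTensorProduct b).repr.map_eq_zero_iff]
    ext a
    have h1 := LinearMap.congr_fun (hs a t) v₀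
    rw [Module.End.mul_apply, ← hΦ, LinearMap.mem_ker.1 ht, map_zero, LinearMap.smul_apply] at h1
    exact (smul_eq_zero.1 h1.symm).resolve_right hεv₀
  exact ⟨c, LinearEquiv.ofBijective Φ ⟨hinj, hsurj⟩, hΦmem, hΦact⟩

end SupercommutingActions

theorem SuperSpace.mem_part_of_equiv {k V V' : Type*} [Field k] [CharZero k] [AddCommGroup V]
    [Module k V] [AddCommGroup V'] [Module k V'] (S' : SuperSpace k V') (S : SuperSpace k V)
    {e : V' ≃ₗ[k] V} (he : ∀ p, ∀ t ∈ S'.part p, e t ∈ S.part p) {p : ZMod 2} {v : V}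
    (hv : v ∈ S.part p) : e.symm v ∈ S'.part p := by
  have h : e.toLinearMap ∘ₗ S'.parityOp = S.parityOp ∘ₗ e.toLinearMap :=
    S'.hom_ext fun q t ht => by
      simp [S'.parityOp_of_mem ht, S.parityOp_of_mem (he q t ht)]
  rw [S'.mem_part_iff, ← e.injective.eq_iff]
  have h1 := LinearMap.congr_fun h (e.symm v)
  simp only [LinearMap.comp_apply, LinearEquiv.coe_coe, LinearEquiv.apply_symm_apply] at h1
  rw [h1, S.parityOp_of_mem hv, map_smul, LinearEquiv.apply_symm_apply]

theorem Ideal.exists_orthogonal {A ι : Type*} [CommRing A] [Finite ι] (I : ι → Ideal A)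
    (hI : Pairwise (Function.onFun IsCoprime I)) :
    ∃ a : ι → A, (∀ i, a i - 1 ∈ I i) ∧ ∀ i j, i ≠ j → a i ∈ I j := by
  classical
  choose a ha using fun i =>
    Ideal.exists_forall_sub_mem_ideal hI fun j => if j = i then (1 : A) else 0
  refine ⟨a, fun i => by simpa using ha i i, fun i j hij => ?_⟩
  simpa [hij.symm] using ha i j

theorem MaximalSpectrum.pairwise_isCoprime_pow {A ι : Type*} [CommRing A] {m : ι → MaximalSpectrum A}
    (hm : Function.Injective m) (n : ι → ℕ) :
    Pairwise (Function.onFun IsCoprime fun i => (m i).asIdeal ^ n i) := fun i j hij => by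
  have := (m i).isMaximal
  have := (m j).isMaximal
  exact IsCoprime.pow (Ideal.isCoprime_iff_sup_eq.2 (Ideal.IsMaximal.coprime_of_ne ‹_› ‹_›
    fun h => hij (hm (MaximalSpectrum.ext h))))

/-! ### Splitting the action along coprime ideals -/

namespace LieSuperModule

open PiTensorProduct

variable {k g A V : Type*} [Field k] [AddCommGroup g] [Module k g] [CommRing A]
  [Algebra k A] [AddCommGroup V] [Module k V] {L : LieSuperalgebra k g}

/-- The bracket of `x ⊗ a c` and `y ⊗ b d` is a multiple of `a b` in the second factor, so it acts
by zero. -/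
theorem site_act_mul_site_act {N : LieSuperModule (L.map A) V} {a b : A}
    (ha : ∀ (x : g) (c : A), N.act (x ⊗ₜ (a * a * c)) = N.act (x ⊗ₜ (a * c)))
    (hb : ∀ (x : g) (c : A), N.act (x ⊗ₜ (b * b * c)) = N.act (x ⊗ₜ (b * c)))
    (hab : ∀ (x : g) (c : A), N.act (x ⊗ₜ (a * b * c)) = 0) {p q : ZMod 2} {x y : g ⊗[k] A}
    (hx : x ∈ (L.map A).part p) (hy : y ∈ (L.map A).part q) (v : V) :
    (N.site a ha).act x ((N.site b hb).act y v) =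
      superSign k p q • (N.site b hb).act y ((N.site a ha).act x v) := by
  obtain ⟨x, rfl⟩ := hx
  obtain ⟨y, rfl⟩ := hy
  induction x with
  | zero => simp
  | add x x' hx hx' => simp only [map_add, LinearMap.add_apply, hx, hx', smul_add]
  | tmul x c =>
    induction y with
    | zero => simp
    | add y y' hy hy' => simp only [map_add, LinearMap.add_apply, hy, hy', smul_add]
    | tmul y d =>
      have h := N.act_bracket p q _ (L.tmul_mem_part x.2 (a * c)) _ (L.tmul_mem_part y.2 (b * d)) v
      rw [L.map_bracket_tmul, mul_mul_mul_comm, hab, LinearMap.zero_apply] at h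
      exact sub_eq_zero.1 h.symm

theorem supercommutingActions_site {N : LieSuperModule (L.map A) V} (hN : N.IsIrreducible)
    {ι : Type*} [Fintype ι] {a : ι → A}
    (ha : ∀ i (x : g) (c : A), N.act (x ⊗ₜ (a i * a i * c)) = N.act (x ⊗ₜ (a i * c)))
    (hab : ∀ i j, i ≠ j → ∀ (x : g) (c : A), N.act (x ⊗ₜ (a i * a j * c)) = 0)
    (hsum : ∀ z, ∑ i, (N.site (a i) (ha i)).act z = N.act z) :
    SupercommutingActions (L.map A) N.toSuperSpace fun i => (N.site (a i) (ha i)).act where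
  mem i p q x hx v hv := (N.site (a i) (ha i)).act_mem p q x hx v hv
  comm i j hij p q x hx y hy := LinearMap.ext fun v =>
    site_act_mul_site_act (ha i) (ha j) (hab i j hij) hx hy v
  irreducible U hU hact := hN.2 U hU fun x u hu => by
    rw [← hsum, LinearMap.sum_apply]
    exact Submodule.sum_mem _ fun i _ => hact i x u hu

end LieSuperModule

namespace LieSuperModule

open PiTensorProduct

universe u v w x

variable {k : Type u} {g : Type v} {A : Type w} {V : Type x} [Field k] [IsAlgClosed k] [CharZero k]
  [AddCommGroup g] [Module k g] [Module.Finite k g] [CommRing A] [Algebra k A] [AddCommGroup V]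
  [Module k V] [Module.Finite k V] {L : LieSuperalgebra k g}

/-- An irreducible module annihilated by an intersection of powers of distinct maximal ideals is a
generalized evaluation module at these ideals. -/
theorem IsIrreducible.isEvaluationAt {N : LieSuperModule (L.map A) V} (hN : N.IsIrreducible)
    (hL : L.IsReductive ∨ L.IsBasicClassical ∨ ∃ n : ℕ, 1 ≤ n ∧ L.IsIsomorphic (slSuper k n))
    {ℓ : ℕ} {m : Fin (ℓ + 1) → MaximalSpectrum A} (hm : Function.Injective m)
    {n : Fin (ℓ + 1) → ℕ}
    (hact : ∀ x : g, ∀ f ∈ ⨅ i, (m i).asIdeal ^ n i, N.act (x ⊗ₜ f) = 0) :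
    N.IsEvaluationAt m n := by
  have hnt := hN.1
  let I : Fin (ℓ + 1) → Ideal A := fun i => (m i).asIdeal ^ n i
  -- Modulo the intersection of the `I i` the elements `a i` are orthogonal idempotents with sum 1,
  -- so the action of `g ⊗ A` is the sum of its sites.
  obtain ⟨a, ha1, ha0⟩ := Ideal.exists_orthogonal I (MaximalSpectrum.pairwise_isCoprime_pow hm n)
  have hmem : ∀ b, b ∈ ⨅ i, I i ↔ ∀ i, b ∈ I i := fun b => by simp
  have haI : ∀ i, ∀ b ∈ I i, a i * b ∈ ⨅ i, I i := fun i b hb => by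
    rw [hmem]
    intro j
    by_cases hij : i = j
    · exact Ideal.mul_mem_left _ _ (hij ▸ hb)
    · exact Ideal.mul_mem_right _ _ (ha0 i j hij)
  have hcongr : ∀ (x : g) (b c : A), b - c ∈ ⨅ i, I i → N.act (x ⊗ₜ b) = N.act (x ⊗ₜ c) :=
    fun x b c h => by
      rw [← sub_eq_zero, ← map_sub, ← TensorProduct.tmul_sub]
      exact hact x _ h
  have ha : ∀ i (x : g) (b : A), N.act (x ⊗ₜ (a i * a i * b)) = N.act (x ⊗ₜ (a i * b)) :=
    fun i x b => hcongr x _ _ (by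
      have h := haI i _ (Ideal.mul_mem_right b _ (ha1 i))
      rwa [show a i * ((a i - 1) * b) = a i * a i * b - a i * b by ring] at h)
  have hab : ∀ i j, i ≠ j → ∀ (x : g) (b : A), N.act (x ⊗ₜ (a i * a j * b)) = 0 :=
    fun i j hij x b => hact x _ (by
      rw [mul_assoc]
      exact haI i _ (Ideal.mul_mem_right b _ (ha0 j i hij.symm)))
  have hone : ∑ i, a i - 1 ∈ ⨅ i, I i := by
    rw [hmem]
    intro j
    rw [← Finset.add_sum_erase _ _ (Finset.mem_univ j), add_sub_right_comm]
    exact Ideal.add_mem _ (ha1 j) (Ideal.sum_mem _ fun i hi => ha0 i j (Finset.ne_of_mem_erase hi))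
  have hsum : ∀ z, ∑ i, (N.site (a i) (ha i)).act z = N.act z := by
    intro z
    induction z with
    | zero => simp
    | add x y hx hy => simp only [map_add, Finset.sum_add_distrib, hx, hy]
    | tmul x b =>
      simp only [site_act_tmul]
      rw [← map_sum, ← TensorProduct.tmul_sum, ← Finset.sum_mul]
      refine hcongr x _ _ ?_
      rw [show (∑ i, a i) * b - b = (∑ i, a i - 1) * b by ring]
      exact Ideal.mul_mem_right _ _ hone
  choose W hWgr hW hirr using fun i => (N.site (a i) (ha i)).exists_irreducible_submodule
  obtain ⟨c, e, hemem, heact⟩ := (supercommutingActions_site hN ha hab hsum).exists_tensorEquiv W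
    (fun i => Submodule.nontrivial_iff_ne_bot.1 (hirr i).1) hWgr hW
    fun i X hX => (hirr i).eq_bot_or_eq_top hL hX
  -- Since `a i * b` lies in the intersection for `b` in `I i`, the `i`-th site is a module over `g
  -- ⊗ (A ⧸ I i)`.
  choose Q hQS hQact using fun i =>
    ((((N.site (a i) (ha i)).restrict (W i) (hWgr i) (hW i)).shift (c i)).exists_descend (I i)
      fun x b hb u => Subtype.ext (LinearMap.congr_fun (hact x _ (haI i b hb)) (u : V)))
  refine ⟨fun i => W i, inferInstance, inferInstance, Q, inferInstance, e.symm, fun p v hv => ?_,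
    fun z v => ?_⟩
  · have hS : (fun i => (Q i).toSuperSpace) = fun i =>
        (N.toSuperSpace.restrict (W i) (hWgr i)).shift (c i) := funext hQS
    change e.symm v ∈ (SuperSpace.tensor fun i => (Q i).toSuperSpace).part p
    rw [hS]
    exact SuperSpace.mem_part_of_equiv _ _ hemem hv
  · have key : ∀ p, ∀ z ∈ (L.map A).part p, ∀ t, e (((outerTensor Q).pullback
        (L.evalHom fun i => (m i).asIdeal ^ n i)).act z t) = N.act z (e t) := by
      intro p z hz t
      change e (tensorAct Q ((L.evalHom I).toLinearMap z) t) = _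
      rw [tensorAct_of_mem Q ((L.evalHom I).map_mem p z hz), LinearMap.sum_apply, map_sum, ← hsum,
        LinearMap.sum_apply]
      refine Finset.sum_congr rfl fun i _ => ?_
      induction t using PiTensorProduct.induction_on with
      | smul_tprod b u =>
        simp only [map_smul]
        congr 1
        rw [← heact i p z hz u, siteOp_apply, PiTensorProduct.map_tprod]
        congr 2
        funext j
        by_cases hj : j = i
        · subst hj
          rw [Function.update_self, Function.update_self]
          exact LinearMap.congr_fun (hQact j z) (u j)
        · rw [Function.update_of_ne hj, Function.update_of_ne hj, koszulOp, hQS j]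
          split_ifs <;> rfl
      | add s t hs ht => simp only [map_add, hs, ht]
    rw [LinearEquiv.symm_apply_eq]
    conv_lhs => rw [← e.apply_symm_apply v]
    rw [← (L.map A).proj_add_proj z]
    simp only [map_add, LinearMap.add_apply, key 0 _ ((L.map A).proj_mem 0 z),
      key 1 _ ((L.map A).proj_mem 1 z)]

end LieSuperModule

/-! ### Ideals with finitely many maximal ideals above them -/

namespace MaximalSpectrum

theorem mem_range_of_iInf_pow_le {A ι : Type*} [CommRing A] [Finite ι] {m : ι → MaximalSpectrum A}
    {n : ι → ℕ} {M : MaximalSpectrum A} (h : ⨅ i, (m i).asIdeal ^ n i ≤ M.asIdeal) :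
    M ∈ Set.range m := by
  cases nonempty_fintype ι
  have hM := M.isMaximal.isPrime
  have h1 : ∏ i, (m i).asIdeal ^ n i ≤ M.asIdeal :=
    (Ideal.prod_le_inf.trans (le_of_eq (Finset.inf_univ_eq_iInf _))).trans h
  obtain ⟨i, -, hi⟩ := hM.prod_le.1 h1
  exact ⟨i, MaximalSpectrum.ext ((m i).isMaximal.eq_of_le hM.ne_top (Ideal.IsPrime.le_of_pow_le hi))⟩

/-- Ideals containing a finite intersection of maximal ideals are radical. -/
theorem isRadical_of_iInf_le {A ι : Type*} [CommRing A] [Finite ι] {m : ι → MaximalSpectrum A}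
    (hm : Function.Injective m) {J : Ideal A} (h : ⨅ i, (m i).asIdeal ≤ J) : J.IsRadical := by
  rw [Ideal.isRadical_iff_pow_one_lt 2 one_lt_two]
  intro r hr
  -- Modulo the intersection, `A` is a product of fields, so `r` is a multiple of `r ^ 2`: take `y`
  -- to be 0 or an inverse of `r` in each field and glue.
  have hex : ∀ i, ∃ y, r * r * y - r ∈ (m i).asIdeal := fun i => by
    by_cases hri : r ∈ (m i).asIdeal
    · exact ⟨0, by simpa using hri⟩
    · obtain ⟨y, t, ht, hy⟩ := (m i).isMaximal.exists_inv hri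
      refine ⟨y, ?_⟩
      rw [show r * r * y - r = -(r * t) by linear_combination r * hy]
      exact neg_mem (Ideal.mul_mem_left _ _ ht)
  choose y hy using hex
  have hc := pairwise_isCoprime_pow hm fun _ => 1
  simp only [pow_one] at hc
  obtain ⟨s, hs⟩ := Ideal.exists_forall_sub_mem_ideal hc y
  have h1 : r * r * s - r ∈ ⨅ i, (m i).asIdeal := by
    rw [Ideal.mem_iInf]
    intro i
    rw [show r * r * s - r = r * r * (s - y i) + (r * r * y i - r) by ring]
    exact Ideal.add_mem _ (Ideal.mul_mem_left _ _ (hs i)) (hy i)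
  rw [show r = r ^ 2 * s - (r * r * s - r) by ring]
  exact Ideal.sub_mem _ (Ideal.mul_mem_right _ _ hr) (h h1)

/-- In a noetherian Jacobson ring, an ideal which is contained in only finitely many maximal ideals
contains an intersection of powers of these. -/
theorem exists_iInf_pow_le {A : Type*} [CommRing A] [Nontrivial A] [IsNoetherianRing A]
    [IsJacobsonRing A] {J : Ideal A} (hJ : {M : MaximalSpectrum A | J ≤ M.asIdeal}.Finite) :
    ∃ (ℓ : ℕ) (m : Fin (ℓ + 1) → MaximalSpectrum A), Function.Injective m ∧
      ⨅ i, (m i).asIdeal ≤ J.radical ∧ ∃ n, 1 ≤ n ∧ ⨅ i, (m i).asIdeal ^ n ≤ J := by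
  obtain ⟨M₀⟩ : Nonempty (MaximalSpectrum A) := inferInstance
  -- No maximal ideal lies above `J` if `g ⊗ A` acts by zero, while the empty tensor product is an
  -- even line and cannot match an odd one. An arbitrary `M₀` is added so that there is at least one
  -- factor; this only shrinks the intersection.
  have hfin := hJ.insert M₀
  have := hfin.to_subtype
  have hcard : Nat.card (insert M₀ {M : MaximalSpectrum A | J ≤ M.asIdeal} : Set _) ≠ 0 :=
    Nat.card_ne_zero.2 ⟨⟨⟨M₀, Set.mem_insert _ _⟩⟩, inferInstance⟩
  obtain ⟨ℓ, hℓ⟩ := Nat.exists_eq_succ_of_ne_zero hcard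
  let φ := (Finite.equivFinOfCardEq hℓ).symm
  let m : Fin (ℓ + 1) → MaximalSpectrum A := fun i => φ i
  have hm : Function.Injective m := Subtype.val_injective.comp φ.injective
  have hrad : ⨅ i, (m i).asIdeal ≤ J.radical := by
    rw [Ideal.radical_eq_jacobson]
    refine le_sInf fun M ⟨hJM, hM⟩ => ?_
    refine (iInf_le _ (φ.symm ⟨⟨M, hM⟩, Set.mem_insert_of_mem _ hJM⟩)).trans (le_of_eq ?_)
    simp [m]
  refine ⟨ℓ, m, hm, hrad, ?_⟩
  obtain ⟨n, hn⟩ := J.exists_radical_pow_le_of_fg (IsNoetherian.noetherian _)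
  -- The exponent `n` may be 0, but evaluation modules need positive exponents.
  refine ⟨n + 1, Nat.le_add_left 1 n, ?_⟩
  have h1 := Ideal.prod_eq_iInf_of_pairwise_isCoprime (s := Finset.univ)
    (J := fun i => (m i).asIdeal ^ (n + 1)) fun i _ j _ hij => pairwise_isCoprime_pow hm _ hij
  simp only [Finset.mem_univ, iInf_pos] at h1
  rw [← h1, Finset.prod_pow]
  have h2 : ∏ i, (m i).asIdeal ≤ ⨅ i, (m i).asIdeal :=
    Ideal.prod_le_inf.trans (le_of_eq (Finset.inf_univ_eq_iInf _))
  exact (Ideal.pow_right_mono (h2.trans hrad) _).trans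
    ((Ideal.pow_le_pow_right n.le_succ).trans hn)

/-- By Zariski's lemma the residue fields are finite over `k`, hence equal to it. -/
theorem isRational_of_isAlgClosed (k : Type*) {A : Type*} [Field k] [IsAlgClosed k] [CommRing A]
    [Algebra k A] [Algebra.FiniteType k A] (m : MaximalSpectrum A) : m.IsRational k := by
  have := m.isMaximal
  let := Ideal.Quotient.field m.asIdeal
  have := finite_of_finite_type_of_isJacobsonRing k (A ⧸ m.asIdeal)
  exact IsAlgClosed.algebraMap_bijective_of_isIntegral

end MaximalSpectrum

/-! ### Annihilators of evaluation modules and the main theorem -/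

namespace LieSuperModule

variable {k g A V : Type*} [Field k] [AddCommGroup g] [Module k g] [CommRing A]
  [Algebra k A] [AddCommGroup V] [Module k V] {L : LieSuperalgebra k g}

theorem act_tmul_of_mem_annihilator (N : LieSuperModule (L.map A) V) (x : g) {f : A}
    (hf : f ∈ N.annihilator) : N.act (x ⊗ₜ f) = 0 := by
  rw [annihilator, sSup_eq_iSup'] at hf
  induction hf using Submodule.iSup_induction' with
  | mem I f hf => exact LinearMap.ext fun v => I.2 x f hf v
  | zero => simp
  | add f f' _ _ hf hf' => rw [TensorProduct.tmul_add, map_add, hf, hf', add_zero]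

theorem IsEvaluationAt.iInf_le_annihilator [CharZero k] {N : LieSuperModule (L.map A) V} {ℓ : ℕ}
    {m : Fin ℓ → MaximalSpectrum A} {n : Fin ℓ → ℕ} (h : N.IsEvaluationAt m n) :
    ⨅ i, (m i).asIdeal ^ n i ≤ N.annihilator := by
  refine le_sSup fun x f hf v => ?_
  obtain ⟨W, _, _, P, -, e, -, he⟩ := h
  have h0 : (L.evalHom fun i => (m i).asIdeal ^ n i).toLinearMap (x ⊗ₜ f) = 0 := by
    funext i
    change x ⊗ₜ[k] Ideal.Quotient.mk _ f = 0
    rw [Ideal.Quotient.eq_zero_iff_mem.2 (Ideal.mem_iInf.1 hf i), TensorProduct.tmul_zero]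
  rw [← e.map_eq_zero_iff, he]
  change (outerTensor P).act ((L.evalHom fun i => (m i).asIdeal ^ n i).toLinearMap (x ⊗ₜ f)) _ = 0
  rw [h0, map_zero, LinearMap.zero_apply]

theorem IsEvaluationAt.finite_support [CharZero k] {N : LieSuperModule (L.map A) V} {ℓ : ℕ}
    {m : Fin ℓ → MaximalSpectrum A} {n : Fin ℓ → ℕ} (h : N.IsEvaluationAt m n) :
    N.support.Finite :=
  (Set.finite_range m).subset fun _ hM =>
    MaximalSpectrum.mem_range_of_iInf_pow_le (h.iInf_le_annihilator.trans hM)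

end LieSuperModule
end

theorem mainTheorem9 {k : Type*} [Field k] [IsAlgClosed k] [CharZero k]
    {g : Type*} [AddCommGroup g] [Module k g] [Module.Finite k g] (L : LieSuperalgebra k g)
    (hL : L.IsReductive ∨ L.IsBasicClassical ∨ ∃ n : ℕ, 1 ≤ n ∧ L.IsIsomorphic (slSuper k n))
    {A : Type*} [CommRing A] [Algebra k A] [Algebra.FiniteType k A] [Nontrivial A]
    {V : Type*} [AddCommGroup V] [Module k V] [Module.Finite k V]
    (N : LieSuperModule (L.map A) V) (hN : N.IsIrreducible) :
    (N.IsGeneralizedEvaluation ↔ N.support.Finite) ∧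
    (N.IsEvaluation ↔ N.support.Finite ∧ N.HasReducedSupport) := by
  have : IsNoetherianRing A := Algebra.FiniteType.isNoetherianRing k A
  have : IsJacobsonRing A := isJacobsonRing_of_finiteType (A := k)
  have hrat : ∀ m : MaximalSpectrum A, m.IsRational k := fun m => m.isRational_of_isAlgClosed k
  refine ⟨⟨?_, fun hfin => ?_⟩, ⟨?_, fun ⟨hfin, hred⟩ => ?_⟩⟩
  · rintro ⟨ℓ, m, n, -, -, -, h⟩
    exact h.finite_support
  · obtain ⟨ℓ, m, hm, -, n, hn, hle⟩ := MaximalSpectrum.exists_iInf_pow_le hfin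
    exact ⟨ℓ + 1, m, fun _ => n, hm, fun i => hrat _, fun _ => hn,
      hN.isEvaluationAt hL hm fun x f hf => N.act_tmul_of_mem_annihilator x (hle hf)⟩
  · rintro ⟨ℓ, m, hm, -, h⟩
    refine ⟨h.finite_support, MaximalSpectrum.isRadical_of_iInf_le hm ?_⟩
    simpa using h.iInf_le_annihilator
  -- A radical annihilator equals its radical, which already contains the intersection of the
  -- maximal ideals themselves, so all exponents can be 1.
  · obtain ⟨ℓ, m, hm, hle, -⟩ := MaximalSpectrum.exists_iInf_pow_le hfin
    refine ⟨ℓ + 1, m, hm, fun i => hrat _, hN.isEvaluationAt hL hm fun x f hf =>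
      N.act_tmul_of_mem_annihilator x (hred (hle ?_))⟩
    simpa using hf
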